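/- **Conventions.** $\mathbb N=\{1,2,\dots\}$; $\mathbb K$ is $\mathbb R$ or $\mathbb C$; $X$ is a Banach space over $\mathbb K$ with closed unit ball $B_X$. A sequence of ordinals is non-empty and finite unless said otherwise; $\leqslant$ between sequences is the initial segment order; $MAX(T)$ is the set of $\leqslant$-maximal members of a set $T$ of sequences; $\gamma+(\zeta_j)_{j=1}^k=(\gamma+\zeta_j)_{j=1}^k$; $\smallfrown$ is concatenation. **Trees and coefficients.** For an ordinal $\xi$, $n\in\mathbb N$ and $1\leqslant i\leqslant n$, define recursively $\Gamma_{0,1}=\{(0)\}$; $$\Lambda_{\xi,n,i}=\{(\omega^\xi(n-1)+t_1)\smallfrown\cdots\smallfrown(\omega^\xi(n-i)+t_i): t_1,\dots,t_i\in\Gamma_{\xi,1},\ t_1,\dots,t_{i-1}\in MAX(\Gamma_{\xi,1})\},\qquad \Gamma_{\xi,n}=\bigcup_{i=1}^n\Lambda_{\xi,n,i};$$ $\Gamma_{\xi+1,1}=\bigcup_{n\in\mathbb N}\Gamma_{\xi,n}$; and $\Gamma_{\xi,1}=\bigcup_{\zeta<\xi}(\omega^\zeta+\Gamma_{\zeta+1,1})$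 for a limit ordinal $\xi$. (The unions over $n$ and over $\zeta$ are disjoint.) Define $\mathbb P_{\xi,n}:\Gamma_{\xi,n}\to[0,1]$ by $\mathbb P_{0,1}((0))=1$; $\mathbb P_{\xi,n}\big((\omega^\xi(n-1)+t_1)\smallfrown\cdots\smallfrown(\omega^\xi(n-i)+t_i)\big)=\mathbb P_{\xi,1}(t_i)$; $\mathbb P_{\xi+1,1}(t)=\frac1n\mathbb P_{\xi,n}(t)$ for $t\in\Gamma_{\xi,n}$; and $\mathbb P_{\xi,1}(\omega^\zeta+t)=\mathbb P_{\zeta+1,1}(t)$ for a limit $\xi$, $\zeta<\xi$ and $t\in\Gamma_{\zeta+1,1}$. For a non-empty directed set $D$ and a set $T$ of sequences of ordinals let $T.D=\{(\zeta_j,u_j)_{j=1}^k:(\zeta_j)_{j=1}^k\in T,\ u_j\in D\}$; put $\mathbb P_{\xi,n}((\zeta_j,u_j)_j)=\mathbb P_{\xi,n}((\zeta_j)_j)$ and $\gamma+(\zeta_j,u_j)_j=(\gamma+\zeta_j,u_j)_j$. **Cofinal sets.** For $\mathcal E\subset MAX(\Gamma_{\xi,n}.D)$, "$\mathcal E$ is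 cofinal in $\Gamma_{\xi,n}.D$" is defined recursively. $\mathcal E\subset\Gamma_{0,1}.D$ is cofinal if $\{u\in D:(0,u)\in\mathcal E\}$ is cofinal in $D$. If $\xi$ is a limit, $\mathcal E$ is cofinal in $\Gamma_{\xi,1}.D$ if the set of $\zeta<\xi$ for which $\{s\in MAX(\Gamma_{\zeta+1,1}.D):\omega^\zeta+s\in\mathcal E\}$ is cofinal in $\Gamma_{\zeta+1,1}.D$ is cofinal in $[0,\xi)$. $\mathcal E$ is cofinal in $\Gamma_{\xi+1,1}.D$ if $\mathcal E\cap\Gamma_{\xi,n}.D$ is cofinal in $\Gamma_{\xi,n}.D$ for infinitely many $n$. $\mathcal E$ is cofinal in $\Gamma_{\xi,n+1}.D$ if the set of those $t\in MAX(\Gamma_{\xi,1}.D)$ for which $\{s\in MAX(\Gamma_{\xi,n}.D):(\omega^\xi n+t)\smallfrown s\in\mathcal E\}$ is cofinal in $\Gamma_{\xi,n}.D$ is itself cofinal in $\Gamma_{\xi,1}.D$. **The quantities $\alpha$.** A collection $(x_t)_{t\in\Gamma_{\xi,n}.D}\subset X$ is weakly null if for all $t$ (possibly empty) and $\zeta$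 with $t\smallfrown(\zeta,u)\in\Gamma_{\xi,n}.D$ for $u\in D$, the net $(x_{t\smallfrown(\zeta,u)})_{u\in D}$ is weakly null. For $t\in MAX(\Gamma_{\xi,n}.D)$ and $1\leqslant i\leqslant n$ let $z_i^t=\sum_{\Lambda_{\xi,n,i}.D\ni s\leqslant t}\mathbb P_{\xi,n}(s)\,x_s$. For a weak$^*$-compact $K\subset X^*$ let $r_K(x)=\max_{x^*\in K}\mathrm{Re}\,x^*(x)$ if $K\ne\varnothing$, and $r_\varnothing=0$. For $1\leqslant p\leqslant\infty$, $\alpha_{\xi,p,n}(K)$ is the infimum of those $\alpha>0$ such that for every directed set $D$, every $(a_i)_{i=1}^n\in\mathbb K^n$ and every weakly null $(x_t)_{t\in\Gamma_{\xi,n}.D}\subset B_X$, $$\inf_{t\in MAX(\Gamma_{\xi,n}.D)}r_K\Big(\sum_{i=1}^na_iz_i^t\Big)\leqslant\alpha\,\|(a_i)_{i=1}^n\|_{\ell_p^n},$$ and $\alpha_{\xi,p}(K)=\sup_{n\in\mathbb N}\alpha_{\xi,p,n}(K)\in[0,\infty]$. **Szlenk index.** For $\varepsilon>0$ and a weak$^*$-compact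 $K\subset X^*$, $s_\varepsilon(K)$ is the set of $x^*\in K$ such that $\mathrm{diam}(V\cap K)>\varepsilon$ for every weak$^*$-neighbourhood $V$ of $x^*$; $s^0_\varepsilon(K)=K$, $s_\varepsilon^{\xi+1}(K)=s_\varepsilon(s_\varepsilon^\xi(K))$, and $s_\varepsilon^\xi(K)=\bigcap_{\zeta<\xi}s_\varepsilon^\zeta(K)$ for a limit $\xi$; $Sz(K,\varepsilon)$ is the least $\xi$ with $s_\varepsilon^\xi(K)=\varnothing$ ($\infty$ if there is none), and $Sz(K)=\sup_{\varepsilon>0}Sz(K,\varepsilon)$. **Theorem.** Let $X$ be a Banach space, $K\subset X^*$ weak$^*$-compact, $\xi$ an ordinal and $1\leqslant p\leqslant\infty$. (i) Let $n\in\mathbb N$ and $\alpha\in\mathbb R$. Then $\alpha_{\xi,p,n}(K)>\alpha$ if and only if there exist non-negative scalars $(a_i)_{i=1}^n\in B_{\ell_p^n}$, a directed set $D$, a weakly null collection $(x_t)_{t\in\Gamma_{\xi,n}.D}\subset B_X$ and $\alpha'>\alpha$ such that $$\Big\{t\in MAX(\Gamma_{\xi,n}.D): r_K\Big(\sum_{i=1}^n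 a_iz_i^t\Big)>\alpha'\Big\}$$ is cofinal in $\Gamma_{\xi,n}.D$. If moreover $K\neq\varnothing$ or $\alpha\geqslant0$, this holds if and only if there exist non-negative scalars $(a_i)_{i=1}^n\in B_{\ell_p^n}$, a directed set $D$, a weakly null collection $(x_t)_{t\in\Gamma_{\xi,n}.D}\subset B_X$, functionals $(x_t^*)_{t\in MAX(\Gamma_{\xi,n}.D)}\subset K$ and non-negative reals $b_1,\dots,b_n$ such that $\alpha<\sum_{i=1}^na_ib_i$ and $\mathrm{Re}\,x_t^*(x_s)\geqslant b_i$ whenever $1\leqslant i\leqslant n$ and $\Lambda_{\xi,n,i}.D\ni s\leqslant t\in MAX(\Gamma_{\xi,n}.D)$. (ii) $\alpha_{\xi,p,n}(K)=0$ for some $n\in\mathbb N$ if and only if $\alpha_{\xi,p,n}(K)=0$ for all $n\in\mathbb N$, if and only if $Sz(K)\leqslant\omega^\xi$. (iii) If $R\geqslant0$ and $K\subset RB_{X^*}$, then $\alpha_{\xi,p,n}(K)\leqslant n^{1-1/p}R$ for every $n\in\mathbb N$ (with $1/\infty=0$). (iv) $\alpha_{\xi,p,n}(K)=\alpha_{\xi,p,n}\big(\overline{\mathrm{abs\,co}}^{\,\mathrm{weak}^*}(K)\big)$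 for every $n\in\mathbb N$. Consequently $\alpha_{\xi,p}(K)=\alpha_{\xi,p}\big(\overline{\mathrm{abs\,co}}^{\,\mathrm{weak}^*}(K)\big)$. -/

import Mathlib

open Filter Topology Ordinal

universe u v

noncomputable section

namespace WeakNullTrees

/-! ### Trees of finite sequences -/

/-- The members of a set `T` of finite sequences that are maximal for the initial segment order. -/
def maxNodes {A : Type*} (T : Set (List A)) : Set (List A) :=
  {t | t ∈ T ∧ ∀ s ∈ T, t <+: s → s = t}

/-- `γ + (ζ₁, …, ζₖ) = (γ + ζ₁, …, γ + ζₖ)`. -/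
def shift (γ : Ordinal.{v}) (t : List Ordinal.{v}) : List Ordinal.{v} := t.map (γ + ·)

/-- The levels built from the tree `G = Γ_{ξ,1}`; the index `i` starts from `0`, so that
`levelsOf ξ G n i` is the level `Λ_{ξ,n,i+1}`, which consists of the concatenations
`(ω^ξ(n-1) + t₁) ⌢ ⋯ ⌢ (ω^ξ(n-i-1) + t_{i+1})` with all `tⱼ ∈ G` and `t₁, …, tᵢ ∈ MAX(G)`. -/
def levelsOf (ξ : Ordinal.{v}) (G : Set (List Ordinal.{v})) : ℕ → ℕ → Set (List Ordinal.{v})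
  | 0, _ => ∅
  | n + 1, 0 => {t | ∃ s ∈ G, t = shift (ω ^ ξ * n) s}
  | n + 1, i + 1 =>
      {t | ∃ s ∈ maxNodes G, ∃ r ∈ levelsOf ξ G n i, t = shift (ω ^ ξ * n) s ++ r}

/-- The tree `Γ_{ξ,1}`. -/
def gammaOne (ξ : Ordinal.{v}) : Set (List Ordinal.{v}) :=
  Ordinal.limitRecOn ξ
    {[0]}
    (fun ξ G => {t | ∃ n : ℕ, 1 ≤ n ∧ ∃ i < n, t ∈ levelsOf ξ G n i})
    (fun ξ hξ G => {t | ∃ ζ, ∃ h : ζ < ξ, ∃ s ∈ G (ζ + 1) (hξ.add_one_lt h), t = shift (ω ^ ζ) s})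

/-- The level `Λ_{ξ,n,i+1}` of `Γ_{ξ,n}`, for `i < n`. -/
def level (ξ : Ordinal.{v}) (n i : ℕ) : Set (List Ordinal.{v}) := levelsOf ξ (gammaOne ξ) n i

/-- The tree `Γ_{ξ,n}`, the union of its `n` levels. -/
def gamma (ξ : Ordinal.{v}) (n : ℕ) : Set (List Ordinal.{v}) := {t | ∃ i < n, t ∈ level ξ n i}

/-! ### The coefficients `ℙ_{ξ,n}` -/

/-- For `t = (ω^ξ(n-1) + t₁) ⌢ ⋯ ⌢ (ω^ξ(n-i) + tᵢ)` in `Γ_{ξ,n}`, this is `tᵢ`: the terms that have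
the same quotient by `ω^ξ` as the last one, reduced modulo `ω^ξ`. -/
def lastBlock (ξ : Ordinal.{v}) (t : List Ordinal.{v}) : List Ordinal.{v} :=
  (t.filter (fun o => decide (o / ω ^ ξ = t.getLastD 0 / ω ^ ξ))).map (· % ω ^ ξ)

open Classical in
/-- The coefficients `ℙ_{ξ,1}` on `Γ_{ξ,1}`: they are `1` on `Γ_{0,1}`; `ℙ_{ξ,n} / n` on the part
`Γ_{ξ,n}` of `Γ_{ξ+1,1}`; and for a limit `ξ` they are copied from `Γ_{ζ+1,1}` to `ω^ζ + Γ_{ζ+1,1}`.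
See `coeffOne_zero`, `coeffOne_add_one` and `coeffOne_limit`. -/
def coeffOne (ξ : Ordinal.{v}) : List Ordinal.{v} → ℝ :=
  Ordinal.limitRecOn ξ
    (fun _ => 1)
    (fun ξ P t =>
      if h : ∃ n : ℕ, t ∈ gamma ξ n then P (lastBlock ξ t) / (h.choose : ℝ) else 0)
    (fun ξ hξ P t =>
      if h : ∃ ζ, ζ < ξ ∧ ∃ s ∈ gammaOne (ζ + 1), t = shift (ω ^ ζ) s then
        P (h.choose + 1) (hξ.add_one_lt h.choose_spec.1) h.choose_spec.2.choose
      else 0)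

/-- The coefficient `ℙ_{ξ,n}(t)` for `t ∈ Γ_{ξ,n}`: if
`t = (ω^ξ(n-1) + t₁) ⌢ ⋯ ⌢ (ω^ξ(n-i) + tᵢ)`, it is `ℙ_{ξ,1}(tᵢ)` (the same formula for each `n`).
See `coeff_gammaOne`, `coeff_shift` and `coeff_append`. -/
def coeff (ξ : Ordinal.{v}) (t : List Ordinal.{v}) : ℝ := coeffOne ξ (lastBlock ξ t)

/-! ### The recursive description of the trees and of the coefficients -/

theorem gammaOne_zero : gammaOne (0 : Ordinal.{v}) = {[0]} := by
  simp [gammaOne]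

theorem gammaOne_add_one (ξ : Ordinal.{v}) :
    gammaOne (ξ + 1) = {t | ∃ n : ℕ, 1 ≤ n ∧ t ∈ gamma ξ n} := by
  rw [gammaOne, Ordinal.limitRecOn_add_one]
  rfl

theorem gammaOne_limit {ξ : Ordinal.{v}} (hξ : Order.IsSuccLimit ξ) :
    gammaOne ξ = {t | ∃ ζ < ξ, ∃ s ∈ gammaOne (ζ + 1), t = shift (ω ^ ζ) s} := by
  rw [gammaOne, Ordinal.limitRecOn_limit _ _ _ _ hξ]
  ext t
  constructor
  · rintro ⟨ζ, h, s, hs, e⟩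
    exact ⟨ζ, h, s, hs, e⟩
  · rintro ⟨ζ, h, s, hs, e⟩
    exact ⟨ζ, h, s, hs, e⟩

theorem opow_omega_ne_zero (ξ : Ordinal.{v}) : ω ^ ξ ≠ 0 :=
  (Ordinal.opow_pos ξ omega0_pos).ne'

theorem shift_div {ξ : Ordinal.{v}} {n : ℕ} {s : List Ordinal.{v}} (hs : ∀ o ∈ s, o < ω ^ ξ)
    {o : Ordinal.{v}} (ho : o ∈ shift (ω ^ ξ * n) s) : o / ω ^ ξ = n := by
  obtain ⟨a, ha, rfl⟩ := List.mem_map.1 ho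
  rw [Ordinal.mul_add_div _ (opow_omega_ne_zero ξ), Ordinal.div_eq_zero_of_lt (hs a ha), add_zero]

theorem shift_ne_nil {γ : Ordinal.{v}} {s : List Ordinal.{v}} (h : s ≠ []) : shift γ s ≠ [] := by
  simpa [shift] using h

theorem levelsOf_div_lt {ξ : Ordinal.{v}} {G : Set (List Ordinal.{v})}
    (hG : ∀ s ∈ G, s ≠ [] ∧ ∀ o ∈ s, o < ω ^ ξ) (n : ℕ) :
    ∀ i, ∀ t ∈ levelsOf ξ G n i, t ≠ [] ∧ ∀ o ∈ t, o / ω ^ ξ < n := by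
  induction n with
  | zero => intro i t ht; simp [levelsOf] at ht
  | succ n ih =>
    have key : ∀ s ∈ G, ∀ o ∈ shift (ω ^ ξ * n) s, o / ω ^ ξ < ((n + 1 : ℕ) : Ordinal.{v}) := by
      intro s hs o ho
      rw [shift_div (hG s hs).2 ho]
      exact_mod_cast Nat.lt_succ_self n
    intro i t ht
    cases i with
    | zero =>
      obtain ⟨s, hs, rfl⟩ := ht
      exact ⟨shift_ne_nil (hG s hs).1, key s hs⟩
    | succ i =>
      obtain ⟨s, hs, r, hr, rfl⟩ := ht
      refine ⟨by simp [shift_ne_nil (hG s hs.1).1], ?_⟩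
      intro o ho
      rcases List.mem_append.1 ho with ho | ho
      · exact key s hs.1 o ho
      · exact ((ih i r hr).2 o ho).trans (by exact_mod_cast Nat.lt_succ_self n)

theorem levelsOf_head {ξ : Ordinal.{v}} {G : Set (List Ordinal.{v})}
    (hG : ∀ s ∈ G, s ≠ [] ∧ ∀ o ∈ s, o < ω ^ ξ) {n i : ℕ} {t : List Ordinal.{v}}
    (ht : t ∈ levelsOf ξ G n i) : t.headD 0 / ω ^ ξ + 1 = n := by
  have key : ∀ (n : ℕ) (s r : List Ordinal.{v}), s ∈ G →
      (shift (ω ^ ξ * n) s ++ r).headD 0 / ω ^ ξ + 1 = ((n + 1 : ℕ) : Ordinal.{v}) := by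
    intro n s r hs
    have hne := (hG s hs).1
    have h := @shift_div ξ n s (hG s hs).2
    cases s with
    | nil => exact absurd rfl hne
    | cons a s =>
      have := @h (ω ^ ξ * n + a) (by simp [shift])
      simp [shift, this]
  cases n with
  | zero => simp [levelsOf] at ht
  | succ n =>
    cases i with
    | zero =>
      obtain ⟨s, hs, rfl⟩ := ht
      simpa using key n s [] hs
    | succ i =>
      obtain ⟨s, hs, r, hr, rfl⟩ := ht
      exact key n s r hs.1

/-- The members of `Γ_{ξ,1}` are non-empty sequences of ordinals smaller than `ω^ξ`. -/
theorem gammaOne_lt (ξ : Ordinal.{v}) : ∀ s ∈ gammaOne ξ, s ≠ [] ∧ ∀ o ∈ s, o < ω ^ ξ := by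
  induction ξ using Ordinal.limitRecOn with
  | zero => simp [gammaOne_zero]
  | add_one ξ ih =>
    rw [gammaOne_add_one]
    rintro t ⟨n, hn, i, hi, ht⟩
    obtain ⟨h1, h2⟩ := levelsOf_div_lt ih n i t ht
    refine ⟨h1, fun o ho => ?_⟩
    rw [Ordinal.opow_add_one]
    have := h2 o ho
    rw [← Ordinal.lt_mul_iff_div_lt (opow_omega_ne_zero ξ)] at this
    exact this.trans (mul_lt_mul_of_pos_left (natCast_lt_omega0 n) (Ordinal.opow_pos ξ omega0_pos))
  | limit ξ hξ ih =>
    rw [gammaOne_limit hξ]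
    rintro t ⟨ζ, hζ, s, hs, rfl⟩
    obtain ⟨h1, h2⟩ := ih (ζ + 1) (hξ.add_one_lt hζ) s hs
    refine ⟨shift_ne_nil h1, fun o ho => ?_⟩
    obtain ⟨a, ha, rfl⟩ := List.mem_map.1 ho
    refine Ordinal.isPrincipal_add_omega0_opow ξ ?_ ?_
    · exact (Ordinal.opow_lt_opow_iff_right one_lt_omega0).2 hζ
    · exact (h2 a ha).trans ((Ordinal.opow_lt_opow_iff_right one_lt_omega0).2 (hξ.add_one_lt hζ))

theorem gamma_one (ξ : Ordinal.{v}) : gamma ξ 1 = gammaOne ξ := by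
  ext t
  simp [gamma, level, levelsOf, shift]

/-- The trees `Γ_{ξ,n}` are pairwise disjoint for fixed `ξ`. -/
theorem gamma_unique {ξ : Ordinal.{v}} {m n : ℕ} {t : List Ordinal.{v}} (hm : t ∈ gamma ξ m)
    (hn : t ∈ gamma ξ n) : m = n := by
  obtain ⟨i, _, hi⟩ := hm
  obtain ⟨j, _, hj⟩ := hn
  exact_mod_cast (levelsOf_head (gammaOne_lt ξ) hi).symm.trans (levelsOf_head (gammaOne_lt ξ) hj)

theorem lastBlock_shift {ξ : Ordinal.{v}} {n : ℕ} {s : List Ordinal.{v}} (hs : s ∈ gammaOne ξ) :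
    lastBlock ξ (shift (ω ^ ξ * n) s) = s := by
  obtain ⟨h1, h2⟩ := gammaOne_lt ξ s hs
  have hd := @shift_div ξ n s h2
  have hl : (shift (ω ^ ξ * n) s).getLastD 0 / ω ^ ξ = n := by
    rw [List.getLastD_eq_getLast?, List.getLast?_eq_getLast_of_ne_nil (shift_ne_nil h1)]
    exact hd (List.getLast_mem _)
  rw [lastBlock, hl, List.filter_eq_self.2 (fun o ho => by simp [hd ho])]
  rw [shift, List.map_map]
  conv_rhs => rw [← List.map_id s]
  refine List.map_congr_left fun o ho => ?_
  simp [Ordinal.mul_add_mod_self, Ordinal.mod_eq_of_lt (h2 o ho)]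

theorem lastBlock_append {ξ : Ordinal.{v}} {n : ℕ} {s r : List Ordinal.{v}} (hs : s ∈ gammaOne ξ)
    (hr : r ∈ gamma ξ n) : lastBlock ξ (shift (ω ^ ξ * n) s ++ r) = lastBlock ξ r := by
  obtain ⟨i, _, hr⟩ := hr
  obtain ⟨h1, h2⟩ := levelsOf_div_lt (gammaOne_lt ξ) n i r hr
  have hd := @shift_div ξ n s (gammaOne_lt ξ s hs).2
  have hl : (shift (ω ^ ξ * n) s ++ r).getLastD 0 = r.getLastD 0 := by
    rw [List.getLastD_eq_getLast?, List.getLastD_eq_getLast?, List.getLast?_append_of_ne_nil _ h1]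
  have hlt : r.getLastD 0 / ω ^ ξ < n := by
    rw [List.getLastD_eq_getLast?, List.getLast?_eq_getLast_of_ne_nil h1]
    exact h2 _ (List.getLast_mem _)
  rw [lastBlock, hl, List.filter_append, List.filter_eq_nil_iff.2, List.nil_append, lastBlock]
  intro o ho
  rw [hd ho]
  simpa only [decide_eq_true_eq] using hlt.ne'

theorem coeff_gammaOne {ξ : Ordinal.{v}} {s : List Ordinal.{v}} (hs : s ∈ gammaOne ξ) :
    coeff ξ s = coeffOne ξ s := by
  have := @lastBlock_shift ξ 0 s hs
  rw [coeff]
  simp only [shift, Nat.cast_zero, mul_zero, zero_add, List.map_id'] at this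
  rw [this]

/-- `ℙ_{ξ,n+1}(ω^ξ n + s) = ℙ_{ξ,1}(s)` for `s ∈ Γ_{ξ,1}`. -/
theorem coeff_shift {ξ : Ordinal.{v}} {n : ℕ} {s : List Ordinal.{v}} (hs : s ∈ gammaOne ξ) :
    coeff ξ (shift (ω ^ ξ * n) s) = coeffOne ξ s := by
  rw [coeff, lastBlock_shift hs]

/-- `ℙ_{ξ,n+1}((ω^ξ n + s) ⌢ r) = ℙ_{ξ,n}(r)` for `s ∈ MAX(Γ_{ξ,1})` and `r ∈ Γ_{ξ,n}`. -/
theorem coeff_append {ξ : Ordinal.{v}} {n : ℕ} {s r : List Ordinal.{v}} (hs : s ∈ gammaOne ξ)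
    (hr : r ∈ gamma ξ n) : coeff ξ (shift (ω ^ ξ * n) s ++ r) = coeff ξ r := by
  rw [coeff, lastBlock_append hs hr, coeff]

/-- `ℙ_{0,1} = 1`. -/
theorem coeffOne_zero (t : List Ordinal.{v}) : coeffOne 0 t = 1 := by
  simp [coeffOne]

/-- `ℙ_{ξ+1,1}(t) = ℙ_{ξ,n}(t) / n` for `t ∈ Γ_{ξ,n}`. -/
theorem coeffOne_add_one {ξ : Ordinal.{v}} {n : ℕ} {t : List Ordinal.{v}} (ht : t ∈ gamma ξ n) :
    coeffOne (ξ + 1) t = coeff ξ t / n := by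
  have h : ∃ n : ℕ, t ∈ gamma ξ n := ⟨n, ht⟩
  rw [coeffOne, Ordinal.limitRecOn_add_one, dif_pos h, gamma_unique h.choose_spec ht]
  rfl

theorem shift_injective (γ : Ordinal.{v}) : Function.Injective (shift γ) :=
  List.map_injective_iff.2 fun _ _ h => add_left_cancel h

/-- `ℙ_{ξ,1}(ω^ζ + s) = ℙ_{ζ+1,1}(s)` for a limit `ξ`, `ζ < ξ` and `s ∈ Γ_{ζ+1,1}`. -/
theorem coeffOne_limit {ξ ζ : Ordinal.{v}} (hξ : Order.IsSuccLimit ξ) (hζ : ζ < ξ)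
    {s : List Ordinal.{v}} (hs : s ∈ gammaOne (ζ + 1)) :
    coeffOne ξ (shift (ω ^ ζ) s) = coeffOne (ζ + 1) s := by
  have key : ∀ (ζ : Ordinal.{v}) (s : List Ordinal.{v}), s ∈ gammaOne (ζ + 1) →
      Ordinal.log ω ((shift (ω ^ ζ) s).headD 0) = ζ := by
    intro ζ s hs
    obtain ⟨h1, h2⟩ := gammaOne_lt _ s hs
    cases s with
    | nil => exact absurd rfl h1
    | cons a s =>
      simp only [shift, List.map_cons, List.headD_cons]
      have hle : ω ^ ζ ≤ ω ^ ζ + a := le_self_add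
      have hne : ω ^ ζ + a ≠ 0 := ((Ordinal.opow_pos ζ omega0_pos).trans_le hle).ne'
      refine (Ordinal.log_eq_iff one_lt_omega0 hne ζ).2 ⟨hle, ?_⟩
      exact Ordinal.isPrincipal_add_omega0_opow (ζ + 1)
        ((Ordinal.opow_lt_opow_iff_right one_lt_omega0).2 (lt_add_one ζ)) (h2 a (by simp))
  have h : ∃ ζ', ζ' < ξ ∧ ∃ s' ∈ gammaOne (ζ' + 1), shift (ω ^ ζ) s = shift (ω ^ ζ') s' :=
    ⟨ζ, hζ, s, hs, rfl⟩
  rw [coeffOne, Ordinal.limitRecOn_limit _ _ _ _ hξ, dif_pos h]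
  have e1 : h.choose = ζ := by
    rw [← key _ _ h.choose_spec.2.choose_spec.1, ← h.choose_spec.2.choose_spec.2, key _ _ hs]
  have e2 : h.choose_spec.2.choose = s := by
    have aux : ∀ ζ' s', ζ' = ζ → shift (ω ^ ζ) s = shift (ω ^ ζ') s' → s' = s := by
      rintro ζ' s' rfl h'
      exact (shift_injective _ h').symm
    exact aux _ _ e1 h.choose_spec.2.choose_spec.2
  rw [e2]
  change coeffOne (h.choose + 1) s = _
  rw [e1]

/-! ### The trees `Γ_{ξ,n}.D` and their cofinal sets of maximal members -/

/-- For a set `T` of sequences of ordinals, the set `T.D` of the sequences `(ζⱼ, uⱼ)ⱼ` with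
`(ζⱼ)ⱼ ∈ T` and `uⱼ ∈ D`. -/
def withDirs (D : Type u) (T : Set (List Ordinal.{v})) : Set (List (Ordinal.{v} × D)) :=
  {t | t.map Prod.fst ∈ T}

/-- `γ + (ζⱼ, uⱼ)ⱼ = (γ + ζⱼ, uⱼ)ⱼ`, the inverse of the canonical identification. -/
def shiftD {D : Type u} (γ : Ordinal.{v}) (t : List (Ordinal.{v} × D)) : List (Ordinal.{v} × D) :=
  t.map fun a => (γ + a.1, a.2)

/-- `Ω_{ξ,n}` for `n ≥ 1`, obtained from the family `C = Ω_{ξ,1}`. -/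
def cofinalOf {D : Type u} (ξ : Ordinal.{v}) (C : Set (List (Ordinal.{v} × D)) → Prop) :
    ℕ → Set (List (Ordinal.{v} × D)) → Prop
  | 0, _ => False
  | 1, E => C E
  | n + 2, E =>
      C {t | t ∈ maxNodes (withDirs D (gammaOne ξ)) ∧
        cofinalOf ξ C (n + 1)
          {s | s ∈ maxNodes (withDirs D (gamma ξ (n + 1))) ∧
            shiftD (ω ^ ξ * (n + 1 : ℕ)) t ++ s ∈ E}}

/-- The family `Ω_{ξ,1}` of the cofinal sets of maximal members of `Γ_{ξ,1}.D`. -/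
def cofinalOne (D : Type u) [Preorder D] (ξ : Ordinal.{v}) :
    Set (List (Ordinal.{v} × D)) → Prop :=
  Ordinal.limitRecOn ξ
    (fun E => IsCofinal {u : D | [((0 : Ordinal.{v}), u)] ∈ E})
    (fun ξ C E => ∀ m : ℕ, ∃ n : ℕ, m ≤ n ∧ 1 ≤ n ∧
      cofinalOf ξ C n (E ∩ withDirs D (gamma ξ n)))
    (fun ξ hξ C E => ∀ η < ξ, ∃ ζ, ∃ h : ζ < ξ, η ≤ ζ ∧
      C (ζ + 1) (hξ.add_one_lt h)
        {s | s ∈ maxNodes (withDirs D (gammaOne (ζ + 1))) ∧ shiftD (ω ^ ζ) s ∈ E})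

/-- `E` is a cofinal set of maximal members of `Γ_{ξ,n}.D`, that is, `E ∈ Ω_{ξ,n}`. -/
def IsCofinalIn {D : Type u} [Preorder D] (ξ : Ordinal.{v}) (n : ℕ)
    (E : Set (List (Ordinal.{v} × D))) : Prop :=
  E ⊆ maxNodes (withDirs D (gamma ξ n)) ∧ cofinalOf ξ (cofinalOne D ξ) n E

/-! ### The quantities `α_{ξ,p,n}(K)` and `α_{ξ,p}(K)` -/

section Gauge

variable {𝕜 : Type*} [RCLike 𝕜] {X : Type u} [NormedAddCommGroup X] [NormedSpace 𝕜 X]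

/-- `r_K(x) = max_{f ∈ K} Re f(x)` for a non-empty weak*-compact `K`, and `r_∅(x) = 0`. -/
def supportFun (K : Set (WeakDual 𝕜 X)) (x : X) : ℝ :=
  sSup ((fun f : WeakDual 𝕜 X => RCLike.re (f x)) '' K)

variable (𝕜) in
/-- `(x_t)_{t ∈ Γ_{ξ,n}.D}` is a weakly null collection in the closed unit ball: for each `t`
(possibly empty) and `ζ` such that the `t ⌢ (ζ, u)` are in the tree, the net
`(x_{t ⌢ (ζ, u)})_{u ∈ D}` is weakly null. Values of `x` outside the tree play no role. -/
def IsWeaklyNullInBall {D : Type u} [Preorder D] (ξ : Ordinal.{v}) (n : ℕ)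
    (x : List (Ordinal.{v} × D) → X) : Prop :=
  (∀ t ∈ withDirs D (gamma ξ n), ‖x t‖ ≤ 1) ∧
    ∀ (t : List (Ordinal.{v} × D)) (ζ : Ordinal.{v}), t.map Prod.fst ++ [ζ] ∈ gamma ξ n →
      ∀ f : StrongDual 𝕜 X, Tendsto (fun u : D => f (x (t ++ [(ζ, u)]))) atTop (𝓝 0)

variable (𝕜) in
open Classical in
/-- The vector `z^t_{i+1}`: the sum of `ℙ_{ξ,n}(s) x_s` over the initial segments `s` of `t` that
belong to the level `Λ_{ξ,n,i+1}.D`. -/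
def blockVec {D : Type u} (ξ : Ordinal.{v}) (n i : ℕ) (x : List (Ordinal.{v} × D) → X)
    (t : List (Ordinal.{v} × D)) : X :=
  ∑ k ∈ (Finset.Icc 1 t.length).filter (fun k => t.take k ∈ withDirs D (level ξ n i)),
    ((coeff ξ ((t.take k).map Prod.fst) : ℝ) : 𝕜) • x (t.take k)

/-- The vector `∑ aᵢ z^t_i`. -/
def branchVec {D : Type u} (ξ : Ordinal.{v}) {n : ℕ} (a : Fin n → 𝕜)
    (x : List (Ordinal.{v} × D) → X) (t : List (Ordinal.{v} × D)) : X :=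
  ∑ i : Fin n, a i • blockVec 𝕜 ξ n i x t

/-- The norm of `ℓ_p^n`. -/
def lpNorm {F : Type*} [NormedAddCommGroup F] (p : ENNReal) {n : ℕ} (a : Fin n → F) : ℝ :=
  ‖(WithLp.toLp p a : PiLp p fun _ : Fin n => F)‖

/-- The quantity `α_{ξ,p,n}(K)`. As a weak neighbourhood basis of `0` in `X` lives in the universe
of `X`, directed sets in that universe suffice. -/
def alpha (ξ : Ordinal.{v}) (p : ENNReal) (n : ℕ) (K : Set (WeakDual 𝕜 X)) : EReal :=
  sInf {c : EReal | ∃ α : ℝ, 0 < α ∧ c = (α : EReal) ∧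
    ∀ (D : Type u) [Preorder D] [IsDirectedOrder D] [Nonempty D] (a : Fin n → 𝕜)
      (x : List (Ordinal.{v} × D) → X), IsWeaklyNullInBall 𝕜 ξ n x →
      ⨅ t ∈ maxNodes (withDirs D (gamma ξ n)), ((supportFun K (branchVec ξ a x t) : ℝ) : EReal) ≤
        ((α * lpNorm p a : ℝ) : EReal)}

/-- The quantity `α_{ξ,p}(K) = sup_n α_{ξ,p,n}(K)`, over the positive integers `n`. -/
def alphaSup (ξ : Ordinal.{v}) (p : ENNReal) (K : Set (WeakDual 𝕜 X)) : EReal :=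
  ⨆ n : ℕ, ⨆ _ : 1 ≤ n, alpha ξ p n K

/-- The weak*-closed absolutely convex hull. -/
def wkStarAbsConvexHull (K : Set (WeakDual 𝕜 X)) : Set (WeakDual 𝕜 X) :=
  closure (convexHull ℝ (balancedHull 𝕜 K))

/-! ### The Szlenk index -/

/-- The Szlenk derivation `s_ε`: a point `f` of `K` is kept if `diam (V ∩ K) > ε` for each
weak*-neighbourhood `V` of `f`. -/
def szlenkDeriv (ε : ℝ) (K : Set (WeakDual 𝕜 X)) : Set (WeakDual 𝕜 X) :=
  {f | f ∈ K ∧ ∀ V ∈ 𝓝 f, ∃ g ∈ V ∩ K, ∃ h ∈ V ∩ K,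
    ε < ‖WeakDual.toStrongDual g - WeakDual.toStrongDual h‖}

/-- The transfinite derivations `s_ε^ξ`. -/
def szlenkIter (ε : ℝ) (K : Set (WeakDual 𝕜 X)) (ξ : Ordinal.{v}) : Set (WeakDual 𝕜 X) :=
  Ordinal.limitRecOn ξ K (fun _ L => szlenkDeriv ε L)
    (fun ξ _ L => ⋂ ζ, ⋂ h : ζ < ξ, L ζ h)

/-- `Sz(K, ε)`, the first `ξ` with `s_ε^ξ(K) = ∅`, or `∞ = ⊤`. -/
def szlenkIndexAt (ε : ℝ) (K : Set (WeakDual 𝕜 X)) : WithTop Ordinal.{v} :=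
  sInf {o | ∃ ξ : Ordinal.{v}, o = (ξ : WithTop Ordinal.{v}) ∧ szlenkIter ε K ξ = ∅}

/-- The Szlenk index `Sz(K) = sup_{ε > 0} Sz(K, ε)`. -/
def szlenkIndex (K : Set (WeakDual 𝕜 X)) : WithTop Ordinal.{v} :=
  ⨆ ε : ℝ, ⨆ _ : 0 < ε, szlenkIndexAt ε K

end Gauge

end WeakNullTrees
end

open WeakNullTrees

/-!
The proof replaces the trees by two kinds of filters.

*Cofinal sets.* The families of cofinal sets are partition regular, so they consist of the frequent
sets of filters `cofinalFilter D ξ n` on sequences. The recursive definition of cofinality becomes a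
recursive definition of these filters by `Filter.bind` (`isCofinalIn_iff`).

*Derivation on the dual.* For a filter `G` on `X*` and `b : ℝ`, a set `L` is frequent for
`filterStep b G` if each weak neighbourhood of `0` contains some `x` in the unit ball such that
`{f ∈ L | b ≤ Re f(x)}` is frequent for `G`. `filterIter` denotes the transfinite iterates. For
non-empty `K`, the quantity `α_{ξ,p,n}(K)` turns out to be the supremum of the sums `∑ aᵢ bᵢ` with `aᵢ, bᵢ ≥ 0` and
`‖a‖_p ≤ 1` for which `blockFilter K ξ n b` is non-trivial. This is the filter derived from `𝓟 K` by
`n` groups of `ω^ξ` derivations, with the constant `bᵢ` for the group that corresponds to the block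
`z_i^t`.

* From large values on a tree to a non-trivial filter: `bind_cofinalFilterOne_le` shows, by
  induction on `ξ`, that functionals with `Re f(z^t) ≥ c` for a cofinal set of `t` persist through
  `ω^ξ` derivations with any constant `b < c`. At successor steps `z^t` is an average of `n` blocks,
  so the number of blocks on which `Re f` exceeds `b` grows linearly in `n`. For `n` blocks with
  different coefficients, the values on the single blocks are stabilized along an ultrafilter
  (`exists_neBot_of_frequently`).
* From a non-trivial filter to trees with functionals: the sequences in `Γ_{ξ,n}` are strictly
  decreasing, so a vector can be chosen for each term `ζ` in such a way that the set of admissible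
  functionals remains frequent for the derived filter of order `ζ` (`exists_tree_of_neBot`).
* Since `z_i^t` is an iterated average of the `x_s` with `s ≤ t` in `Λ_{ξ,n,i}.D` (`blockVec_mem`),
  such functionals bound `α_{ξ,p,n}(K)` from below (`le_alpha_of_functionals`).

The remaining claims follow. `α_{ξ,p,n}(K) > 0` means that `ω^ξ` derivations of `𝓟 K` with some
constant `b > 0` give a non-trivial filter, independently of `n` and `p`; and the derived filters
follow the Szlenk derivations, since their frequent sets accumulate exactly at points of the sets
`s_ε^η(K)`, up to a change of `ε` (`forall_szlenkIter_eq_empty_iff`). For the absolutely convex hull,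
the arguments of the values `f(∑ aᵢ z_i^t)` are stabilized in the same way as the blocks and absorbed
in the vectors (`alpha_hull_le_alpha`).
-/

noncomputable section

namespace WeakNullTrees

/-! ### Maximal members of the trees -/

theorem headD_eq_of_prefix {A : Type*} {s t : List A} (d : A) (hs : s ≠ []) (h : s <+: t) :
    s.headD d = t.headD d := by
  obtain ⟨r, rfl⟩ := h
  cases s with
  | nil => exact absurd rfl hs
  | cons a s => rfl

theorem gamma_ne_nil {ξ : Ordinal.{v}} {n : ℕ} {t : List Ordinal.{v}} (ht : t ∈ gamma ξ n) :
    t ≠ [] := by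
  obtain ⟨i, _, hi⟩ := ht
  exact (levelsOf_div_lt (gammaOne_lt ξ) n i t hi).1

theorem gamma_div_lt {ξ : Ordinal.{v}} {n : ℕ} {t : List Ordinal.{v}} (ht : t ∈ gamma ξ n) :
    ∀ o ∈ t, o / ω ^ ξ < n := by
  obtain ⟨i, _, hi⟩ := ht
  exact (levelsOf_div_lt (gammaOne_lt ξ) n i t hi).2

theorem level_index_lt {ξ : Ordinal.{v}} {n i : ℕ} {t : List Ordinal.{v}}
    (ht : t ∈ level ξ n i) : i < n := by
  induction n generalizing i t with
  | zero => simp [level, levelsOf] at ht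
  | succ n ih =>
    cases i with
    | zero => omega
    | succ i =>
      obtain ⟨s, _, r, hr, _⟩ := ht
      have := ih hr
      omega

theorem level_subset_gamma {ξ : Ordinal.{v}} {n i : ℕ} {t : List Ordinal.{v}}
    (ht : t ∈ level ξ n i) : t ∈ gamma ξ n := ⟨i, level_index_lt ht, ht⟩

theorem mem_level_one {ξ : Ordinal.{v}} {t : List Ordinal.{v}} :
    t ∈ level ξ 1 0 ↔ t ∈ gammaOne ξ := by
  simp [level, levelsOf, shift]

theorem mem_gamma_succ {ξ : Ordinal.{v}} {n : ℕ} {t : List Ordinal.{v}} :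
    t ∈ gamma ξ (n + 1) ↔ (∃ s ∈ gammaOne ξ, t = shift (ω ^ ξ * n) s) ∨
      ∃ s ∈ maxNodes (gammaOne ξ), ∃ r ∈ gamma ξ n, t = shift (ω ^ ξ * n) s ++ r := by
  constructor
  · rintro ⟨i, hi, ht⟩
    cases i with
    | zero => exact Or.inl ht
    | succ i =>
      obtain ⟨s, hs, r, hr, e⟩ := ht
      exact Or.inr ⟨s, hs, r, level_subset_gamma hr, e⟩
  · rintro (h | ⟨s, hs, r, ⟨i, hi, hr⟩, e⟩)
    · exact ⟨0, n.succ_pos, h⟩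
    · exact ⟨i + 1, by omega, s, hs, r, hr, e⟩

theorem eq_of_prefix_gamma {ξ : Ordinal.{v}} {m n : ℕ} {s t : List Ordinal.{v}}
    (hs : s ∈ gamma ξ m) (ht : t ∈ gamma ξ n) (h : s <+: t) : m = n := by
  have h0 := headD_eq_of_prefix 0 (gamma_ne_nil hs) h
  obtain ⟨i, _, hi⟩ := hs
  obtain ⟨j, _, hj⟩ := ht
  have h1 := levelsOf_head (gammaOne_lt ξ) hi
  have h2 := levelsOf_head (gammaOne_lt ξ) hj
  rw [h0, h2] at h1
  exact_mod_cast h1.symm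

theorem shift_prefix_iff {γ : Ordinal.{v}} {s t : List Ordinal.{v}} :
    shift γ s <+: shift γ t ↔ s <+: t :=
  List.prefix_map_iff_of_injective fun _ _ h => add_left_cancel h

theorem log_headD_shift {ζ : Ordinal.{v}} {s : List Ordinal.{v}} (hs : s ∈ gammaOne (ζ + 1)) :
    Ordinal.log ω ((shift (ω ^ ζ) s).headD 0) = ζ := by
  obtain ⟨h1, h2⟩ := gammaOne_lt _ s hs
  cases s with
  | nil => exact absurd rfl h1
  | cons a s =>
    simp only [shift, List.map_cons, List.headD_cons]
    have hle : ω ^ ζ ≤ ω ^ ζ + a := le_self_add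
    have hne : ω ^ ζ + a ≠ 0 := ((Ordinal.opow_pos ζ omega0_pos).trans_le hle).ne'
    refine (Ordinal.log_eq_iff one_lt_omega0 hne ζ).2 ⟨hle, ?_⟩
    exact Ordinal.isPrincipal_add_omega0_opow (ζ + 1)
      ((Ordinal.opow_lt_opow_iff_right one_lt_omega0).2 (lt_add_one ζ)) (h2 a (by simp))

theorem eq_of_prefix_limit {ζ ζ' : Ordinal.{v}} {s s' : List Ordinal.{v}}
    (hs : s ∈ gammaOne (ζ + 1)) (hs' : s' ∈ gammaOne (ζ' + 1))
    (h : shift (ω ^ ζ) s <+: shift (ω ^ ζ') s') : ζ = ζ' := by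
  rw [← log_headD_shift hs, ← log_headD_shift hs',
    headD_eq_of_prefix 0 (shift_ne_nil (gammaOne_lt _ s hs).1) h]

/-- A sequence decomposes in at most one way into a part with quotients `n` and a part with smaller
quotients by `ω^ξ`. -/
theorem shift_append_inj {ξ : Ordinal.{v}} {n : ℕ} {s s' r r' : List Ordinal.{v}}
    (hs : ∀ o ∈ s, o < ω ^ ξ) (hs' : ∀ o ∈ s', o < ω ^ ξ)
    (hr : ∀ o ∈ r, o / ω ^ ξ < n) (hr' : ∀ o ∈ r', o / ω ^ ξ < n)
    (h : shift (ω ^ ξ * n) s ++ r = shift (ω ^ ξ * n) s' ++ r') : s = s' ∧ r = r' := by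
  have key : ∀ s r : List Ordinal.{v}, (∀ o ∈ s, o < ω ^ ξ) → (∀ o ∈ r, o / ω ^ ξ < n) →
      (shift (ω ^ ξ * n) s ++ r).filter (fun o => decide (o / ω ^ ξ = n)) =
        shift (ω ^ ξ * n) s := by
    intro s r hs hr
    rw [List.filter_append, List.filter_eq_self.2, List.filter_eq_nil_iff.2, List.append_nil]
    · intro o ho
      simpa using (hr o ho).ne
    · intro o ho
      simpa using shift_div hs ho
  have e : shift (ω ^ ξ * n) s = shift (ω ^ ξ * n) s' := by
    rw [← key s r hs hr, h, key s' r' hs' hr']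
  refine ⟨shift_injective _ e, ?_⟩
  rw [e] at h
  exact List.append_cancel_left h

theorem gammaOne_nonempty (ξ : Ordinal.{v}) : (gammaOne ξ).Nonempty := by
  induction ξ using Ordinal.limitRecOn with
  | zero => simp [gammaOne_zero]
  | add_one ξ ih =>
    rw [gammaOne_add_one]
    obtain ⟨t, ht⟩ := ih
    exact ⟨t, 1, le_rfl, by rwa [gamma_one]⟩
  | limit ξ hξ ih =>
    rw [gammaOne_limit hξ]
    obtain ⟨t, ht⟩ := ih (0 + 1) (hξ.add_one_lt hξ.bot_lt)
    exact ⟨_, 0, hξ.bot_lt, t, ht, rfl⟩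

theorem append_mem_maxNodes {ξ : Ordinal.{v}} {n : ℕ} {s r : List Ordinal.{v}}
    (hs : s ∈ maxNodes (gammaOne ξ)) (hr : r ∈ maxNodes (gamma ξ n)) :
    shift (ω ^ ξ * n) s ++ r ∈ maxNodes (gamma ξ (n + 1)) := by
  refine ⟨mem_gamma_succ.2 (Or.inr ⟨s, hs, r, hr.1, rfl⟩), fun q hq hpre => ?_⟩
  have hne := gamma_ne_nil hr.1
  rcases mem_gamma_succ.1 hq with ⟨s', hs', rfl⟩ | ⟨s', hs', r', hr', rfl⟩
  · exfalso
    obtain ⟨a, r, rfl⟩ := List.exists_cons_of_ne_nil hne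
    have h1 : a / ω ^ ξ < n := gamma_div_lt hr.1 a (by simp)
    have h2 : a ∈ shift (ω ^ ξ * n) s' := hpre.subset (by simp)
    exact h1.ne (shift_div (gammaOne_lt ξ s' hs').2 h2)
  · have e : s = s' := by
      rcases List.prefix_or_prefix_of_prefix
        ((List.prefix_append _ r).trans hpre) (List.prefix_append _ r') with h | h
      · exact (hs.2 _ hs'.1 (shift_prefix_iff.1 h)).symm
      · exact hs'.2 _ hs.1 (shift_prefix_iff.1 h)
    subst e
    rw [hr.2 r' hr' ((List.prefix_append_right_inj _).1 hpre)]

theorem exists_append_of_mem_maxNodes {ξ : Ordinal.{v}} {n : ℕ} {t : List Ordinal.{v}}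
    (ht : t ∈ maxNodes (gamma ξ (n + 2))) : ∃ s ∈ maxNodes (gammaOne ξ),
      ∃ r ∈ maxNodes (gamma ξ (n + 1)), t = shift (ω ^ ξ * (n + 1 : ℕ)) s ++ r := by
  rcases mem_gamma_succ.1 ht.1 with ⟨s, hs, rfl⟩ | ⟨s, hs, r, hr, rfl⟩
  · exfalso
    have hmax : s ∈ maxNodes (gammaOne ξ) := ⟨hs, fun q hq hpre =>
      shift_injective _ (ht.2 _ (mem_gamma_succ.2 (Or.inl ⟨q, hq, rfl⟩)) (shift_prefix_iff.2 hpre))⟩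
    obtain ⟨r, hr⟩ := gammaOne_nonempty ξ
    have hr' : shift (ω ^ ξ * n) r ∈ gamma ξ (n + 1) := mem_gamma_succ.2 (Or.inl ⟨r, hr, rfl⟩)
    have := ht.2 _ (mem_gamma_succ.2 (Or.inr ⟨s, hmax, _, hr', rfl⟩)) (List.prefix_append _ _)
    exact gamma_ne_nil hr' (List.self_eq_append_right.1 this.symm)
  · exact ⟨s, hs, r, ⟨hr, fun q hq hpre => List.append_cancel_left
      (ht.2 _ (mem_gamma_succ.2 (Or.inr ⟨s, hs, q, hq, rfl⟩))
        ((List.prefix_append_right_inj _).2 hpre))⟩, rfl⟩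

theorem mem_maxNodes_gammaOne_add_one {ξ : Ordinal.{v}} {t : List Ordinal.{v}} :
    t ∈ maxNodes (gammaOne (ξ + 1)) ↔ ∃ n : ℕ, 1 ≤ n ∧ t ∈ maxNodes (gamma ξ n) := by
  rw [gammaOne_add_one]
  constructor
  · rintro ⟨⟨n, hn, ht⟩, hmax⟩
    exact ⟨n, hn, ht, fun s hs h => hmax s ⟨n, hn, hs⟩ h⟩
  · rintro ⟨n, hn, ht, hmax⟩
    refine ⟨⟨n, hn, ht⟩, fun s ⟨m, hm, hs⟩ h => hmax s ?_ h⟩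
    rwa [eq_of_prefix_gamma ht hs h]

theorem mem_maxNodes_gammaOne_limit {ξ : Ordinal.{v}} (hξ : Order.IsSuccLimit ξ)
    {t : List Ordinal.{v}} : t ∈ maxNodes (gammaOne ξ) ↔
      ∃ ζ < ξ, ∃ s ∈ maxNodes (gammaOne (ζ + 1)), t = shift (ω ^ ζ) s := by
  rw [gammaOne_limit hξ]
  constructor
  · rintro ⟨⟨ζ, hζ, s, hs, rfl⟩, hmax⟩
    exact ⟨ζ, hζ, s, ⟨hs, fun q hq h =>
      shift_injective _ (hmax _ ⟨ζ, hζ, q, hq, rfl⟩ (shift_prefix_iff.2 h))⟩, rfl⟩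
  · rintro ⟨ζ, hζ, s, ⟨hs, hmax⟩, rfl⟩
    refine ⟨⟨ζ, hζ, s, hs, rfl⟩, ?_⟩
    rintro _ ⟨ζ', hζ', s', hs', rfl⟩ h
    obtain rfl := eq_of_prefix_limit hs hs' h
    rw [hmax s' hs' (shift_prefix_iff.1 h)]

/-! ### Entries of the sequences -/

/-- The last entry of a member of `Λ_{ξ,n,i+1}` has quotient `n - 1 - i` by `ω^ξ`. -/
theorem level_getLast_div {ξ : Ordinal.{v}} {n i : ℕ} {t : List Ordinal.{v}} {o : Ordinal.{v}}
    (ht : t ++ [o] ∈ level ξ n i) : o / ω ^ ξ = (n - 1 - i : ℕ) := by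
  induction n generalizing i t with
  | zero => simp [level, levelsOf] at ht
  | succ n ih =>
    cases i with
    | zero =>
      obtain ⟨s, hs, e⟩ := ht
      simpa using shift_div (gammaOne_lt ξ s hs).2 (e ▸ by simp : o ∈ shift (ω ^ ξ * n) s)
    | succ i =>
      obtain ⟨s, hs, r, hr, e⟩ := ht
      obtain ⟨r', a, rfl⟩ := (List.eq_nil_or_concat r).resolve_left
        (gamma_ne_nil (level_subset_gamma hr))
      rw [List.concat_eq_append, ← List.append_assoc] at e
      obtain ⟨-, e⟩ := List.append_inj' e rfl
      rw [List.concat_eq_append, ← List.singleton_inj.1 e] at hr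
      rw [ih hr]
      congr 1
      omega

theorem level_index_unique {ξ : Ordinal.{v}} {n i j : ℕ} {t : List Ordinal.{v}}
    (hi : t ∈ level ξ n i) (hj : t ∈ level ξ n j) : i = j := by
  obtain ⟨r, a, rfl⟩ := (List.eq_nil_or_concat t).resolve_left
    (gamma_ne_nil (level_subset_gamma hi))
  rw [List.concat_eq_append] at hi hj
  have h := (level_getLast_div hi).symm.trans (level_getLast_div hj)
  have h' : n - 1 - i = n - 1 - j := by exact_mod_cast h
  have := level_index_lt hi
  have := level_index_lt hj
  omega

theorem shift_pairwise_gt {γ : Ordinal.{v}} {s : List Ordinal.{v}} (hs : s.Pairwise (· > ·)) :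
    (shift γ s).Pairwise (· > ·) :=
  List.Pairwise.map _ (fun _ _ h => by simpa using h) hs

theorem gamma_pairwise_gt_of_gammaOne {ξ : Ordinal.{v}}
    (h : ∀ s ∈ gammaOne ξ, s.Pairwise (· > ·)) (n : ℕ) :
    ∀ t ∈ gamma ξ n, t.Pairwise (· > ·) := by
  induction n with
  | zero => rintro t ⟨i, hi, _⟩; omega
  | succ n ih =>
    intro t ht
    rcases mem_gamma_succ.1 ht with ⟨s, hs, rfl⟩ | ⟨s, hs, r, hr, rfl⟩
    · exact shift_pairwise_gt (h s hs)
    · refine List.pairwise_append.2 ⟨shift_pairwise_gt (h s hs.1), ih r hr, fun a ha b hb => ?_⟩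
      have h1 := shift_div (gammaOne_lt ξ s hs.1).2 ha
      have h2 := gamma_div_lt hr b hb
      rw [← h1] at h2
      by_contra hab
      exact h2.not_ge (Ordinal.div_le_left (not_lt.1 hab) _)

/-- The members of `Γ_{ξ,1}` are strictly decreasing sequences. -/
theorem gammaOne_pairwise_gt (ξ : Ordinal.{v}) : ∀ s ∈ gammaOne ξ, s.Pairwise (· > ·) := by
  induction ξ using Ordinal.limitRecOn with
  | zero => simp [gammaOne_zero]
  | add_one ξ ih =>
    rw [gammaOne_add_one]
    rintro t ⟨n, hn, ht⟩
    exact gamma_pairwise_gt_of_gammaOne ih n t ht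
  | limit ξ hξ ih =>
    rw [gammaOne_limit hξ]
    rintro t ⟨ζ, hζ, s, hs, rfl⟩
    exact shift_pairwise_gt (ih _ (hξ.add_one_lt hζ) s hs)

theorem gamma_pairwise_gt {ξ : Ordinal.{v}} {n : ℕ} {t : List Ordinal.{v}} (ht : t ∈ gamma ξ n) :
    t.Pairwise (· > ·) :=
  gamma_pairwise_gt_of_gammaOne (gammaOne_pairwise_gt ξ) n t ht

theorem gamma_lt {ξ : Ordinal.{v}} {n : ℕ} {t : List Ordinal.{v}} (ht : t ∈ gamma ξ n) :
    ∀ o ∈ t, o < ω ^ ξ * n := fun o ho =>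
  (Ordinal.lt_mul_iff_div_lt (opow_omega_ne_zero ξ)).2 (gamma_div_lt ht o ho)

/-! ### Adjoining directions -/

section Dirs

variable {D : Type u}

theorem map_fst_shiftD (γ : Ordinal.{v}) (t : List (Ordinal.{v} × D)) :
    (shiftD γ t).map Prod.fst = shift γ (t.map Prod.fst) := by
  simp [shiftD, shift]

theorem exists_shiftD_eq {γ : Ordinal.{v}} {t : List (Ordinal.{v} × D)} {s : List Ordinal.{v}}
    (h : t.map Prod.fst = shift γ s) :
    ∃ t' : List (Ordinal.{v} × D), t'.map Prod.fst = s ∧ t = shiftD γ t' := by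
  induction t generalizing s with
  | nil =>
    cases s with
    | nil => exact ⟨[], rfl, rfl⟩
    | cons a s => simp [shift] at h
  | cons p t ih =>
    cases s with
    | nil => simp [shift] at h
    | cons a s =>
      simp only [shift, List.map_cons, List.cons.injEq] at h
      obtain ⟨t', rfl, rfl⟩ := ih h.2
      exact ⟨(a, p.2) :: t', rfl, by simp [shiftD, ← h.1]⟩

theorem mem_maxNodes_withDirs [Nonempty D] {T : Set (List Ordinal.{v})}
    {t : List (Ordinal.{v} × D)} :
    t ∈ maxNodes (withDirs D T) ↔ t.map Prod.fst ∈ maxNodes T := by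
  constructor
  · rintro ⟨ht, hmax⟩
    refine ⟨ht, ?_⟩
    rintro _ hs ⟨r, rfl⟩
    have := hmax (t ++ r.map fun o => (o, Classical.arbitrary D))
      (by simpa [withDirs, Function.comp_def] using hs) (List.prefix_append _ _)
    have h2 := List.self_eq_append_right.1 this.symm
    rw [List.map_eq_nil_iff] at h2
    rw [h2]; simp
  · rintro ⟨ht, hmax⟩
    refine ⟨ht, ?_⟩
    rintro _ hs ⟨r, rfl⟩
    have := hmax _ hs (by simp)
    simpa using this

end Dirs

/-! ### The block vectors along a branch -/

/-- The sum of the values of `φ` at the non-empty initial segments of a sequence. -/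
def prefixSum {A E : Type*} [AddCommMonoid E] (φ : List A → E) (t : List A) : E :=
  ∑ k ∈ Finset.range t.length, φ (t.take (k + 1))

section PrefixSum

variable {A B E : Type*} [AddCommMonoid E]

theorem prefixSum_congr {φ ψ : List A → E} {t : List A}
    (h : ∀ r, r ≠ [] → r <+: t → φ r = ψ r) : prefixSum φ t = prefixSum ψ t := by
  refine Finset.sum_congr rfl fun k hk => h _ ?_ (List.take_prefix _ _)
  have := Finset.mem_range.1 hk
  intro h0
  have := congrArg List.length h0
  simp only [List.length_take, List.length_nil] at this
  omega

theorem prefixSum_eq_zero {φ : List A → E} {t : List A}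
    (h : ∀ r, r ≠ [] → r <+: t → φ r = 0) : prefixSum φ t = 0 := by
  rw [prefixSum_congr h]
  simp [prefixSum]

theorem prefixSum_append (φ : List A → E) (s t : List A) :
    prefixSum φ (s ++ t) = prefixSum φ s + prefixSum (fun r => φ (s ++ r)) t := by
  rw [prefixSum, List.length_append, Finset.sum_range_add]
  congr 1
  · refine Finset.sum_congr rfl fun k hk => ?_
    have := Finset.mem_range.1 hk
    rw [List.take_append_of_le_length (by omega)]
  · refine Finset.sum_congr rfl fun k _ => ?_
    rw [add_assoc, List.take_length_add_append]

theorem prefixSum_map (φ : List B → E) (g : A → B) (t : List A) :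
    prefixSum φ (t.map g) = prefixSum (fun r => φ (r.map g)) t := by
  simp only [prefixSum, List.length_map, List.map_take]

end PrefixSum

section BlockVec

variable {𝕜 : Type*} [RCLike 𝕜] {X : Type u} [NormedAddCommGroup X] [NormedSpace 𝕜 X]
variable {D : Type u}

variable (𝕜) in
open Classical in
/-- The contribution of the node `r` to the vectors `z_{i+1}^t`, `t ≥ r`. -/
def nodeTerm (ξ : Ordinal.{v}) (n i : ℕ) (x : List (Ordinal.{v} × D) → X)
    (r : List (Ordinal.{v} × D)) : X :=
  if r.map Prod.fst ∈ level ξ n i then ((coeff ξ (r.map Prod.fst) : ℝ) : 𝕜) • x r else 0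

theorem nodeTerm_of_mem {ξ : Ordinal.{v}} {n i : ℕ} {x : List (Ordinal.{v} × D) → X}
    {r : List (Ordinal.{v} × D)} (h : r.map Prod.fst ∈ level ξ n i) :
    nodeTerm 𝕜 ξ n i x r = ((coeff ξ (r.map Prod.fst) : ℝ) : 𝕜) • x r := if_pos h

theorem nodeTerm_of_notMem {ξ : Ordinal.{v}} {n i : ℕ} {x : List (Ordinal.{v} × D) → X}
    {r : List (Ordinal.{v} × D)} (h : r.map Prod.fst ∉ level ξ n i) :
    nodeTerm 𝕜 ξ n i x r = 0 := if_neg h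

theorem nodeTerm_congr {ξ ξ' : Ordinal.{v}} {n n' i i' : ℕ} {x x' : List (Ordinal.{v} × D) → X}
    {r r' : List (Ordinal.{v} × D)}
    (h : r.map Prod.fst ∈ level ξ n i ↔ r'.map Prod.fst ∈ level ξ' n' i')
    (hc : r'.map Prod.fst ∈ level ξ' n' i' →
      coeff ξ (r.map Prod.fst) = coeff ξ' (r'.map Prod.fst))
    (hx : x r = x' r') : nodeTerm 𝕜 ξ n i x r = nodeTerm 𝕜 ξ' n' i' x' r' := by
  by_cases hr : r'.map Prod.fst ∈ level ξ' n' i'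
  · rw [nodeTerm_of_mem hr, nodeTerm_of_mem (h.2 hr), hc hr, hx]
  · rw [nodeTerm_of_notMem hr, nodeTerm_of_notMem (fun h' => hr (h.1 h'))]

theorem blockVec_eq_prefixSum (ξ : Ordinal.{v}) (n i : ℕ) (x : List (Ordinal.{v} × D) → X)
    (t : List (Ordinal.{v} × D)) :
    blockVec 𝕜 ξ n i x t = prefixSum (nodeTerm 𝕜 ξ n i x) t := by
  classical
  rw [blockVec, prefixSum, Finset.sum_filter, Finset.range_eq_Ico,
    Finset.sum_Ico_add' (fun k => nodeTerm 𝕜 ξ n i x (t.take k)) 0 t.length 1]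
  have : Finset.Icc 1 t.length = Finset.Ico (0 + 1) (t.length + 1) := by
    ext; simp
  rw [this]
  exact Finset.sum_congr rfl fun k _ => by
    simp only [nodeTerm, withDirs, Set.mem_ofPred_eq]
    congr

theorem mem_level_shift {ξ : Ordinal.{v}} {n : ℕ} {s : List Ordinal.{v}} :
    shift (ω ^ ξ * n) s ∈ level ξ (n + 1) 0 ↔ s ∈ gammaOne ξ := by
  constructor
  · rintro ⟨s', hs', e⟩
    rwa [shift_injective _ e]
  · intro h
    exact ⟨s, h, rfl⟩

theorem append_notMem_level_zero {ξ : Ordinal.{v}} {n : ℕ} {s r : List Ordinal.{v}}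
    (hne : r ≠ []) (hr : ∀ o ∈ r, o / ω ^ ξ < n) : s ++ r ∉ level ξ (n + 1) 0 := by
  rintro ⟨s', hs', e⟩
  obtain ⟨a, r, rfl⟩ := List.exists_cons_of_ne_nil hne
  have h2 : a ∈ shift (ω ^ ξ * n) s' := e ▸ by simp
  exact (hr a (by simp)).ne (shift_div (gammaOne_lt ξ s' hs').2 h2)

theorem shift_notMem_level_succ {ξ : Ordinal.{v}} {n i : ℕ} {s : List Ordinal.{v}}
    (hs : ∀ o ∈ s, o < ω ^ ξ) : shift (ω ^ ξ * n) s ∉ level ξ (n + 1) (i + 1) := by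
  rintro ⟨s', hs', r, hr, e⟩
  have hr := level_subset_gamma hr
  obtain ⟨a, r, rfl⟩ := List.exists_cons_of_ne_nil (gamma_ne_nil hr)
  have h2 : a ∈ shift (ω ^ ξ * n) s := e ▸ by simp
  exact (gamma_div_lt hr a (by simp)).ne (shift_div hs h2)

theorem append_mem_level_succ {ξ : Ordinal.{v}} {n i : ℕ} {s r : List Ordinal.{v}}
    (hs : s ∈ maxNodes (gammaOne ξ)) (hr : ∀ o ∈ r, o / ω ^ ξ < n) :
    shift (ω ^ ξ * n) s ++ r ∈ level ξ (n + 1) (i + 1) ↔ r ∈ level ξ n i := by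
  constructor
  · rintro ⟨s', hs', r', hr', e⟩
    have := shift_append_inj (gammaOne_lt ξ s hs.1).2 (gammaOne_lt ξ s' hs'.1).2 hr
      (gamma_div_lt (level_subset_gamma hr')) e
    rw [this.2]
    exact hr'
  · intro h
    exact ⟨s, hs, r, h, rfl⟩

/-- The first block of a branch of `Γ_{ξ,n+1}.D`. -/
theorem blockVec_append_zero {ξ : Ordinal.{v}} {n : ℕ} (x : List (Ordinal.{v} × D) → X)
    (t : List (Ordinal.{v} × D)) {s : List (Ordinal.{v} × D)}
    (hs : ∀ o ∈ s.map Prod.fst, o / ω ^ ξ < n) :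
    blockVec 𝕜 ξ (n + 1) 0 x (shiftD (ω ^ ξ * n) t ++ s) =
      blockVec 𝕜 ξ 1 0 (fun r => x (shiftD (ω ^ ξ * n) r)) t := by
  rw [blockVec_eq_prefixSum, blockVec_eq_prefixSum, prefixSum_append,
    prefixSum_eq_zero (t := s), add_zero, shiftD, prefixSum_map]
  · refine prefixSum_congr fun r _ _ => ?_
    have e : (r.map fun a => (ω ^ ξ * (n : Ordinal.{v}) + a.1, a.2)) = shiftD (ω ^ ξ * n) r := rfl
    rw [e]
    refine nodeTerm_congr ?_ (fun h => ?_) rfl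
    · rw [map_fst_shiftD, mem_level_shift, mem_level_one]
    · rw [mem_level_one] at h
      rw [map_fst_shiftD, coeff_shift h, coeff_gammaOne h]
  · intro r hne hr
    apply nodeTerm_of_notMem
    rw [List.map_append]
    exact append_notMem_level_zero (by simpa using hne)
      fun o ho => hs o ((hr.map _).subset ho)

/-- The later blocks of a branch of `Γ_{ξ,n+1}.D`. -/
theorem blockVec_append_succ {ξ : Ordinal.{v}} {n : ℕ} (i : ℕ) (x : List (Ordinal.{v} × D) → X)
    {t s : List (Ordinal.{v} × D)} (ht : t.map Prod.fst ∈ maxNodes (gammaOne ξ))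
    (hs : ∀ o ∈ s.map Prod.fst, o / ω ^ ξ < n) :
    blockVec 𝕜 ξ (n + 1) (i + 1) x (shiftD (ω ^ ξ * n) t ++ s) =
      blockVec 𝕜 ξ n i (fun r => x (shiftD (ω ^ ξ * n) t ++ r)) s := by
  rw [blockVec_eq_prefixSum, blockVec_eq_prefixSum, prefixSum_append,
    prefixSum_eq_zero (t := shiftD _ t), zero_add]
  · refine prefixSum_congr fun r hne hr => ?_
    have hr' : ∀ o ∈ r.map Prod.fst, o / ω ^ ξ < n := fun o ho => hs o ((hr.map _).subset ho)
    refine nodeTerm_congr ?_ (fun h => ?_) rfl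
    · rw [List.map_append, map_fst_shiftD, append_mem_level_succ ht hr']
    · rw [List.map_append, map_fst_shiftD, coeff_append ht.1 (level_subset_gamma h)]
  · rintro r hne ⟨q, hq⟩
    apply nodeTerm_of_notMem
    obtain ⟨a, b, e, rfl, -⟩ := List.map_eq_append_iff.1 hq.symm
    have := map_fst_shiftD (ω ^ ξ * (n : Ordinal.{v})) a
    rw [shiftD] at this
    rw [this]
    exact shift_notMem_level_succ fun o ho => (gammaOne_lt ξ _ ht.1).2 o (by
      rw [e, List.map_append]; exact List.mem_append_left _ ho)

/-- The block vector for `Γ_{ξ+1,1}.D` is the average of the block vectors for `Γ_{ξ,n}.D`. -/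
theorem blockVec_add_one {ξ : Ordinal.{v}} {n : ℕ} (x : List (Ordinal.{v} × D) → X)
    {t : List (Ordinal.{v} × D)} (ht : t.map Prod.fst ∈ gamma ξ n) :
    blockVec 𝕜 (ξ + 1) 1 0 x t =
      (n : 𝕜)⁻¹ • ∑ i ∈ Finset.range n, blockVec 𝕜 ξ n i x t := by
  have key : ∀ r, r ≠ [] → r <+: t → nodeTerm 𝕜 (ξ + 1) 1 0 x r =
      (n : 𝕜)⁻¹ • ∑ i ∈ Finset.range n, nodeTerm 𝕜 ξ n i x r := by
    intro r hne hr
    by_cases h : ∃ i, r.map Prod.fst ∈ level ξ n i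
    · obtain ⟨i, hi⟩ := h
      have hg := level_subset_gamma hi
      have hlt := level_index_lt hi
      have h1 : r.map Prod.fst ∈ gammaOne (ξ + 1) := by
        rw [gammaOne_add_one]
        exact ⟨n, by omega, hg⟩
      rw [Finset.sum_eq_single i, nodeTerm_of_mem hi, nodeTerm_of_mem (mem_level_one.2 h1),
        coeff_gammaOne h1, coeffOne_add_one hg, smul_smul]
      · congr 1
        push_cast
        rw [div_eq_inv_mul]
      · intro j _ hj
        exact nodeTerm_of_notMem fun h => hj (level_index_unique h hi)
      · intro h
        exact absurd (Finset.mem_range.2 hlt) h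
    · rw [nodeTerm_of_notMem, Finset.sum_eq_zero, smul_zero]
      · intro i _
        exact nodeTerm_of_notMem fun h' => h ⟨i, h'⟩
      · rw [mem_level_one, gammaOne_add_one]
        rintro ⟨m, -, hm⟩
        obtain rfl := eq_of_prefix_gamma hm ht (hr.map Prod.fst)
        obtain ⟨i, -, hi⟩ := hm
        exact h ⟨i, hi⟩
  rw [blockVec_eq_prefixSum, prefixSum_congr key]
  simp only [blockVec_eq_prefixSum, prefixSum]
  rw [← Finset.smul_sum, Finset.sum_comm]

theorem blockVec_limit {ξ ζ : Ordinal.{v}} (hξ : Order.IsSuccLimit ξ) (hζ : ζ < ξ)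
    (x : List (Ordinal.{v} × D) → X) {t : List (Ordinal.{v} × D)}
    (ht : t.map Prod.fst ∈ gammaOne (ζ + 1)) :
    blockVec 𝕜 ξ 1 0 x (shiftD (ω ^ ζ) t) =
      blockVec 𝕜 (ζ + 1) 1 0 (fun r => x (shiftD (ω ^ ζ) r)) t := by
  rw [blockVec_eq_prefixSum, blockVec_eq_prefixSum, shiftD, prefixSum_map]
  refine prefixSum_congr fun r hne hr => ?_
  have e : (r.map fun a => (ω ^ ζ + a.1, a.2)) = shiftD (ω ^ ζ) r := rfl
  rw [e]
  have hiff : shift (ω ^ ζ) (r.map Prod.fst) ∈ gammaOne ξ ↔ r.map Prod.fst ∈ gammaOne (ζ + 1) := by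
    rw [gammaOne_limit hξ]
    constructor
    · rintro ⟨ζ', hζ', s, hs, e⟩
      have h1 := log_headD_shift hs
      have h2 := log_headD_shift ht
      rw [← headD_eq_of_prefix 0 (shift_ne_nil (by simpa using hne))
        (shift_prefix_iff.2 (hr.map Prod.fst)), e, h1] at h2
      subst h2
      rwa [shift_injective _ e]
    · intro h
      exact ⟨ζ, hζ, _, h, rfl⟩
  refine nodeTerm_congr ?_ (fun h => ?_) rfl
  · rw [map_fst_shiftD, mem_level_one, mem_level_one, hiff]
  · rw [mem_level_one] at h
    rw [map_fst_shiftD, coeff_gammaOne (hiff.2 h), coeff_gammaOne h, coeffOne_limit hξ hζ h]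

theorem blockVec_zero (x : List (Ordinal.{v} × D) → X) (u : D) :
    blockVec 𝕜 0 1 0 x [((0 : Ordinal.{v}), u)] = x [((0 : Ordinal.{v}), u)] := by
  have h : [(0 : Ordinal.{v})] ∈ gammaOne 0 := by simp [gammaOne_zero]
  rw [blockVec_eq_prefixSum]
  simp only [prefixSum, List.length_singleton, Finset.sum_range_one, List.take_succ_cons,
    List.take_zero]
  rw [nodeTerm_of_mem (mem_level_one.2 (by simpa using h))]
  simp [coeff_gammaOne h, coeffOne_zero]

theorem blockVec_mem_of_one {C : Set X} {ξ : Ordinal.{v}}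
    (hC : ∀ (x : List (Ordinal.{v} × D) → X) (t : List (Ordinal.{v} × D)),
      t.map Prod.fst ∈ maxNodes (gammaOne ξ) →
      (∀ r, r <+: t → r.map Prod.fst ∈ gammaOne ξ → x r ∈ C) → blockVec 𝕜 ξ 1 0 x t ∈ C) {n : ℕ} :
    ∀ {i : ℕ} (_ : i < n) {x : List (Ordinal.{v} × D) → X} {t : List (Ordinal.{v} × D)},
      t.map Prod.fst ∈ maxNodes (gamma ξ n) →
      (∀ r, r <+: t → r.map Prod.fst ∈ level ξ n i → x r ∈ C) → blockVec 𝕜 ξ n i x t ∈ C := by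
  induction n with
  | zero => intro i hi; omega
  | succ n ihn =>
    intro i hi x t ht hx
    rcases n with _ | n
    · obtain rfl : i = 0 := by omega
      rw [zero_add, gamma_one] at ht
      exact hC x t ht fun r hr h => hx r hr (mem_level_one.2 h)
    obtain ⟨s, hs, r, hr, e⟩ := exists_append_of_mem_maxNodes ht
    obtain ⟨t', q, rfl, e', rfl⟩ := List.map_eq_append_iff.1 e
    obtain ⟨t, rfl, rfl⟩ := exists_shiftD_eq e'
    have hq := gamma_div_lt hr.1
    cases i with
    | zero =>
      rw [blockVec_append_zero x t hq]
      refine hC _ t hs fun r hr h => hx _ ?_ ⟨_, h, map_fst_shiftD _ _⟩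
      exact (hr.map _).trans (List.prefix_append _ _)
    | succ i =>
      rw [blockVec_append_succ i x hs hq]
      refine ihn (by omega) hr (fun r hr h => hx _ ((List.prefix_append_right_inj _).2 hr) ?_)
      exact ⟨_, hs, _, h, by rw [List.map_append, map_fst_shiftD]⟩

/-- The block vector at a maximal member of `Γ_{ξ,1}.D` is an iterated average of the vectors
attached to its initial segments, so it belongs to any set that contains these and is stable under
averages. -/
theorem blockVec_one_mem {C : Set X}
    (hC : ∀ (n : ℕ) (w : ℕ → X), 1 ≤ n → (∀ i < n, w i ∈ C) →
      (n : 𝕜)⁻¹ • ∑ i ∈ Finset.range n, w i ∈ C) (ξ : Ordinal.{v}) :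
    ∀ (x : List (Ordinal.{v} × D) → X) (t : List (Ordinal.{v} × D)),
      t.map Prod.fst ∈ maxNodes (gammaOne ξ) →
      (∀ r, r <+: t → r.map Prod.fst ∈ gammaOne ξ → x r ∈ C) → blockVec 𝕜 ξ 1 0 x t ∈ C := by
  induction ξ using Ordinal.limitRecOn with
  | zero =>
    intro x t ht hx
    have h0 := ht.1
    rw [gammaOne_zero, Set.mem_singleton_iff] at h0
    obtain ⟨u, rfl⟩ : ∃ u : D, t = [((0 : Ordinal.{v}), u)] := by
      obtain ⟨p, t, rfl⟩ := List.exists_cons_of_ne_nil (fun h => by simp [h] at h0 : t ≠ [])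
      simp only [List.map_cons, List.cons.injEq, List.map_eq_nil_iff] at h0
      exact ⟨p.2, by rw [h0.2, ← h0.1]⟩
    rw [blockVec_zero]
    exact hx _ List.prefix_rfl ht.1
  | add_one ξ ih =>
    intro x t ht hx
    obtain ⟨n, hn, ht⟩ := mem_maxNodes_gammaOne_add_one.1 ht
    rw [blockVec_add_one x ht.1]
    refine hC n _ hn ?_
    have hx' : ∀ r, r <+: t → r.map Prod.fst ∈ gamma ξ n → x r ∈ C := fun r hr h =>
      hx r hr (by rw [gammaOne_add_one]; exact ⟨n, hn, h⟩)
    exact fun i hi => blockVec_mem_of_one ih hi ht fun r hr h => hx' r hr (level_subset_gamma h)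
  | limit ξ hξ ih =>
    intro x t ht hx
    obtain ⟨ζ, hζ, s, hs, e⟩ := (mem_maxNodes_gammaOne_limit hξ).1 ht
    obtain ⟨t, rfl, rfl⟩ := exists_shiftD_eq e
    rw [blockVec_limit hξ hζ x hs.1]
    refine ih _ (hξ.add_one_lt hζ) _ t hs fun r hr h => hx _ (hr.map _) ?_
    rw [gammaOne_limit hξ, map_fst_shiftD]
    exact ⟨ζ, hζ, _, h, rfl⟩

/-- The block vector `z_{i+1}^t` belongs to any set that contains the vectors attached to the
initial segments of `t` in `Λ_{ξ,n,i+1}.D` and is stable under averages. -/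
theorem blockVec_mem {C : Set X}
    (hC : ∀ (n : ℕ) (w : ℕ → X), 1 ≤ n → (∀ i < n, w i ∈ C) →
      (n : 𝕜)⁻¹ • ∑ i ∈ Finset.range n, w i ∈ C) {ξ : Ordinal.{v}} {n i : ℕ} (hi : i < n)
    {x : List (Ordinal.{v} × D) → X} {t : List (Ordinal.{v} × D)}
    (ht : t.map Prod.fst ∈ maxNodes (gamma ξ n))
    (hx : ∀ r, r <+: t → r.map Prod.fst ∈ level ξ n i → x r ∈ C) : blockVec 𝕜 ξ n i x t ∈ C :=
  blockVec_mem_of_one (blockVec_one_mem hC ξ) hi ht hx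

end BlockVec

/-! ### The filters of cofinal sets -/

section CofinalFilter

variable {D : Type u}

/-- The filter on `Γ_{ξ,n}.D` obtained from a filter `F` on `Γ_{ξ,1}.D` by iteration over the `n`
blocks. -/
def cofinalFilterOf (ξ : Ordinal.{v}) (F : Filter (List (Ordinal.{v} × D))) :
    ℕ → Filter (List (Ordinal.{v} × D))
  | 0 => ⊥
  | 1 => F
  | n + 2 => F.bind fun t =>
      (cofinalFilterOf ξ F (n + 1)).map (shiftD (ω ^ ξ * (n + 1 : ℕ)) t ++ ·)

variable (D) in
/-- The filter on sequences whose frequent sets are the cofinal sets in `Γ_{ξ,1}.D`. -/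
def cofinalFilterOne [Preorder D] (ξ : Ordinal.{v}) : Filter (List (Ordinal.{v} × D)) :=
  Ordinal.limitRecOn ξ
    ((atTop : Filter D).map fun u => [((0 : Ordinal.{v}), u)])
    (fun ξ F => (atTop : Filter ℕ).bind (cofinalFilterOf ξ F))
    (fun ξ hξ F => (atTop : Filter (Set.Iio ξ)).bind fun ζ =>
      (F (ζ.1 + 1) (hξ.add_one_lt ζ.2)).map (shiftD (ω ^ ζ.1)))

variable (D) in
/-- The filter on sequences whose frequent sets are the cofinal sets in `Γ_{ξ,n}.D`. -/
def cofinalFilter [Preorder D] (ξ : Ordinal.{v}) (n : ℕ) : Filter (List (Ordinal.{v} × D)) :=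
  cofinalFilterOf ξ (cofinalFilterOne D ξ) n

variable [Preorder D]

theorem cofinalFilterOne_zero : cofinalFilterOne D (0 : Ordinal.{v}) =
    (atTop : Filter D).map fun u => [((0 : Ordinal.{v}), u)] := by
  simp [cofinalFilterOne]

theorem cofinalFilterOne_add_one (ξ : Ordinal.{v}) : cofinalFilterOne D (ξ + 1) =
    (atTop : Filter ℕ).bind (cofinalFilter D ξ) := by
  rw [cofinalFilterOne, Ordinal.limitRecOn_add_one]
  rfl

theorem cofinalFilterOne_limit {ξ : Ordinal.{v}} (hξ : Order.IsSuccLimit ξ) :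
    cofinalFilterOne D ξ = (atTop : Filter (Set.Iio ξ)).bind fun ζ =>
      (cofinalFilterOne D (ζ.1 + 1)).map (shiftD (ω ^ ζ.1)) := by
  rw [cofinalFilterOne, Ordinal.limitRecOn_limit _ _ _ _ hξ]
  rfl

theorem cofinalFilter_one (ξ : Ordinal.{v}) : cofinalFilter D ξ 1 = cofinalFilterOne D ξ := rfl

theorem cofinalFilter_add_two (ξ : Ordinal.{v}) (n : ℕ) : cofinalFilter D ξ (n + 2) =
    (cofinalFilterOne D ξ).bind fun t =>
      (cofinalFilter D ξ (n + 1)).map (shiftD (ω ^ ξ * (n + 1 : ℕ)) t ++ ·) := rfl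

theorem eventually_cofinalFilter_of_one {ξ : Ordinal.{v}}
    (h : ∀ᶠ t in cofinalFilterOne D ξ, t.map Prod.fst ∈ maxNodes (gammaOne ξ)) (n : ℕ) :
    ∀ᶠ t in cofinalFilter D ξ n, t.map Prod.fst ∈ maxNodes (gamma ξ n) := by
  induction n with
  | zero => exact mem_bot
  | succ n ih =>
    rcases n with _ | n
    · rwa [zero_add, cofinalFilter_one, gamma_one]
    rw [cofinalFilter_add_two, eventually_bind]
    filter_upwards [h] with t ht
    rw [eventually_map]
    filter_upwards [ih] with s hs
    rw [List.map_append, map_fst_shiftD]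
    exact append_mem_maxNodes ht hs

theorem eventually_cofinalFilterOne (ξ : Ordinal.{v}) :
    ∀ᶠ t in cofinalFilterOne D ξ, t.map Prod.fst ∈ maxNodes (gammaOne ξ) := by
  induction ξ using Ordinal.limitRecOn with
  | zero =>
    rw [cofinalFilterOne_zero, eventually_map]
    refine Eventually.of_forall fun u => ?_
    rw [gammaOne_zero]
    exact ⟨rfl, fun s hs _ => hs⟩
  | add_one ξ ih =>
    rw [cofinalFilterOne_add_one, eventually_bind]
    filter_upwards [eventually_ge_atTop 1] with n hn
    filter_upwards [eventually_cofinalFilter_of_one ih n] with t ht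
    exact mem_maxNodes_gammaOne_add_one.2 ⟨n, hn, ht⟩
  | limit ξ hξ ih =>
    rw [cofinalFilterOne_limit hξ, eventually_bind]
    refine Eventually.of_forall fun ζ => ?_
    rw [eventually_map]
    filter_upwards [ih _ (hξ.add_one_lt ζ.2)] with t ht
    rw [map_fst_shiftD]
    exact (mem_maxNodes_gammaOne_limit hξ).2 ⟨ζ, ζ.2, _, ht, rfl⟩

theorem eventually_cofinalFilter (ξ : Ordinal.{v}) (n : ℕ) :
    ∀ᶠ t in cofinalFilter D ξ n, t.map Prod.fst ∈ maxNodes (gamma ξ n) :=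
  eventually_cofinalFilter_of_one (eventually_cofinalFilterOne ξ) n

theorem neBot_bind {A B : Type*} {F : Filter A} {m : A → Filter B} [F.NeBot]
    (h : ∀ᶠ a in F, (m a).NeBot) : (F.bind m).NeBot := by
  refine ⟨fun h0 => ?_⟩
  have h' := mem_bind'.1 (empty_mem_iff_bot.2 h0)
  obtain ⟨a, h1, h2⟩ := (h.and h').exists
  exact h1.ne (empty_mem_iff_bot.1 h2)

theorem neBot_cofinalFilter_of_one {ξ : Ordinal.{v}} (h : (cofinalFilterOne D ξ).NeBot) (n : ℕ) :
    (cofinalFilter D ξ (n + 1)).NeBot := by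
  induction n with
  | zero => exact h
  | succ n ih => exact neBot_bind (Eventually.of_forall fun t => ih.map _)

theorem cofinalOf_iff_of_one [Nonempty D] {ξ : Ordinal.{v}}
    (h : ∀ E, cofinalOne D ξ E ↔ ∃ᶠ t in cofinalFilterOne D ξ, t ∈ E) (n : ℕ) :
    ∀ E, cofinalOf ξ (cofinalOne D ξ) n E ↔ ∃ᶠ t in cofinalFilter D ξ n, t ∈ E := by
  induction n with
  | zero => exact fun E => iff_of_false id (by simp [cofinalFilter, cofinalFilterOf])
  | succ n ih =>
    rcases n with _ | n
    · exact h
    intro E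
    rw [cofinalFilter_add_two, frequently_bind]
    change cofinalOne D ξ _ ↔ _
    rw [h]
    refine frequently_congr ?_
    filter_upwards [eventually_cofinalFilterOne ξ] with t ht
    refine (and_iff_right (mem_maxNodes_withDirs.2 ht)).trans ?_
    rw [ih, frequently_map]
    refine frequently_congr ?_
    filter_upwards [eventually_cofinalFilter ξ (n + 1)] with s hs
    exact and_iff_right (mem_maxNodes_withDirs.2 hs)

variable [IsDirectedOrder D] [Nonempty D]

theorem neBot_cofinalFilterOne (ξ : Ordinal.{v}) : (cofinalFilterOne D ξ).NeBot := by
  induction ξ using Ordinal.limitRecOn with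
  | zero =>
    rw [cofinalFilterOne_zero]
    infer_instance
  | add_one ξ ih =>
    rw [cofinalFilterOne_add_one]
    refine neBot_bind ?_
    filter_upwards [eventually_ge_atTop 1] with n hn
    obtain ⟨n, rfl⟩ : ∃ m, n = m + 1 := ⟨n - 1, by omega⟩
    exact neBot_cofinalFilter_of_one ih n
  | limit ξ hξ ih =>
    rw [cofinalFilterOne_limit hξ]
    have : Nonempty (Set.Iio ξ) := ⟨⟨0, hξ.bot_lt⟩⟩
    exact neBot_bind (Eventually.of_forall fun ζ => (ih _ (hξ.add_one_lt ζ.2)).map _)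

theorem neBot_cofinalFilter (ξ : Ordinal.{v}) {n : ℕ} (hn : 1 ≤ n) :
    (cofinalFilter D ξ n).NeBot := by
  obtain ⟨n, rfl⟩ : ∃ m, n = m + 1 := ⟨n - 1, by omega⟩
  exact neBot_cofinalFilter_of_one (neBot_cofinalFilterOne ξ) n

theorem maxNodes_nonempty (D : Type u) [Nonempty D] (ξ : Ordinal.{v}) {n : ℕ} (hn : 1 ≤ n) :
    ∃ t, t ∈ maxNodes (withDirs D (gamma ξ n)) := by
  let _ : Preorder D :=
    { le := fun _ _ => True
      le_refl := fun _ => trivial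
      le_trans := fun _ _ _ _ _ => trivial }
  have : IsDirectedOrder D := ⟨fun a _ => ⟨a, trivial, trivial⟩⟩
  have := neBot_cofinalFilter (D := D) ξ hn
  obtain ⟨t, ht⟩ := (eventually_cofinalFilter (D := D) ξ n).exists
  exact ⟨t, mem_maxNodes_withDirs.2 ht⟩

theorem cofinalOne_iff (ξ : Ordinal.{v}) :
    ∀ E, cofinalOne D ξ E ↔ ∃ᶠ t in cofinalFilterOne D ξ, t ∈ E := by
  induction ξ using Ordinal.limitRecOn with
  | zero =>
    intro E
    rw [cofinalFilterOne_zero, frequently_map, frequently_atTop, cofinalOne,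
      Ordinal.limitRecOn_zero]
    exact ⟨fun h a => (h a).imp fun b hb => hb.symm, fun h a => (h a).imp fun b hb => hb.symm⟩
  | add_one ξ ih =>
    intro E
    rw [cofinalFilterOne_add_one, frequently_bind, frequently_atTop, cofinalOne,
      Ordinal.limitRecOn_add_one]
    have key : ∀ n, cofinalOf ξ (cofinalOne D ξ) n (E ∩ withDirs D (gamma ξ n)) ↔
        ∃ᶠ t in cofinalFilter D ξ n, t ∈ E := by
      intro n
      rw [cofinalOf_iff_of_one ih]
      refine frequently_congr ?_
      filter_upwards [eventually_cofinalFilter ξ n] with t ht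
      exact and_iff_left ht.1
    refine forall_congr' fun m => exists_congr fun n => and_congr_right fun _ => ?_
    refine Iff.trans (and_congr_right fun _ => key n) (and_iff_right_of_imp fun h => ?_)
    rcases n with _ | n
    · simp [cofinalFilter, cofinalFilterOf] at h
    · omega
  | limit ξ hξ ih =>
    intro E
    have : Nonempty (Set.Iio ξ) := ⟨⟨0, hξ.bot_lt⟩⟩
    rw [cofinalFilterOne_limit hξ, frequently_bind, frequently_atTop, cofinalOne,
      Ordinal.limitRecOn_limit _ _ _ _ hξ]
    have key : ∀ ζ < ξ, cofinalOne D (ζ + 1)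
        {s | s ∈ maxNodes (withDirs D (gammaOne (ζ + 1))) ∧ shiftD (ω ^ ζ) s ∈ E} ↔
        ∃ᶠ t in (cofinalFilterOne D (ζ + 1)).map (shiftD (ω ^ ζ)), t ∈ E := by
      intro ζ hζ
      rw [ih _ (hξ.add_one_lt hζ), frequently_map]
      refine frequently_congr ?_
      filter_upwards [eventually_cofinalFilterOne (ζ + 1)] with t ht
      exact and_iff_right (mem_maxNodes_withDirs.2 ht)
    constructor
    · rintro h ⟨η, hη⟩
      obtain ⟨ζ, hζ, hle, hC⟩ := h η hη
      exact ⟨⟨ζ, hζ⟩, hle, (key ζ hζ).1 hC⟩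
    · intro h η hη
      obtain ⟨⟨ζ, hζ⟩, hle, hC⟩ := h ⟨η, hη⟩
      exact ⟨ζ, hζ, hle, (key ζ hζ).2 hC⟩

theorem isCofinalIn_iff {ξ : Ordinal.{v}} {n : ℕ} {E : Set (List (Ordinal.{v} × D))}
    (hE : E ⊆ maxNodes (withDirs D (gamma ξ n))) :
    IsCofinalIn ξ n E ↔ ∃ᶠ t in cofinalFilter D ξ n, t ∈ E := by
  rw [IsCofinalIn, and_iff_right hE, cofinalOf_iff_of_one (cofinalOne_iff ξ)]

end CofinalFilter

/-! ### Transfinite derivation of filters on the dual -/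

section Derivation

variable {𝕜 : Type*} [RCLike 𝕜] {X : Type u} [NormedAddCommGroup X] [NormedSpace 𝕜 X]

variable (𝕜 X) in
/-- The trace on the closed unit ball of the filter of weak neighbourhoods of `0`. A net in the
unit ball is weakly null if and only if it tends to this filter. -/
def weakBall : Filter X :=
  (⨅ φ : StrongDual 𝕜 X, comap φ (𝓝 0)) ⊓ 𝓟 (Metric.closedBall 0 1)

theorem tendsto_weakBall {A : Type*} {l : Filter A} {x : A → X} (hx : ∀ a, ‖x a‖ ≤ 1)
    (h : ∀ φ : StrongDual 𝕜 X, Tendsto (fun a => φ (x a)) l (𝓝 0)) :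
    Tendsto x l (weakBall 𝕜 X) := by
  refine tendsto_inf.2 ⟨tendsto_iInf.2 fun φ => tendsto_comap_iff.2 (h φ), ?_⟩
  exact tendsto_principal.2 (Eventually.of_forall fun a => by simpa using hx a)

theorem weakBall_tendsto (φ : StrongDual 𝕜 X) : Tendsto φ (weakBall 𝕜 X) (𝓝 0) :=
  (tendsto_comap.mono_left (iInf_le _ φ)).mono_left inf_le_left

theorem eventually_weakBall_norm_le : ∀ᶠ x in weakBall 𝕜 X, ‖x‖ ≤ 1 := by
  have : Metric.closedBall (0 : X) 1 ∈ weakBall 𝕜 X := mem_inf_of_right (mem_principal_self _)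
  filter_upwards [this] with x hx
  simpa using hx

theorem pure_zero_le_weakBall : pure 0 ≤ weakBall 𝕜 X :=
  tendsto_weakBall (l := pure ()) (x := fun _ => (0 : X)) (by simp)
    (by simp) |>.trans' (by simp)

/-- The derivation of filters on the dual: `L` is frequent for `filterStep b G` if and only if each
weak neighbourhood of `0` contains a vector `x` in the unit ball such that `{f ∈ L | b ≤ Re f(x)}`
is frequent for `G`. -/
def filterStep (b : ℝ) (G : Filter (WeakDual 𝕜 X)) : Filter (WeakDual 𝕜 X) :=
  (weakBall 𝕜 X).bind fun x => G ⊓ 𝓟 {f | b ≤ RCLike.re (f x)}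

theorem filterStep_le (b : ℝ) (G : Filter (WeakDual 𝕜 X)) : filterStep b G ≤ G :=
  bind_le (Eventually.of_forall fun _ => inf_le_left)

theorem filterStep_mono {b b' : ℝ} (hb : b' ≤ b) {G G' : Filter (WeakDual 𝕜 X)} (hG : G ≤ G') :
    filterStep b G ≤ filterStep b' G' :=
  bind_mono le_rfl (Eventually.of_forall fun _ =>
    inf_le_inf hG (principal_mono.2 fun _ hf => hb.trans hf))

theorem le_filterStep {b : ℝ} (hb : b ≤ 0) (G : Filter (WeakDual 𝕜 X)) : G ≤ filterStep b G := by
  intro s hs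
  have := pure_zero_le_weakBall (mem_bind'.1 hs)
  rw [mem_pure, Set.mem_ofPred_eq, mem_inf_principal] at this
  filter_upwards [this] with f hf
  exact hf (by simpa using hb)

/-- The transfinite iterates of the derivation of filters, with the constant `β η` in the passage
from `η` to `η + 1`, and infima at limit ordinals. -/
def filterIter (β : Ordinal.{v} → ℝ) (G : Filter (WeakDual 𝕜 X)) (η : Ordinal.{v}) :
    Filter (WeakDual 𝕜 X) :=
  Ordinal.limitRecOn η G (fun η H => filterStep (β η) H) (fun η _ H => ⨅ ζ : Set.Iio η, H ζ.1 ζ.2)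

variable {β β' : Ordinal.{v} → ℝ} {G G' : Filter (WeakDual 𝕜 X)}

theorem filterIter_zero : filterIter β G 0 = G := by
  simp [filterIter]

theorem filterIter_add_one (η : Ordinal.{v}) :
    filterIter β G (η + 1) = filterStep (β η) (filterIter β G η) := by
  rw [filterIter, Ordinal.limitRecOn_add_one]
  rfl

theorem filterIter_limit {η : Ordinal.{v}} (hη : Order.IsSuccLimit η) :
    filterIter β G η = ⨅ ζ : Set.Iio η, filterIter β G ζ.1 := by
  rw [filterIter, Ordinal.limitRecOn_limit _ _ _ _ hη]
  rfl

theorem filterIter_anti {η θ : Ordinal.{v}} (h : η ≤ θ) : filterIter β G θ ≤ filterIter β G η := by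
  induction θ using Ordinal.limitRecOn with
  | zero =>
    rw [nonpos_iff_eq_zero] at h
    rw [h]
  | add_one θ ih =>
    rcases h.eq_or_lt with rfl | h
    · exact le_rfl
    · rw [filterIter_add_one]
      exact (filterStep_le _ _).trans (ih (Order.lt_add_one_iff.1 h))
  | limit θ hθ ih =>
    rcases h.eq_or_lt with rfl | h
    · exact le_rfl
    · rw [filterIter_limit hθ]
      exact iInf_le (fun ζ : Set.Iio θ => filterIter β G ζ.1) ⟨η, h⟩

theorem filterIter_le (η : Ordinal.{v}) : filterIter β G η ≤ G := by
  conv_rhs => rw [← filterIter_zero (β := β) (G := G)]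
  exact filterIter_anti (by simp)

theorem filterIter_mono {η : Ordinal.{v}} (hβ : ∀ o < η, β' o ≤ β o) (hG : G ≤ G') :
    filterIter β G η ≤ filterIter β' G' η := by
  induction η using Ordinal.limitRecOn with
  | zero => rwa [filterIter_zero, filterIter_zero]
  | add_one η ih =>
    rw [filterIter_add_one, filterIter_add_one]
    exact filterStep_mono (hβ _ (lt_add_one η)) (ih fun o ho => hβ o (ho.trans (lt_add_one η)))
  | limit η hη ih =>
    rw [filterIter_limit hη, filterIter_limit hη]
    exact iInf_mono fun ζ => ih _ ζ.2 fun o ho => hβ o (ho.trans ζ.2)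

theorem le_filterIter {η : Ordinal.{v}} (hβ : ∀ o < η, β o ≤ 0) : G ≤ filterIter β G η := by
  induction η using Ordinal.limitRecOn with
  | zero => rw [filterIter_zero]
  | add_one η ih =>
    rw [filterIter_add_one]
    exact (ih fun o ho => hβ o (ho.trans (lt_add_one η))).trans
      (le_filterStep (hβ _ (lt_add_one η)) _)
  | limit η hη ih =>
    rw [filterIter_limit hη]
    exact le_iInf fun ζ => ih _ ζ.2 fun o ho => hβ o (ho.trans ζ.2)

theorem filterIter_add (η θ : Ordinal.{v}) :
    filterIter β G (η + θ) = filterIter (fun o => β (η + o)) (filterIter β G η) θ := by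
  induction θ using Ordinal.limitRecOn with
  | zero => rw [add_zero, filterIter_zero]
  | add_one θ ih => rw [← add_assoc, filterIter_add_one, filterIter_add_one, ih]
  | limit θ hθ ih =>
    rw [filterIter_limit (Ordinal.isSuccLimit_add η hθ), filterIter_limit hθ]
    refine le_antisymm (le_iInf fun ζ => ?_) (le_iInf fun ζ => ?_)
    · rw [← ih _ ζ.2]
      exact iInf_le (fun ζ : Set.Iio (η + θ) => filterIter β G ζ.1)
        ⟨η + ζ.1, (add_lt_add_iff_left η).2 ζ.2⟩
    · obtain ⟨o, ho, hle⟩ := (Ordinal.lt_add_iff hθ.ne_bot).1 ζ.2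
      refine le_trans (iInf_le _ (⟨o, ho⟩ : Set.Iio θ)) ?_
      rw [← ih _ ho]
      exact filterIter_anti hle

theorem mem_filterIter_limit {η : Ordinal.{v}} (hη : Order.IsSuccLimit η)
    {s : Set (WeakDual 𝕜 X)} : s ∈ filterIter β G η ↔ ∃ ζ < η, s ∈ filterIter β G ζ := by
  have : Nonempty (Set.Iio η) := ⟨⟨0, hη.bot_lt⟩⟩
  rw [filterIter_limit hη, mem_iInf_of_directed]
  · simp
  · intro a b
    exact ⟨max a b, filterIter_anti (le_max_left a.1 b.1), filterIter_anti (le_max_right a.1 b.1)⟩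

theorem frequently_filterIter_limit {η : Ordinal.{v}} (hη : Order.IsSuccLimit η)
    {q : WeakDual 𝕜 X → Prop} :
    (∃ᶠ f in filterIter β G η, q f) ↔ ∀ ζ < η, ∃ᶠ f in filterIter β G ζ, q f := by
  simp only [Filter.Frequently, Filter.Eventually, mem_filterIter_limit hη]
  push Not
  rfl

theorem frequently_filterStep {b : ℝ} {q : WeakDual 𝕜 X → Prop} :
    (∃ᶠ f in filterStep b G, q f) ↔
      ∃ᶠ x in weakBall 𝕜 X, ∃ᶠ f in G, b ≤ RCLike.re (f x) ∧ q f := by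
  rw [filterStep, frequently_bind]
  simp only [frequently_inf_principal]
  rfl

end Derivation

section Stabilization

variable {𝕜 : Type*} [RCLike 𝕜] {X : Type u} [NormedAddCommGroup X] [NormedSpace 𝕜 X]
variable {D : Type u} [Preorder D]

/-! ### Weakly null collections on subtrees -/

theorem IsWeaklyNullInBall.comp_shiftD {ξ : Ordinal.{v}} {n : ℕ} {x : List (Ordinal.{v} × D) → X}
    (hx : IsWeaklyNullInBall 𝕜 ξ (n + 1) x) :
    IsWeaklyNullInBall 𝕜 ξ 1 (fun r => x (shiftD (ω ^ ξ * n) r)) := by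
  rw [IsWeaklyNullInBall, gamma_one]
  refine ⟨fun t ht => hx.1 _ (mem_gamma_succ.2 (Or.inl ⟨_, ht, map_fst_shiftD _ _⟩)),
    fun t ζ ht f => ?_⟩
  have := hx.2 (shiftD (ω ^ ξ * n) t) (ω ^ ξ * n + ζ)
    (mem_gamma_succ.2 (Or.inl ⟨_, ht, by rw [map_fst_shiftD]; simp [shift]⟩)) f
  simpa [shiftD] using this

theorem IsWeaklyNullInBall.append {ξ : Ordinal.{v}} {n : ℕ} {x : List (Ordinal.{v} × D) → X}
    (hx : IsWeaklyNullInBall 𝕜 ξ (n + 1) x) {t : List (Ordinal.{v} × D)}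
    (ht : t.map Prod.fst ∈ maxNodes (gammaOne ξ)) :
    IsWeaklyNullInBall 𝕜 ξ n (fun r => x (shiftD (ω ^ ξ * n) t ++ r)) := by
  refine ⟨fun s hs => hx.1 _ (mem_gamma_succ.2 (Or.inr ⟨_, ht, _, hs, ?_⟩)), fun s ζ hs f => ?_⟩
  · rw [List.map_append, map_fst_shiftD]
  · have := hx.2 (shiftD (ω ^ ξ * n) t ++ s) ζ
      (mem_gamma_succ.2 (Or.inr ⟨_, ht, _, hs, by
        rw [List.map_append, map_fst_shiftD, List.append_assoc]⟩)) f
    simpa only [List.append_assoc] using this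

theorem IsWeaklyNullInBall.of_add_one {ξ : Ordinal.{v}} {n : ℕ} {x : List (Ordinal.{v} × D) → X}
    (hx : IsWeaklyNullInBall 𝕜 (ξ + 1) 1 x) (hn : 1 ≤ n) : IsWeaklyNullInBall 𝕜 ξ n x := by
  rw [IsWeaklyNullInBall, gamma_one, gammaOne_add_one] at hx
  exact ⟨fun t ht => hx.1 t ⟨n, hn, ht⟩, fun t ζ ht => hx.2 t ζ ⟨n, hn, ht⟩⟩

theorem IsWeaklyNullInBall.of_limit {ξ ζ : Ordinal.{v}} {x : List (Ordinal.{v} × D) → X}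
    (hx : IsWeaklyNullInBall 𝕜 ξ 1 x) (hξ : Order.IsSuccLimit ξ) (hζ : ζ < ξ) :
    IsWeaklyNullInBall 𝕜 (ζ + 1) 1 (fun r => x (shiftD (ω ^ ζ) r)) := by
  rw [IsWeaklyNullInBall, gamma_one, gammaOne_limit hξ] at hx
  rw [IsWeaklyNullInBall, gamma_one]
  refine ⟨fun t ht => hx.1 _ ⟨ζ, hζ, _, ht, map_fst_shiftD _ _⟩, fun t o ht f => ?_⟩
  have := hx.2 (shiftD (ω ^ ζ) t) (ω ^ ζ + o)
    ⟨ζ, hζ, _, ht, by rw [map_fst_shiftD]; simp [shift]⟩ f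
  simpa [shiftD] using this

theorem average_mem_closedBall (n : ℕ) (w : ℕ → X) (_ : 1 ≤ n)
    (hw : ∀ i < n, w i ∈ Metric.closedBall (0 : X) 1) :
    (n : 𝕜)⁻¹ • ∑ i ∈ Finset.range n, w i ∈ Metric.closedBall (0 : X) 1 := by
  simp only [mem_closedBall_zero_iff] at hw ⊢
  rw [norm_smul, norm_inv, RCLike.norm_natCast]
  have h : ‖∑ i ∈ Finset.range n, w i‖ ≤ n := by
    refine (norm_sum_le_of_le _ fun i hi => hw i (Finset.mem_range.1 hi)).trans ?_
    simp
  calc (n : ℝ)⁻¹ * ‖∑ i ∈ Finset.range n, w i‖ ≤ (n : ℝ)⁻¹ * n := by gcongr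
    _ ≤ 1 := inv_mul_le_one

theorem IsWeaklyNullInBall.norm_blockVec_le {ξ : Ordinal.{v}} {n i : ℕ} (hi : i < n)
    {x : List (Ordinal.{v} × D) → X} (hx : IsWeaklyNullInBall 𝕜 ξ n x)
    {t : List (Ordinal.{v} × D)} (ht : t.map Prod.fst ∈ maxNodes (gamma ξ n)) :
    ‖blockVec 𝕜 ξ n i x t‖ ≤ 1 := by
  rw [← mem_closedBall_zero_iff]
  exact blockVec_mem average_mem_closedBall hi ht fun r _ h =>
    mem_closedBall_zero_iff.2 (hx.1 r (level_subset_gamma h))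

/-! ### Stabilization along cofinal sets -/

/-- The composition `T (n - 1) ∘ ⋯ ∘ T 0`. -/
def iterateOps {A : Type*} (T : ℕ → A → A) : ℕ → A → A
  | 0, a => a
  | n + 1, a => T n (iterateOps T n a)

theorem mem_bind_cofinalFilter_add_two {A : Type*} {ξ : Ordinal.{v}} {n : ℕ} {s : Set A}
    {m : List (Ordinal.{v} × D) → Filter A} :
    s ∈ (cofinalFilter D ξ (n + 2)).bind m ↔ ∀ᶠ t in cofinalFilterOne D ξ,
      ∀ᶠ r in cofinalFilter D ξ (n + 1), s ∈ m (shiftD (ω ^ ξ * (n + 1 : ℕ)) t ++ r) := by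
  rw [mem_bind', cofinalFilter_add_two]
  exact eventually_bind

/-- If `T j` controls the passage along one block subject to the constraint `P j`, then the
composition of these operators controls the passage along `n` blocks. The block `z_i^t` has the
index `j = n - i`, as the last block corresponds to the operator applied first. -/
theorem bind_blocks_le {ξ : Ordinal.{v}} {R : ℝ}
    {T : ℕ → Filter (WeakDual 𝕜 X) → Filter (WeakDual 𝕜 X)} {P : ℕ → X → Set (WeakDual 𝕜 X)}
    (hle : ∀ j G, T j G ≤ G)
    (hT : ∀ j G, (∀ᶠ f in G, ‖WeakDual.toStrongDual f‖ ≤ R) →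
      ∀ x : List (Ordinal.{v} × D) → X, IsWeaklyNullInBall 𝕜 ξ 1 x →
        ((cofinalFilterOne D ξ).bind fun t => G ⊓ 𝓟 (P j (blockVec 𝕜 ξ 1 0 x t))) ≤ T j G)
    {G : Filter (WeakDual 𝕜 X)} (hG : ∀ᶠ f in G, ‖WeakDual.toStrongDual f‖ ≤ R) (n : ℕ) :
    ∀ x : List (Ordinal.{v} × D) → X, IsWeaklyNullInBall 𝕜 ξ n x →
      ((cofinalFilter D ξ n).bind fun t =>
        G ⊓ 𝓟 {f | ∀ j < n, f ∈ P j (blockVec 𝕜 ξ n (n - 1 - j) x t)}) ≤ iterateOps T n G := by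
  have hcomp : ∀ n, iterateOps T n G ≤ G := by
    intro n
    induction n with
    | zero => exact le_rfl
    | succ n ih => exact (hle _ _).trans ih
  induction n with
  | zero =>
    intro x _
    exact bind_le mem_bot
  | succ n ih =>
    intro x hx
    rcases n with _ | n
    · refine (bind_mono le_rfl (Eventually.of_forall fun t => ?_)).trans (hT 0 G hG x hx)
      exact inf_le_inf le_rfl (principal_mono.2 fun f hf => by simpa using hf 0 one_pos)
    intro s hs
    have hs' := mem_bind'.1 (hT (n + 1) _ (hG.filter_mono (hcomp (n + 1))) _ hx.comp_shiftD hs)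
    rw [mem_bind_cofinalFilter_add_two]
    filter_upwards [hs', eventually_cofinalFilterOne ξ] with t ht htmax
    have hr := mem_bind'.1 (ih _ (hx.append htmax) (mem_inf_principal.1 ht))
    filter_upwards [hr, eventually_cofinalFilter ξ (n + 1)] with r hr hrmax
    have hlt := gamma_div_lt hrmax.1
    replace hr := mem_inf_principal.1 hr
    refine mem_inf_principal.2 ?_
    filter_upwards [hr] with f hf hP
    refine hf (fun j hj => ?_) ?_
    · have := hP j (by omega)
      rw [show n + 1 + 1 - 1 - j = (n + 1 - 1 - j) + 1 by omega,
        blockVec_append_succ _ x htmax hlt] at this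
      exact this
    · have := hP (n + 1) (by omega)
      rw [show n + 1 + 1 - 1 - (n + 1) = 0 by omega, blockVec_append_zero x t hlt] at this
      exact this

/-- If the average of `n` numbers bounded by `R` is at least `c`, then a proportion of at least
`(c - c') / (R - c')` of them is at least `c'`. -/
theorem le_card_filter_of_average {n m : ℕ} {w : ℕ → ℝ} {c c' R : ℝ}
    (hw : ∀ j < n, w j ≤ R) (hR : c' < R) (hsum : n * c ≤ ∑ j ∈ Finset.range n, w j)
    (hm : m * (R - c') ≤ n * (c - c')) :
    m ≤ ((Finset.range n).filter fun j => c' ≤ w j).card := by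
  set A := (Finset.range n).filter fun j => c' ≤ w j
  have h1 : ∑ j ∈ Finset.range n, w j ≤ ∑ j ∈ Finset.range n, (c' + if c' ≤ w j then R - c' else 0) := by
    refine Finset.sum_le_sum fun j hj => ?_
    split_ifs with h
    · linarith [hw j (Finset.mem_range.1 hj)]
    · linarith
  rw [Finset.sum_add_distrib, ← Finset.sum_filter] at h1
  simp only [Finset.sum_const, Finset.card_range, _root_.nsmul_eq_mul] at h1
  have h2 : (m : ℝ) * (R - c') ≤ A.card * (R - c') := by
    change _ ≤ _ + (A.card : ℝ) * _ at h1
    linarith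
  exact_mod_cast le_of_mul_le_mul_right h2 (by linarith)

theorem iterateOps_ite_mem (b : ℝ) (ξ : Ordinal.{v}) (G : Filter (WeakDual 𝕜 X)) (A : Finset ℕ)
    (n : ℕ) :
    iterateOps (fun j G => if j ∈ A then filterIter (fun _ => b) G (ω ^ ξ) else G) n G =
      filterIter (fun _ => b) G (ω ^ ξ * ((Finset.range n).filter (· ∈ A)).card) := by
  induction n with
  | zero => simp [iterateOps, filterIter_zero]
  | succ n ih =>
    rw [iterateOps, ih, Finset.range_add_one, Finset.filter_insert]
    split_ifs with h
    · rw [Finset.card_insert_of_notMem (by simp), Nat.cast_add_one, mul_add_one,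
        filterIter_add]
    · rfl

theorem re_average (f : WeakDual 𝕜 X) (n : ℕ) (w : ℕ → X) :
    RCLike.re (f ((n : 𝕜)⁻¹ • ∑ i ∈ Finset.range n, w i)) =
      (n : ℝ)⁻¹ * ∑ i ∈ Finset.range n, RCLike.re (f (w i)) := by
  rw [map_smul, map_sum, _root_.smul_eq_mul, ← RCLike.ofReal_natCast, ← RCLike.ofReal_inv,
    RCLike.re_ofReal_mul, map_sum]

theorem re_apply_le {f : WeakDual 𝕜 X} {R : ℝ} (hf : ‖WeakDual.toStrongDual f‖ ≤ R) {x : X}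
    (hx : ‖x‖ ≤ 1) : RCLike.re (f x) ≤ R := by
  have h0 : 0 ≤ R := (norm_nonneg _).trans hf
  calc RCLike.re (f x) ≤ ‖f x‖ := RCLike.re_le_norm _
    _ ≤ ‖WeakDual.toStrongDual f‖ * ‖x‖ := (WeakDual.toStrongDual f).le_opNorm x
    _ ≤ R * 1 := by gcongr
    _ = R := mul_one R

/-- If for a cofinal set of maximal members `t` of `Γ_{ξ,1}.D` the functionals with
`c ≤ Re f(z^t)` are frequent for `G`, then the union of these sets is frequent for the derived
filters of `G` up to the order `ω^ξ`, with any constant `b < c`. In the passage from `ξ` to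
`ξ + 1`, an average of `n` blocks that is at least `c` has a number of blocks above `b` that tends
to infinity with `n`. -/
theorem bind_cofinalFilterOne_le {R : ℝ} (ξ : Ordinal.{v}) :
    ∀ {b c : ℝ}, b < c → ∀ G : Filter (WeakDual 𝕜 X),
      (∀ᶠ f in G, ‖WeakDual.toStrongDual f‖ ≤ R) →
      ∀ x : List (Ordinal.{v} × D) → X, IsWeaklyNullInBall 𝕜 ξ 1 x →
      ((cofinalFilterOne D ξ).bind fun t =>
        G ⊓ 𝓟 {f | c ≤ RCLike.re (f (blockVec 𝕜 ξ 1 0 x t))}) ≤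
          filterIter (fun _ : Ordinal.{v} => b) G (ω ^ ξ) := by
  induction ξ using Ordinal.limitRecOn with
  | zero =>
    intro b c hbc G hG x hx
    rw [IsWeaklyNullInBall, gamma_one, gammaOne_zero] at hx
    rw [Ordinal.opow_zero, ← zero_add (1 : Ordinal.{v}), filterIter_add_one, filterIter_zero,
      cofinalFilterOne_zero, bind_map]
    have hlim : Tendsto (fun u : D => x [((0 : Ordinal.{v}), u)]) atTop (weakBall 𝕜 X) :=
      tendsto_weakBall (fun u => hx.1 _ rfl) fun φ => by simpa using hx.2 [] 0 (by simp) φ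
    refine le_trans ?_ (bind_mono hlim (Eventually.of_forall fun _ => le_rfl))
    rw [bind_map]
    refine bind_mono le_rfl (Eventually.of_forall fun u => inf_le_inf le_rfl ?_)
    simp only [blockVec_zero]
    exact principal_mono.2 fun f hf => hbc.le.trans hf
  | add_one ξ ih =>
    intro b c hbc G hG x hx s hs
    rw [Ordinal.opow_add_one, mem_filterIter_limit
      (Ordinal.isSuccLimit_mul_right (opow_omega_ne_zero ξ).bot_lt isSuccLimit_omega0)] at hs
    obtain ⟨η, hη, hs⟩ := hs
    obtain ⟨k, hk, hη⟩ := (Ordinal.lt_mul_iff_of_isSuccLimit isSuccLimit_omega0).1 hη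
    obtain ⟨m, rfl⟩ := Ordinal.lt_omega0.1 hk
    replace hs := filterIter_anti hη.le hs
    obtain ⟨c', hbc', hc'⟩ := exists_between hbc
    obtain ⟨R', hR', hR'c⟩ : ∃ R', R ≤ R' ∧ c' < R' :=
      ⟨max R (c' + 1), le_max_left _ _, (lt_add_one c').trans_le (le_max_right _ _)⟩
    rw [mem_bind', cofinalFilterOne_add_one]
    change ∀ᶠ t in _, _
    -- For `f` bounded by `R'`, an average of `n` values at least `c` forces at least
    -- `n (c - c') / (R' - c')` of the values to be at least `c'`, hence at least `m` for large `n`.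
    have hlarge : ∀ᶠ n : ℕ in atTop, m * (R' - c') ≤ n * (c - c') :=
      (tendsto_natCast_atTop_atTop.atTop_mul_const (sub_pos.2 hc')).eventually_ge_atTop _
    rw [eventually_bind]
    filter_upwards [hlarge, eventually_ge_atTop 1] with n hn hn1
    have hxn := hx.of_add_one hn1
    -- For each set `A` of at least `m` blocks, only the blocks in `A` are used for derivations.
    have hA : ∀ A ∈ (Finset.range n).powerset, ∀ᶠ t in cofinalFilter D ξ n, m ≤ A.card →
        s ∈ G ⊓ 𝓟 {f | ∀ j ∈ A, c' ≤ RCLike.re (f (blockVec 𝕜 ξ n (n - 1 - j) x t))} := by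
      intro A hA
      by_cases hm : m ≤ A.card
      swap
      · exact Eventually.of_forall fun t h => absurd h hm
      have key := bind_blocks_le (D := D) (ξ := ξ)
        (T := fun j G => if j ∈ A then filterIter (fun _ : Ordinal.{v} => b) G (ω ^ ξ) else G)
        (P := fun j z => {f : WeakDual 𝕜 X | j ∈ A → c' ≤ RCLike.re (f z)})
        (fun j G => by
          split_ifs
          · exact filterIter_le _
          · exact le_rfl)
        (fun j G hG x hx => by
          by_cases hj : j ∈ A
          · simpa only [hj, if_true, true_imp_iff] using ih hbc' G hG x hx
          · simp only [hj, if_false]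
            exact bind_le (Eventually.of_forall fun _ => inf_le_left)) hG n x hxn
      rw [iterateOps_ite_mem, Finset.filter_mem_eq_inter,
        Finset.inter_eq_right.2 (Finset.mem_powerset.1 hA)] at key
      have hs' := key (filterIter_anti (mul_le_mul_right (Nat.cast_le.2 hm) _) hs)
      filter_upwards [mem_bind'.1 hs'] with t ht _
      refine inf_le_inf le_rfl (principal_mono.2 fun f hf j _ hj => ?_) ht
      exact hf j hj
    filter_upwards [(Finset.eventually_all _).2 hA, eventually_cofinalFilter ξ n] with t ht htmax
    refine mem_inf_principal.2 ?_
    have hall : ∀ᶠ f in G, ∀ A ∈ (Finset.range n).powerset, m ≤ A.card →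
        (∀ j ∈ A, c' ≤ RCLike.re (f (blockVec 𝕜 ξ n (n - 1 - j) x t))) → f ∈ s := by
      refine (Finset.eventually_all _).2 fun A hA => ?_
      by_cases hm : m ≤ A.card
      · filter_upwards [mem_inf_principal.1 (ht A hA hm)] with f hf _
        exact hf
      · exact Eventually.of_forall fun f h => absurd h hm
    filter_upwards [hall, hG] with f hf hfR hfc
    refine hf _ (Finset.mem_powerset.2 (Finset.filter_subset _ _))
      (le_card_filter_of_average (fun j hj => ?_) hR'c ?_ hn) fun j hj => (Finset.mem_filter.1 hj).2
    · exact (re_apply_le hfR (hxn.norm_blockVec_le (by omega) htmax)).trans hR'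
    · rw [Finset.sum_range_reflect (fun i => RCLike.re (f (blockVec 𝕜 ξ n i x t)))]
      have hfc' : c ≤ _ := hfc
      rw [blockVec_add_one x htmax.1, re_average] at hfc'
      rwa [le_inv_mul_iff₀ (by exact_mod_cast hn1)] at hfc'
  | limit ξ hξ ih =>
    intro b c hbc G hG x hx s hs
    rw [mem_filterIter_limit (Ordinal.isSuccLimit_opow one_lt_omega0 hξ)] at hs
    obtain ⟨η, hη, hs⟩ := hs
    obtain ⟨ζ₀, hζ₀, hη⟩ := (Ordinal.lt_opow_of_isSuccLimit omega0_ne_zero hξ).1 hη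
    rw [mem_bind', cofinalFilterOne_limit hξ]
    change ∀ᶠ t in _, _
    rw [eventually_bind]
    filter_upwards [eventually_ge_atTop (⟨ζ₀, hζ₀⟩ : Set.Iio ξ)] with ζ hζ
    have hle : η ≤ ω ^ (ζ.1 + 1) := hη.le.trans
      (Ordinal.opow_le_opow_right omega0_pos (le_trans hζ (lt_add_one ζ.1).le))
    have hmem := mem_bind'.1 (ih _ (hξ.add_one_lt ζ.2) hbc G hG _ (hx.of_limit hξ ζ.2)
      (filterIter_anti hle hs))
    rw [eventually_map]
    filter_upwards [hmem, eventually_cofinalFilterOne (ζ.1 + 1)] with t ht htmax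
    rw [blockVec_limit hξ ζ.2 x htmax.1]
    exact ht

end Stabilization

section Dual

variable {𝕜 : Type*} [RCLike 𝕜] {X : Type u} [NormedAddCommGroup X] [NormedSpace 𝕜 X]

/-! ### Szlenk derivations and derivations of filters -/

theorem szlenkIter_zero (ε : ℝ) (K : Set (WeakDual 𝕜 X)) :
    szlenkIter ε K (0 : Ordinal.{v}) = K := by
  simp [szlenkIter]

theorem szlenkIter_add_one (ε : ℝ) (K : Set (WeakDual 𝕜 X)) (η : Ordinal.{v}) :
    szlenkIter ε K (η + 1) = szlenkDeriv ε (szlenkIter ε K η) := by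
  rw [szlenkIter, Ordinal.limitRecOn_add_one]
  rfl

theorem szlenkIter_limit (ε : ℝ) (K : Set (WeakDual 𝕜 X)) {η : Ordinal.{v}}
    (hη : Order.IsSuccLimit η) : szlenkIter ε K η = ⋂ ζ : Set.Iio η, szlenkIter ε K ζ.1 := by
  rw [szlenkIter, Ordinal.limitRecOn_limit _ _ _ _ hη, Set.iInter_subtype]
  rfl

theorem szlenkIter_anti {ε : ℝ} {K : Set (WeakDual 𝕜 X)} {η θ : Ordinal.{v}} (h : η ≤ θ) :
    szlenkIter ε K θ ⊆ szlenkIter ε K η := by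
  induction θ using Ordinal.limitRecOn with
  | zero =>
    rw [nonpos_iff_eq_zero] at h
    rw [h]
  | add_one θ ih =>
    rcases h.eq_or_lt with rfl | h
    · exact subset_rfl
    · rw [szlenkIter_add_one]
      exact fun f hf => ih (Order.lt_add_one_iff.1 h) hf.1
  | limit θ hθ ih =>
    rcases h.eq_or_lt with rfl | h
    · exact subset_rfl
    · rw [szlenkIter_limit _ _ hθ]
      exact Set.iInter_subset (fun ζ : Set.Iio θ => szlenkIter ε K ζ.1) ⟨η, h⟩

theorem szlenkIter_subset {ε : ℝ} {K : Set (WeakDual 𝕜 X)} {η : Ordinal.{v}} :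
    szlenkIter ε K η ⊆ K := by
  have := szlenkIter_anti (ε := ε) (K := K) (η := 0) (θ := η) (by simp)
  rwa [szlenkIter_zero] at this

theorem isClosed_szlenkDeriv {ε : ℝ} {L : Set (WeakDual 𝕜 X)} (hL : IsClosed L) :
    IsClosed (szlenkDeriv ε L) := by
  rw [← isOpen_compl_iff, isOpen_iff_mem_nhds]
  intro f hf
  by_cases hfL : f ∈ L
  · have : ∃ V ∈ 𝓝 f, ¬ ∃ g ∈ V ∩ L, ∃ h ∈ V ∩ L,
        ε < ‖WeakDual.toStrongDual g - WeakDual.toStrongDual h‖ := by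
      by_contra! h
      exact hf ⟨hfL, h⟩
    obtain ⟨V, hV, hVL⟩ := this
    filter_upwards [eventually_eventually_nhds.2 hV] with g hg hgd
    exact hVL (hgd.2 V hg)
  · filter_upwards [hL.isOpen_compl.mem_nhds hfL] with g hg hgd
    exact hg hgd.1

theorem isClosed_szlenkIter {ε : ℝ} {K : Set (WeakDual 𝕜 X)} (hK : IsClosed K) (η : Ordinal.{v}) :
    IsClosed (szlenkIter ε K η) := by
  induction η using Ordinal.limitRecOn with
  | zero => rwa [szlenkIter_zero]
  | add_one η ih =>
    rw [szlenkIter_add_one]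
    exact isClosed_szlenkDeriv ih
  | limit η hη ih =>
    rw [szlenkIter_limit _ _ hη]
    exact isClosed_iInter fun ζ => ih _ ζ.2

theorem exists_lt_re_of_lt_norm {g : StrongDual 𝕜 X} {r : ℝ} (hr : 0 ≤ r) (h : r < ‖g‖) :
    ∃ y : X, ‖y‖ ≤ 1 ∧ r < RCLike.re (g y) := by
  obtain ⟨y, hy, hgy⟩ := ContinuousLinearMap.exists_lt_apply_of_lt_opNorm g h
  have hne : g y ≠ 0 := norm_pos_iff.1 (hr.trans_lt hgy)
  obtain ⟨c, hc, hcg⟩ := RCLike.exists_norm_eq_mul_self (g y)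
  refine ⟨c • y, by rw [norm_smul, hc, one_mul]; exact hy.le, ?_⟩
  rw [map_smul, _root_.smul_eq_mul, ← hcg, RCLike.ofReal_re]
  exact hgy

/-- If the differences `(g - f)(y)` of the members of a set near `f` are large, then the members of
this set near `f` are large on weakly null vectors: these are obtained as differences of the
vectors `y`. -/
theorem frequently_weakBall_of_mem_szlenkDeriv {ε : ℝ} (hε : 0 < ε) {L : Set (WeakDual 𝕜 X)}
    {f : WeakDual 𝕜 X} (hf : f ∈ szlenkDeriv ε L) {V : Set (WeakDual 𝕜 X)} (hV : V ∈ 𝓝 f) :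
    ∃ᶠ x in weakBall 𝕜 X, ∃ g ∈ L, V ∈ 𝓝 g ∧ ε / 8 < RCLike.re (g x) := by
  set S : Set (WeakDual 𝕜 X × X) :=
    {q | q.1 ∈ L ∧ ‖q.2‖ ≤ 1 ∧ ε / 2 < RCLike.re (q.1 q.2) - RCLike.re (f q.2)} with hS
  have hne : (comap Prod.fst (𝓝 f) ⊓ 𝓟 S).NeBot := by
    rw [← frequently_mem_iff_neBot, frequently_comap]
    refine frequently_iff.2 fun {V} hV => ?_
    have key : ∃ g ∈ V ∩ L, ε / 2 < ‖WeakDual.toStrongDual g - WeakDual.toStrongDual f‖ := by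
      obtain ⟨g, hg, h, hh, hgh⟩ := hf.2 V hV
      by_contra! hcon
      have h1 := hcon g hg
      have h2 := hcon h hh
      have h3 := norm_sub_le_norm_sub_add_norm_sub (WeakDual.toStrongDual g)
        (WeakDual.toStrongDual f) (WeakDual.toStrongDual h)
      rw [norm_sub_rev (WeakDual.toStrongDual f)] at h3
      linarith
    obtain ⟨g, hg, hgf⟩ := key
    obtain ⟨y, hy, hgy⟩ := exists_lt_re_of_lt_norm (by positivity) hgf
    refine ⟨g, hg.1, (g, y), rfl, hg.2, hy, ?_⟩
    simpa using hgy
  obtain ⟨𝒱, h𝒱⟩ := Ultrafilter.exists_le (comap Prod.fst (𝓝 f) ⊓ 𝓟 S)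
  have hmem : ∀ᶠ q in (𝒱 : Filter _), q ∈ S := h𝒱 (mem_inf_of_right (mem_principal_self S))
  have hfst : Tendsto Prod.fst (𝒱 : Filter (WeakDual 𝕜 X × X)) (𝓝 f) :=
    tendsto_comap.mono_left (h𝒱.trans inf_le_left)
  have hlim : ∀ φ : StrongDual 𝕜 X, ∃ l, Tendsto (fun q : WeakDual 𝕜 X × X => φ q.2) 𝒱 (𝓝 l) := by
    intro φ
    obtain ⟨l, -, hl⟩ := (isCompact_closedBall (0 : 𝕜) ‖φ‖).ultrafilter_le_nhds
      (𝒱.map fun q => φ q.2) (by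
        rw [le_principal_iff, Ultrafilter.mem_coe, Ultrafilter.mem_map]
        filter_upwards [hmem] with q hq
        simpa using φ.le_of_opNorm_le_of_le le_rfl hq.2.1)
    exact ⟨l, hl⟩
  have hdiff : Tendsto (fun q : (WeakDual 𝕜 X × X) × (WeakDual 𝕜 X × X) =>
      (2 : 𝕜)⁻¹ • (q.2.2 - q.1.2)) (𝒱 ×ˢ 𝒱 : Filter _) (weakBall 𝕜 X) := by
    refine tendsto_inf.2 ⟨tendsto_iInf.2 fun φ => tendsto_comap_iff.2 ?_, ?_⟩
    · obtain ⟨l, hl⟩ := hlim φ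
      have := ((hl.comp tendsto_snd).sub (hl.comp tendsto_fst)).const_smul (2 : 𝕜)⁻¹
      rw [_root_.sub_self, smul_zero] at this
      refine this.congr fun q => ?_
      simp
    · refine tendsto_principal.2 ?_
      filter_upwards [hmem.prod_mk hmem] with q hq
      rw [mem_closedBall_zero_iff, norm_smul, norm_inv, RCLike.norm_ofNat]
      have := norm_sub_le q.2.2 q.1.2
      have h1 := hq.1.2.1
      have h2 := hq.2.2.1
      linarith
  intro hbad
  -- For `q` fixed first and `r` depending on `q`, the vector `x = (r.2 - q.2) / 2` satisfies
  -- `r.1 x = ((r.1 - f) r.2 - (r.1 - f) q.2) / 2 + f x`, with real part at least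
  -- `ε / 4 - ε / 32 - ε / 16 > ε / 8`.
  have h1 := (hdiff.eventually hbad).curry
  have h2 : ∀ᶠ x in weakBall 𝕜 X, ‖f x‖ < ε / 16 := by
    have := weakBall_tendsto (WeakDual.toStrongDual f)
    exact (tendsto_zero_iff_norm_tendsto_zero.1 this).eventually_lt_const (by positivity)
  have h3 := (hdiff.eventually h2).curry
  obtain ⟨q, hq1, hq3⟩ := (h1.and h3).exists
  have h4 : ∀ᶠ r in (𝒱 : Filter (WeakDual 𝕜 X × X)), ‖r.1 q.2 - f q.2‖ < ε / 16 := by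
    have : Tendsto (fun r : WeakDual 𝕜 X × X => r.1 q.2) 𝒱 (𝓝 (f q.2)) :=
      ((WeakDual.eval_continuous q.2).tendsto f).comp hfst
    exact (tendsto_iff_norm_sub_tendsto_zero.1 this).eventually_lt_const (by positivity)
  have h5 : ∀ᶠ r in (𝒱 : Filter (WeakDual 𝕜 X × X)), V ∈ 𝓝 r.1 :=
    hfst.eventually (eventually_eventually_nhds.2 hV)
  obtain ⟨r, hr1, hr3, hr4, hr5, hrS⟩ :=
    (hq1.and (hq3.and (h4.and (h5.and hmem)))).exists
  refine hr1 ⟨r.1, hrS.1, hr5, ?_⟩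
  have e : r.1 ((2 : 𝕜)⁻¹ • (r.2 - q.2)) =
      ((1 / 2 : ℝ) : 𝕜) * ((r.1 r.2 - f r.2) - (r.1 q.2 - f q.2)) +
        f ((2 : 𝕜)⁻¹ • (r.2 - q.2)) := by
    simp only [map_smul, map_sub, _root_.smul_eq_mul]
    push_cast
    ring
  rw [e, map_add, RCLike.re_ofReal_mul, map_sub, map_sub]
  have h6 := (abs_lt.1 ((RCLike.abs_re_le_norm _).trans_lt hr3)).1
  have h7 := (abs_lt.1 ((RCLike.abs_re_le_norm _).trans_lt hr4)).2
  have h8 := hrS.2.2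
  linarith

/-- The neighbourhoods of the points of the Szlenk derivation are frequent for the derived
filters. -/
theorem frequently_filterIter_of_mem_szlenkIter {ε : ℝ} (hε : 0 < ε) {K : Set (WeakDual 𝕜 X)}
    (η : Ordinal.{v}) : ∀ f ∈ szlenkIter ε K η, ∀ V ∈ 𝓝 f,
      ∃ᶠ g in filterIter (fun _ : Ordinal.{v} => ε / 8) (𝓟 K) η, g ∈ V := by
  induction η using Ordinal.limitRecOn with
  | zero =>
    intro f hf V hV
    rw [szlenkIter_zero] at hf
    rw [filterIter_zero, frequently_principal]
    exact ⟨f, hf, mem_of_mem_nhds hV⟩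
  | add_one η ih =>
    intro f hf V hV
    rw [szlenkIter_add_one] at hf
    rw [filterIter_add_one, frequently_filterStep]
    refine (frequently_weakBall_of_mem_szlenkDeriv hε hf hV).mono fun x hx => ?_
    obtain ⟨g, hg, hVg, hgx⟩ := hx
    have hopen : {h : WeakDual 𝕜 X | ε / 8 < RCLike.re (h x)} ∈ 𝓝 g :=
      (isOpen_lt continuous_const (RCLike.continuous_re.comp (WeakDual.eval_continuous x))).mem_nhds
        hgx
    exact (ih g hg _ (inter_mem hopen hVg)).mono fun h hh => ⟨le_of_lt hh.1, hh.2⟩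
  | limit η hη ih =>
    intro f hf V hV
    rw [szlenkIter_limit _ _ hη] at hf
    exact (frequently_filterIter_limit hη).2 fun ζ hζ =>
      ih ζ hζ f (Set.mem_iInter.1 hf ⟨ζ, hζ⟩) V hV

/-- The closures of the sets that are frequent for the derived filters meet the Szlenk
derivation. -/
theorem exists_mem_szlenkIter_of_frequently {b : ℝ} (hb : 0 < b) {K : Set (WeakDual 𝕜 X)}
    (hK : IsCompact K) (η : Ordinal.{v}) : ∀ L : Set (WeakDual 𝕜 X),
      (∃ᶠ g in filterIter (fun _ : Ordinal.{v} => b) (𝓟 K) η, g ∈ L) →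
      ∃ f ∈ closure L, f ∈ szlenkIter (b / 4) K η := by
  induction η using Ordinal.limitRecOn with
  | zero =>
    intro L hL
    rw [filterIter_zero, frequently_principal] at hL
    obtain ⟨f, hf, hfL⟩ := hL
    exact ⟨f, subset_closure hfL, by rwa [szlenkIter_zero]⟩
  | add_one η ih =>
    intro L hL
    rw [filterIter_add_one, frequently_filterStep] at hL
    have h1 : ∃ᶠ x in weakBall 𝕜 X, ∃ g ∈ closure L, b ≤ RCLike.re (g x) ∧
        g ∈ szlenkIter (b / 4) K η := by
      refine hL.mono fun x hx => ?_
      obtain ⟨g, hg, hgs⟩ := ih ({g | b ≤ RCLike.re (g x)} ∩ L) hx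
      refine ⟨g, closure_mono Set.inter_subset_right hg, ?_, hgs⟩
      have hcl : IsClosed {g : WeakDual 𝕜 X | b ≤ RCLike.re (g x)} :=
        isClosed_le continuous_const (RCLike.continuous_re.comp (WeakDual.eval_continuous x))
      exact closure_minimal Set.inter_subset_left hcl hg
    rw [frequently_iff_neBot] at h1
    obtain ⟨𝒱, h𝒱⟩ := Ultrafilter.exists_le (weakBall 𝕜 X ⊓ 𝓟 {x | ∃ g ∈ closure L,
      b ≤ RCLike.re (g x) ∧ g ∈ szlenkIter (b / 4) K η})
    have hev : ∀ᶠ x in (𝒱 : Filter X), ∃ g ∈ closure L, b ≤ RCLike.re (g x) ∧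
        g ∈ szlenkIter (b / 4) K η := h𝒱 (mem_inf_of_right (mem_principal_self _))
    have hch : ∀ x, ∃ g : WeakDual 𝕜 X, (∃ g ∈ closure L, b ≤ RCLike.re (g x) ∧
        g ∈ szlenkIter (b / 4) K η) → g ∈ closure L ∧ b ≤ RCLike.re (g x) ∧
        g ∈ szlenkIter (b / 4) K η := by
      intro x
      by_cases h : ∃ g ∈ closure L, b ≤ RCLike.re (g x) ∧ g ∈ szlenkIter (b / 4) K η
      · exact ⟨h.choose, fun _ => h.choose_spec⟩
      · exact ⟨0, fun h' => absurd h' h⟩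
    choose g hg using hch
    replace hev := hev.mono fun x hx => hg x hx
    obtain ⟨f, hfK, hf⟩ := hK.ultrafilter_le_nhds (𝒱.map g) (by
      rw [le_principal_iff, Ultrafilter.mem_coe, Ultrafilter.mem_map]
      filter_upwards [hev] with x hx
      exact szlenkIter_subset hx.2.2)
    have hlim : Tendsto g 𝒱 (𝓝 f) := hf
    have hcl := isClosed_szlenkIter (ε := b / 4) hK.isClosed η
    have hfη : f ∈ szlenkIter (b / 4) K η :=
      hcl.mem_of_tendsto hlim (hev.mono fun x hx => hx.2.2)
    refine ⟨f, isClosed_closure.mem_of_tendsto hlim (hev.mono fun x hx => hx.1), ?_⟩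
    rw [szlenkIter_add_one]
    refine ⟨hfη, fun V hV => ?_⟩
    have hsmall : ∀ᶠ x in (𝒱 : Filter X), ‖f x‖ < b / 2 := by
      have := (weakBall_tendsto (WeakDual.toStrongDual f)).mono_left (h𝒱.trans inf_le_left)
      exact (tendsto_zero_iff_norm_tendsto_zero.1 this).eventually_lt_const (by positivity)
    have hnorm : ∀ᶠ x in (𝒱 : Filter X), ‖x‖ ≤ 1 :=
      (h𝒱.trans inf_le_left) eventually_weakBall_norm_le
    obtain ⟨x, hx, hxV, hxf, hx1⟩ :=
      (hev.and ((hlim.eventually hV).and (hsmall.and hnorm))).exists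
    refine ⟨g x, ⟨hxV, hx.2.2⟩, f, ⟨mem_of_mem_nhds hV, hfη⟩, ?_⟩
    have h2 := re_apply_le (f := g x - f) (le_refl _) hx1
    have h3 := (abs_lt.1 ((RCLike.abs_re_le_norm _).trans_lt hxf)).2
    have h4 : RCLike.re ((g x - f) x) = RCLike.re (g x x) - RCLike.re (f x) := by
      rw [← map_sub]
      rfl
    rw [h4, map_sub] at h2
    linarith [hx.2.1]
  | limit η hη ih =>
    intro L hL
    rw [frequently_filterIter_limit hη] at hL
    have : Nonempty (Set.Iio η) := ⟨⟨0, hη.bot_lt⟩⟩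
    have hcl : ∀ ζ : Ordinal.{v}, IsClosed (closure L ∩ szlenkIter (b / 4) K ζ) := fun ζ =>
      isClosed_closure.inter (isClosed_szlenkIter hK.isClosed ζ)
    obtain ⟨f, hf⟩ := IsCompact.nonempty_iInter_of_directed_nonempty_isCompact_isClosed
      (fun ζ : Set.Iio η => closure L ∩ szlenkIter (b / 4) K ζ.1)
      (fun ζ θ => ⟨max ζ θ,
        Set.inter_subset_inter_right _ (szlenkIter_anti (le_max_left ζ.1 θ.1)),
        Set.inter_subset_inter_right _ (szlenkIter_anti (le_max_right ζ.1 θ.1))⟩)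
      (fun ζ => by
        obtain ⟨f, h1, h2⟩ := ih ζ.1 ζ.2 L (hL ζ.1 ζ.2)
        exact ⟨f, h1, h2⟩)
      (fun ζ => hK.of_isClosed_subset (hcl ζ.1) (Set.inter_subset_right.trans szlenkIter_subset))
      (fun ζ => hcl ζ.1)
    rw [Set.mem_iInter] at hf
    refine ⟨f, (hf ⟨0, hη.bot_lt⟩).1, ?_⟩
    rw [szlenkIter_limit _ _ hη]
    exact Set.mem_iInter.2 fun ζ => (hf ζ).2

/-- The Szlenk derivations of order `η` vanish if and only if the derived filters of order `η`
are trivial. -/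
theorem forall_szlenkIter_eq_empty_iff {K : Set (WeakDual 𝕜 X)} (hK : IsCompact K)
    (η : Ordinal.{v}) : (∀ ε : ℝ, 0 < ε → szlenkIter ε K η = ∅) ↔
      ∀ b : ℝ, 0 < b → filterIter (fun _ : Ordinal.{v} => b) (𝓟 K) η = ⊥ := by
  constructor
  · intro h b hb
    by_contra hne
    have : (filterIter (fun _ : Ordinal.{v} => b) (𝓟 K) η).NeBot := ⟨hne⟩
    obtain ⟨f, -, hf⟩ := exists_mem_szlenkIter_of_frequently hb hK η Set.univ
      (Eventually.of_forall fun _ => Set.mem_univ _).frequently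
    rw [h _ (by positivity)] at hf
    exact hf
  · intro h ε hε
    refine Set.eq_empty_of_forall_notMem fun f hf => ?_
    have := frequently_filterIter_of_mem_szlenkIter hε η f hf Set.univ univ_mem
    rw [h _ (by positivity)] at this
    exact this mem_bot

theorem szlenkIndex_le_iff {K : Set (WeakDual 𝕜 X)} (η : Ordinal.{v}) :
    szlenkIndex K ≤ (η : WithTop Ordinal.{v}) ↔ ∀ ε : ℝ, 0 < ε → szlenkIter ε K η = ∅ := by
  rw [szlenkIndex, iSup₂_le_iff]
  refine forall₂_congr fun ε hε => ?_
  constructor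
  · intro h
    have h' : szlenkIndexAt ε K < ((η + 1 : Ordinal.{v}) : WithTop Ordinal.{v}) :=
      h.trans_lt (WithTop.coe_lt_coe.2 (lt_add_one η))
    obtain ⟨_, ⟨ζ, rfl, hζ⟩, hlt⟩ := sInf_lt_iff.1 h'
    rw [WithTop.coe_lt_coe, Order.lt_add_one_iff] at hlt
    exact Set.subset_eq_empty (szlenkIter_anti hlt) hζ
  · intro h
    exact sInf_le ⟨η, rfl, h⟩

end Dual

/-! ### Trees with functionals -/

section Trees

variable {𝕜 : Type*} [RCLike 𝕜] {X : Type u} [NormedAddCommGroup X] [NormedSpace 𝕜 X]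

variable (𝕜 X) in
/-- The traces of the weak neighbourhoods of `0` on the unit ball, directed by reverse inclusion. -/
abbrev WeakNhd : Type u := {U : Set X // U ∈ weakBall 𝕜 X}ᵒᵈ

instance : IsDirectedOrder (WeakNhd 𝕜 X) :=
  ⟨fun U V => ⟨OrderDual.toDual ⟨_, inter_mem (OrderDual.ofDual U).2 (OrderDual.ofDual V).2⟩,
    Set.inter_subset_left, Set.inter_subset_right⟩⟩

instance : Nonempty (WeakNhd 𝕜 X) := ⟨OrderDual.toDual ⟨Set.univ, univ_mem⟩⟩

theorem tendsto_atTop_of_mem_weakNhd {y : WeakNhd 𝕜 X → X}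
    (hy : ∀ U, y U ∈ (OrderDual.ofDual U).1) : Tendsto y atTop (weakBall 𝕜 X) := by
  intro U hU
  refine mem_map.2 ?_
  filter_upwards [eventually_ge_atTop (OrderDual.toDual ⟨U, hU⟩ : WeakNhd 𝕜 X)] with V hV
  exact hV (hy V)

/-- If the derived filter of `𝓟 K` of order `Ω` is non-trivial, then there are a collection of
vectors indexed by all sequences, and functionals in `K` for the strictly decreasing sequences of
ordinals below `Ω`, such that the functional of `t` is at least `β ζ` on the vector of each initial
segment `s ⌢ (ζ, U)` of `t`. Along a sequence with current term `ζ` the set of functionals that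
satisfy the inequalities so far remains frequent for the derived filter of order `ζ`. -/
theorem exists_tree_of_neBot {β : Ordinal.{v} → ℝ} {K : Set (WeakDual 𝕜 X)} {Ω : Ordinal.{v}}
    (hΩ : (filterIter β (𝓟 K) Ω).NeBot) :
    ∃ (x : List (Ordinal.{v} × WeakNhd 𝕜 X) → X)
      (f : List (Ordinal.{v} × WeakNhd 𝕜 X) → WeakDual 𝕜 X),
      (∀ t, ‖x t‖ ≤ 1) ∧
      (∀ t ζ, Tendsto (fun U => x (t ++ [(ζ, U)])) atTop (weakBall 𝕜 X)) ∧
      ∀ t, (t.map Prod.fst).Pairwise (· > ·) → (∀ o ∈ t.map Prod.fst, o < Ω) →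
        f t ∈ K ∧ ∀ s q, s ++ [q] <+: t → β q.1 ≤ RCLike.re (f t (x (s ++ [q]))) := by
  have hpick : ∀ (L : Set (WeakDual 𝕜 X)) (q : Ordinal.{v} × WeakNhd 𝕜 X),
      ∃ y : X, ‖y‖ ≤ 1 ∧ y ∈ (OrderDual.ofDual q.2).1 ∧
        ((∃ᶠ f in filterIter β (𝓟 K) (q.1 + 1), f ∈ L) →
          ∃ᶠ f in filterIter β (𝓟 K) q.1, f ∈ L ∧ β q.1 ≤ RCLike.re (f y)) := by
    rintro L ⟨o, U⟩
    by_cases h : ∃ᶠ f in filterIter β (𝓟 K) (o + 1), f ∈ L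
    · rw [filterIter_add_one, frequently_filterStep] at h
      obtain ⟨y, hy, hy1, hyU⟩ :=
        (h.and_eventually (eventually_weakBall_norm_le.and (OrderDual.ofDual U).2)).exists
      exact ⟨y, hy1, hyU, fun _ => hy.mono fun f hf => ⟨hf.2, hf.1⟩⟩
    · exact ⟨0, by simp, mem_pure.1 (pure_zero_le_weakBall (OrderDual.ofDual U).2),
        fun h' => absurd h' h⟩
  choose pick hnorm hmem hfreq using hpick
  -- the set of the functionals that satisfy the inequalities for all initial segments of `t`
  let A : List (Ordinal.{v} × WeakNhd 𝕜 X) → Set (WeakDual 𝕜 X) := fun t =>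
    t.foldl (fun L q => {f | f ∈ L ∧ β q.1 ≤ RCLike.re (f (pick L q))}) K
  have hA : ∀ t q, A (t ++ [q]) = {f | f ∈ A t ∧ β q.1 ≤ RCLike.re (f (pick (A t) q))} := by
    intro t q
    simp only [A, List.foldl_append, List.foldl_cons, List.foldl_nil]
  have hanti : ∀ t r, A (t ++ r) ⊆ A t := by
    intro t r
    induction r using List.reverseRecOn with
    | nil => rw [List.append_nil]
    | append_singleton r q ih =>
      rw [← List.append_assoc, hA]
      exact fun f hf => ih hf.1
  let x : List (Ordinal.{v} × WeakNhd 𝕜 X) → X := fun t =>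
    (t.getLast?).elim 0 (pick (A t.dropLast))
  have hx : ∀ t q, x (t ++ [q]) = pick (A t) q := by
    intro t q
    simp [x]
  have hfr : ∀ t, (t.map Prod.fst).Pairwise (· > ·) → (∀ o ∈ t.map Prod.fst, o < Ω) →
      ∀ o ≤ Ω, (∀ a ∈ t.map Prod.fst, o ≤ a) → ∃ᶠ f in filterIter β (𝓟 K) o, f ∈ A t := by
    intro t
    induction t using List.reverseRecOn with
    | nil =>
      intro _ _ o ho _
      have : (filterIter β (𝓟 K) o).NeBot := hΩ.mono (filterIter_anti ho)
      have hev : ∀ᶠ f in filterIter β (𝓟 K) o, f ∈ K := filterIter_le o (mem_principal_self K)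
      exact hev.frequently
    | append_singleton t q ih =>
      intro hdec hlt o _ hle
      rw [List.map_append, List.map_singleton] at hdec hlt hle
      have hq : q.1 + 1 ≤ Ω := Order.add_one_le_of_lt (hlt q.1 (by simp))
      have h1 := ih (List.pairwise_append.1 hdec).1 (fun a ha => hlt a (by simp [ha])) _ hq
        fun a ha => Order.add_one_le_of_lt ((List.pairwise_append.1 hdec).2.2 a ha q.1 (by simp))
      rw [hA]
      exact (hfreq _ q h1).filter_mono (filterIter_anti (hle q.1 (by simp)))
  have hf : ∀ t, ∃ f : WeakDual 𝕜 X, (t.map Prod.fst).Pairwise (· > ·) →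
      (∀ o ∈ t.map Prod.fst, o < Ω) → f ∈ A t := by
    intro t
    by_cases h : (t.map Prod.fst).Pairwise (· > ·) ∧ ∀ o ∈ t.map Prod.fst, o < Ω
    · obtain ⟨f, hf⟩ := (hfr t h.1 h.2 0 (by simp) (by simp)).exists
      exact ⟨f, fun _ _ => hf⟩
    · exact ⟨0, fun h1 h2 => absurd ⟨h1, h2⟩ h⟩
  choose f hf using hf
  refine ⟨x, f, fun t => ?_, fun t ζ => ?_, fun t h1 h2 => ⟨hanti [] t (hf t h1 h2), ?_⟩⟩
  · rcases List.eq_nil_or_concat t with rfl | ⟨s, q, rfl⟩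
    · simp [x]
    · rw [List.concat_eq_append, hx]
      exact hnorm _ _
  · simp only [hx]
    exact tendsto_atTop_of_mem_weakNhd fun U => hmem _ (ζ, U)
  · rintro s q ⟨r, rfl⟩
    have := hanti _ _ (hf _ h1 h2)
    rw [hA] at this
    rw [hx]
    exact this.2

open Classical in
/-- The function with the value `b (n - 1 - j)` at the ordinals with quotient `j` by `ω^ξ`. These
are the ordinals that occur in the level `Λ_{ξ,n,n-j}`. -/
def blockConst (ξ : Ordinal.{v}) (n : ℕ) (b : ℕ → ℝ) (o : Ordinal.{v}) : ℝ :=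
  if h : ∃ j : ℕ, o / ω ^ ξ = j then b (n - 1 - h.choose) else 0

theorem blockConst_of_div {ξ : Ordinal.{v}} {n j : ℕ} {b : ℕ → ℝ} {o : Ordinal.{v}}
    (h : o / ω ^ ξ = j) : blockConst ξ n b o = b (n - 1 - j) := by
  have h' : ∃ j : ℕ, o / ω ^ ξ = j := ⟨j, h⟩
  have e : h'.choose = j := Nat.cast_injective (h'.choose_spec.symm.trans h)
  rw [blockConst, dif_pos h', e]

theorem blockConst_mul_add {ξ : Ordinal.{v}} {n : ℕ} (j : ℕ) {b : ℕ → ℝ} {o : Ordinal.{v}}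
    (ho : o < ω ^ ξ) : blockConst ξ n b (ω ^ ξ * j + o) = b (n - 1 - j) :=
  blockConst_of_div (by
    rw [Ordinal.mul_add_div _ (opow_omega_ne_zero ξ), Ordinal.div_eq_zero_of_lt ho, add_zero])

/-- The filter derived from `𝓟 K` along `n` blocks of length `ω^ξ`, with the constant `b i` for the
block `z_{i+1}`. -/
def blockFilter (K : Set (WeakDual 𝕜 X)) (ξ : Ordinal.{v}) (n : ℕ) (b : ℕ → ℝ) :
    Filter (WeakDual 𝕜 X) :=
  filterIter (blockConst ξ n b) (𝓟 K) (ω ^ ξ * n)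

theorem iterateOps_le_blockFilter (K : Set (WeakDual 𝕜 X)) (ξ : Ordinal.{v}) (n : ℕ) (b : ℕ → ℝ) :
    iterateOps (fun j G => filterIter (fun _ : Ordinal.{v} => b (n - 1 - j)) G (ω ^ ξ)) n (𝓟 K) ≤
      blockFilter K ξ n b := by
  suffices ∀ m : ℕ, iterateOps (fun j G =>
      filterIter (fun _ : Ordinal.{v} => b (n - 1 - j)) G (ω ^ ξ)) m (𝓟 K) ≤
      filterIter (blockConst ξ n b) (𝓟 K) (ω ^ ξ * m) from this n
  intro m
  induction m with
  | zero => simp [iterateOps, filterIter_zero]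
  | succ m ih =>
    rw [iterateOps, Nat.cast_add_one, mul_add_one, filterIter_add]
    exact filterIter_mono (fun o ho => (blockConst_mul_add m ho).le) ih

theorem exists_functionals_of_neBot {K : Set (WeakDual 𝕜 X)} {ξ : Ordinal.{v}} {n : ℕ} {b : ℕ → ℝ}
    (h : (blockFilter K ξ n b).NeBot) :
    ∃ (x : List (Ordinal.{v} × WeakNhd 𝕜 X) → X)
      (f : List (Ordinal.{v} × WeakNhd 𝕜 X) → WeakDual 𝕜 X),
      IsWeaklyNullInBall 𝕜 ξ n x ∧
      (∀ t ∈ maxNodes (withDirs (WeakNhd 𝕜 X) (gamma ξ n)), f t ∈ K) ∧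
      ∀ i : ℕ, ∀ s ∈ withDirs (WeakNhd 𝕜 X) (level ξ n i),
        ∀ t ∈ maxNodes (withDirs (WeakNhd 𝕜 X) (gamma ξ n)),
          s <+: t → b i ≤ RCLike.re (f t (x s)) := by
  obtain ⟨x, f, hx, hlim, hf⟩ := exists_tree_of_neBot h
  refine ⟨x, f, ⟨fun t _ => hx t, fun t ζ _ φ => (weakBall_tendsto φ).comp (hlim t ζ)⟩,
    fun t ht => (hf t (gamma_pairwise_gt ht.1) (gamma_lt ht.1)).1, fun i s hs t ht hst => ?_⟩
  have hs : s.map Prod.fst ∈ level ξ n i := hs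
  rcases List.eq_nil_or_concat s with rfl | ⟨s, q, rfl⟩
  · exact absurd rfl (gamma_ne_nil (level_subset_gamma hs))
  · rw [List.concat_eq_append] at hs hst ⊢
    rw [List.map_append, List.map_singleton] at hs
    have := (hf t (gamma_pairwise_gt ht.1) (gamma_lt ht.1)).2 s q hst
    have hi := level_index_lt hs
    rwa [blockConst_of_div (level_getLast_div hs), show n - 1 - (n - 1 - i) = i by omega] at this

theorem blockFilter_le {K : Set (WeakDual 𝕜 X)} {ξ : Ordinal.{v}} {n i : ℕ} (hi : i < n)
    {b : ℕ → ℝ} :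
    blockFilter K ξ n b ≤ filterIter (fun _ : Ordinal.{v} => b i) (𝓟 K) (ω ^ ξ) := by
  have h1 : ω ^ ξ * ((n - 1 - i : ℕ) + 1 : Ordinal.{v}) ≤ ω ^ ξ * (n : Ordinal.{v}) := by
    refine mul_le_mul_right ?_ _
    exact_mod_cast (by omega : n - 1 - i + 1 ≤ n)
  refine (filterIter_anti h1).trans ?_
  rw [mul_add_one, filterIter_add]
  refine filterIter_mono (fun o ho => ?_) (filterIter_le _)
  rw [blockConst_mul_add _ ho, show n - 1 - (n - 1 - i) = i by omega]

theorem le_blockFilter {K : Set (WeakDual 𝕜 X)} {ξ : Ordinal.{v}} {n : ℕ} (hn : 1 ≤ n) (b : ℝ) :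
    filterIter (fun _ : Ordinal.{v} => b) (𝓟 K) (ω ^ ξ) ≤
      blockFilter K ξ n fun i => if i = n - 1 then b else 0 := by
  obtain ⟨m, rfl⟩ : ∃ m, n = 1 + m := ⟨n - 1, by omega⟩
  rw [blockFilter, Nat.cast_add, Nat.cast_one, mul_add, mul_one, filterIter_add]
  refine le_trans (filterIter_mono (fun o ho => ?_) le_rfl) (le_filterIter fun o ho => ?_)
  · have := blockConst_mul_add (ξ := ξ) (n := 1 + m) 0 (b := fun i => if i = 1 + m - 1 then b else 0)
      ho
    simp only [Nat.cast_zero, mul_zero, zero_add, Nat.sub_zero, if_true] at this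
    exact this.le
  · have hlt := (Ordinal.lt_mul_iff_div_lt (opow_omega_ne_zero ξ)).1 ho
    obtain ⟨j, hj⟩ := Ordinal.lt_omega0.1 (hlt.trans (natCast_lt_omega0 m))
    have hjm : j < m := by
      rw [hj] at hlt
      exact_mod_cast hlt
    rw [blockConst_of_div (j := 1 + j), if_neg (by omega)]
    have := Ordinal.mul_add_div (1 : Ordinal.{v}) (opow_omega_ne_zero ξ) o
    rw [mul_one] at this
    rw [this, hj]
    push_cast
    rfl

end Trees

/-! ### The norm of `ℓ_p^n` -/

section LpNorm

variable {F F' : Type*} [NormedAddCommGroup F] [NormedAddCommGroup F'] {p : ENNReal} {n : ℕ}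

theorem lpNorm_congr_norm (hp : 1 ≤ p) {a : Fin n → F} {b : Fin n → F'} (h : ∀ i, ‖a i‖ = ‖b i‖) :
    lpNorm p a = lpNorm p b := by
  by_cases hp' : p = ⊤
  · subst hp'
    simp only [lpNorm, PiLp.norm_eq_ciSup, h]
  · have : 0 < p.toReal := ENNReal.toReal_pos (one_pos.trans_le hp).ne' hp'
    simp only [lpNorm, PiLp.norm_eq_sum this, h]

theorem sum_norm_le_lpNorm (hp : 1 ≤ p) (a : Fin n → F) :
    ∑ i, ‖a i‖ ≤ (n : ℝ) ^ (1 - (p⁻¹).toReal) * lpNorm p a := by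
  by_cases hp' : p = ⊤
  · subst hp'
    simp only [lpNorm, PiLp.norm_eq_ciSup, ENNReal.inv_top, ENNReal.toReal_zero]
    have hle : ∀ i ∈ Finset.univ, ‖a i‖ ≤ ⨆ i, ‖a i‖ := fun i _ =>
      le_ciSup (f := fun i => ‖a i‖) (Set.finite_range _).bddAbove i
    simpa using Finset.sum_le_card_nsmul _ _ _ hle
  · have hp1 : 1 ≤ p.toReal := by
      rw [← ENNReal.toReal_one]
      exact ENNReal.toReal_mono hp' hp
    have hpos : 0 < p.toReal := one_pos.trans_le hp1
    have h0 : ∀ i ∈ Finset.univ, 0 ≤ ‖a i‖ := fun i _ => norm_nonneg _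
    have h := Real.rpow_sum_le_const_mul_sum_rpow_of_nonneg (s := Finset.univ)
      (f := fun i => ‖a i‖) hp1 h0
    rw [Finset.card_univ, Fintype.card_fin] at h
    have h' := Real.rpow_le_rpow (Real.rpow_nonneg (Finset.sum_nonneg h0) _) h
      (one_div_nonneg.2 hpos.le)
    rw [← Real.rpow_mul (Finset.sum_nonneg h0), mul_one_div_cancel hpos.ne', Real.rpow_one,
      Real.mul_rpow (by positivity) (Finset.sum_nonneg fun i _ => by positivity),
      ← Real.rpow_mul (by positivity)] at h'
    rw [lpNorm, PiLp.norm_eq_sum hpos, ENNReal.toReal_inv]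
    convert h' using 3
    field_simp

theorem lpNorm_eq_zero (hp : 1 ≤ p) {a : Fin n → F} : lpNorm p a = 0 ↔ a = 0 := by
  have : Fact (1 ≤ p) := ⟨hp⟩
  rw [lpNorm, norm_eq_zero, WithLp.toLp_eq_zero]

theorem lpNorm_smul_real (hp : 1 ≤ p) (c : ℝ) (a : Fin n → ℝ) :
    lpNorm p (fun i => c * a i) = |c| * lpNorm p a := by
  have : Fact (1 ≤ p) := ⟨hp⟩
  exact norm_smul c (WithLp.toLp p a : PiLp p fun _ : Fin n => ℝ)

theorem lpNorm_single (hp : 1 ≤ p) (i : Fin n) : lpNorm p (Pi.single i (1 : ℝ)) = 1 := by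
  have : Fact (1 ≤ p) := ⟨hp⟩
  exact (PiLp.norm_single p (fun _ => ℝ) i 1).trans norm_one

theorem lpNorm_nonneg (hp : 1 ≤ p) (a : Fin n → F) : 0 ≤ lpNorm p a := by
  have : Fact (1 ≤ p) := ⟨hp⟩
  exact norm_nonneg _

end LpNorm

section Alpha

variable {𝕜 : Type*} [RCLike 𝕜] {X : Type u} [NormedAddCommGroup X] [NormedSpace 𝕜 X]

/-! ### Rescaling a collection -/

theorem IsWeaklyNullInBall.smul {D : Type u} [Preorder D] {ξ : Ordinal.{v}} {n : ℕ}
    {x : List (Ordinal.{v} × D) → X} (hx : IsWeaklyNullInBall 𝕜 ξ n x)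
    {σ : List Ordinal.{v} → 𝕜} (hσ : ∀ t, ‖σ t‖ ≤ 1) :
    IsWeaklyNullInBall 𝕜 ξ n fun t => σ (t.map Prod.fst) • x t := by
  refine ⟨fun t ht => ?_, fun t ζ ht f => ?_⟩
  · rw [norm_smul]
    exact mul_le_one₀ (hσ _) (norm_nonneg _) (hx.1 t ht)
  · have := (hx.2 t ζ ht f).const_mul (σ (t.map Prod.fst ++ [ζ]))
    simpa using this

theorem blockVec_smul {D : Type u} {ξ : Ordinal.{v}} {n i : ℕ}
    {x : List (Ordinal.{v} × D) → X} {σ : List Ordinal.{v} → 𝕜} {c : 𝕜}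
    (hσ : ∀ t ∈ level ξ n i, σ t = c) (t : List (Ordinal.{v} × D)) :
    blockVec 𝕜 ξ n i (fun t => σ (t.map Prod.fst) • x t) t = c • blockVec 𝕜 ξ n i x t := by
  classical
  rw [blockVec, blockVec, Finset.smul_sum]
  refine Finset.sum_congr rfl fun k hk => ?_
  rw [hσ _ (Finset.mem_filter.1 hk).2, smul_comm]

theorem re_branchVec {D : Type u} {ξ : Ordinal.{v}} {n : ℕ} (f : WeakDual 𝕜 X) (a : Fin n → ℝ)
    (x : List (Ordinal.{v} × D) → X) (t : List (Ordinal.{v} × D)) :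
    RCLike.re (f (branchVec ξ (fun i => ((a i : ℝ) : 𝕜)) x t)) =
      ∑ i : Fin n, a i * RCLike.re (f (blockVec 𝕜 ξ n i x t)) := by
  simp only [branchVec, map_sum, map_smul, _root_.smul_eq_mul, RCLike.re_ofReal_mul]

/-! ### Support functions -/

theorem exists_norm_le_of_isCompact [CompleteSpace X] {K : Set (WeakDual 𝕜 X)} (hK : IsCompact K) :
    ∃ R : ℝ, ∀ f ∈ K, ‖WeakDual.toStrongDual f‖ ≤ R := by
  obtain ⟨R, hR⟩ := banach_steinhaus (g := fun f : K => WeakDual.toStrongDual f.1) fun x => by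
    obtain ⟨C, hC⟩ := hK.exists_bound_of_continuousOn (f := fun f : WeakDual 𝕜 X => f x)
      (WeakDual.eval_continuous x).continuousOn
    exact ⟨C, fun f => hC f.1 f.2⟩
  exact ⟨R, fun f hf => hR ⟨f, hf⟩⟩

variable {K : Set (WeakDual 𝕜 X)} {R : ℝ}

theorem le_supportFun (hK : ∀ f ∈ K, ‖WeakDual.toStrongDual f‖ ≤ R) {f : WeakDual 𝕜 X}
    (hf : f ∈ K) (x : X) : RCLike.re (f x) ≤ supportFun K x := by
  refine le_csSup ⟨R * ‖x‖, ?_⟩ ⟨f, hf, rfl⟩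
  rintro _ ⟨g, hg, rfl⟩
  exact (RCLike.re_le_norm _).trans ((WeakDual.toStrongDual g).le_of_opNorm_le (hK g hg) x)

/-- As `r_∅ = 0`, a set with a positive value of its support function is non-empty. -/
theorem exists_of_lt_supportFun {α : ℝ} (hα : 0 ≤ α) {x : X} (h : α < supportFun K x) :
    ∃ f ∈ K, α < RCLike.re (f x) := by
  have hne : ((fun f : WeakDual 𝕜 X => RCLike.re (f x)) '' K).Nonempty := by
    by_contra hcon
    rw [supportFun, Set.not_nonempty_iff_eq_empty.1 hcon, Real.sSup_empty] at h
    exact h.not_ge hα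
  obtain ⟨_, ⟨f, hf, rfl⟩, hlt⟩ := exists_lt_of_lt_csSup hne h
  exact ⟨f, hf, hlt⟩

/-! ### Bounds for `α_{ξ,p,n}(K)` -/

variable {ξ : Ordinal.{v}} {p : ENNReal} {n : ℕ}

theorem alpha_nonneg : 0 ≤ alpha ξ p n K := by
  refine le_sInf ?_
  rintro _ ⟨α, hα, rfl, -⟩
  exact_mod_cast hα.le

/-- Functionals that are at least `b i` on the vectors of the block `i` give a lower bound for
`alpha`, because `z_i^t` is an average of these vectors. -/
theorem le_alpha_of_functionals (hp : 1 ≤ p) (hK : ∀ f ∈ K, ‖WeakDual.toStrongDual f‖ ≤ R)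
    {a b : Fin n → ℝ} (ha : ∀ i, 0 ≤ a i) (hap : lpNorm p a ≤ 1)
    {D : Type u} [Preorder D] [IsDirectedOrder D] [Nonempty D] {x : List (Ordinal.{v} × D) → X}
    (hx : IsWeaklyNullInBall 𝕜 ξ n x) {f : List (Ordinal.{v} × D) → WeakDual 𝕜 X}
    (hf : ∀ t ∈ maxNodes (withDirs D (gamma ξ n)), f t ∈ K)
    (hb : ∀ i : Fin n, ∀ s ∈ withDirs D (level ξ n i), ∀ t ∈ maxNodes (withDirs D (gamma ξ n)),
      s <+: t → b i ≤ RCLike.re (f t (x s))) :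
    ((∑ i, a i * b i : ℝ) : EReal) ≤ alpha ξ p n K := by
  refine le_sInf ?_
  rintro _ ⟨α, hα, rfl, h⟩
  have h1 := h D (fun i => ((a i : ℝ) : 𝕜)) x hx
  rw [lpNorm_congr_norm (b := a) hp fun i => by simp] at h1
  have h2 : ((α * lpNorm p a : ℝ) : EReal) ≤ α := by
    exact_mod_cast mul_le_of_le_one_right hα.le hap
  refine le_trans (le_iInf₂ fun t ht => ?_) (h1.trans h2)
  refine EReal.coe_le_coe_iff.2 (le_trans ?_ (le_supportFun hK (hf t ht) _))
  rw [re_branchVec]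
  refine Finset.sum_le_sum fun i _ => mul_le_mul_of_nonneg_left ?_ (ha i)
  refine blockVec_mem (C := {y | b i ≤ RCLike.re (f t y)}) (fun m w hm hw => ?_) i.2
    (mem_maxNodes_withDirs.1 ht) fun r hr hrl => hb i r hrl t ht hr
  have hm' : (0 : ℝ) < m := by exact_mod_cast hm
  change b i ≤ _
  rw [re_average, le_inv_mul_iff₀ hm']
  have := Finset.card_nsmul_le_sum (Finset.range m) (fun j => RCLike.re (f t (w j))) (b i)
    fun j hj => hw j (Finset.mem_range.1 hj)
  simpa using this

theorem le_alpha_of_neBot (hp : 1 ≤ p) (hK : ∀ f ∈ K, ‖WeakDual.toStrongDual f‖ ≤ R)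
    {a : Fin n → ℝ} {b : ℕ → ℝ} (ha : ∀ i, 0 ≤ a i) (hap : lpNorm p a ≤ 1)
    (h : (blockFilter K ξ n b).NeBot) : ((∑ i : Fin n, a i * b i : ℝ) : EReal) ≤ alpha ξ p n K := by
  obtain ⟨x, f, hx, hf, hb⟩ := exists_functionals_of_neBot h
  exact le_alpha_of_functionals (b := fun i : Fin n => b i) hp hK ha hap hx hf fun i => hb i

/-- The coefficients can be assumed to be non-negative and of norm at most one: the arguments of
the coefficients are absorbed in the vectors. -/
theorem exists_of_lt_alpha (hp : 1 ≤ p) (hn : 1 ≤ n)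
    (hK : ∀ f ∈ K, ‖WeakDual.toStrongDual f‖ ≤ R) {α : ℝ} (hα : 0 ≤ α)
    (h : (α : EReal) < alpha ξ p n K) :
    ∃ (a : Fin n → ℝ) (D : Type u) (_ : Preorder D) (_ : IsDirectedOrder D) (_ : Nonempty D)
      (x : List (Ordinal.{v} × D) → X) (α' : ℝ), (∀ i, 0 ≤ a i) ∧ lpNorm p a ≤ 1 ∧
      IsWeaklyNullInBall 𝕜 ξ n x ∧ α < α' ∧
      ∀ t ∈ maxNodes (withDirs D (gamma ξ n)),
        α' < supportFun K (branchVec ξ (fun i => ((a i : ℝ) : 𝕜)) x t) := by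
  obtain ⟨β, hαβ, hβ⟩ := EReal.lt_iff_exists_real_btwn.1 h
  rw [EReal.coe_lt_coe_iff] at hαβ
  have hβ0 : 0 < β := hα.trans_lt hαβ
  have hcon : ∃ (D : Type u) (_ : Preorder D) (_ : IsDirectedOrder D) (_ : Nonempty D)
      (a : Fin n → 𝕜) (x : List (Ordinal.{v} × D) → X), IsWeaklyNullInBall 𝕜 ξ n x ∧
      ((β * lpNorm p a : ℝ) : EReal) < ⨅ t ∈ maxNodes (withDirs D (gamma ξ n)),
        ((supportFun K (branchVec ξ a x t) : ℝ) : EReal) := by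
    by_contra! hcon
    exact hβ.not_ge (sInf_le ⟨β, hβ0, rfl, fun D _ _ _ a x hx => hcon D _ ‹_› ‹_› a x hx⟩)
  obtain ⟨D, _, _, _, a, x, hx, hlt⟩ := hcon
  have hlt' : ∀ t ∈ maxNodes (withDirs D (gamma ξ n)),
      ∃ f ∈ K, β * lpNorm p a < RCLike.re (f (branchVec ξ a x t)) := fun t ht =>
    exists_of_lt_supportFun (mul_nonneg hβ0.le (lpNorm_nonneg hp a))
      (EReal.coe_lt_coe_iff.1 (hlt.trans_le (iInf₂_le t ht)))
  have hN : 0 < lpNorm p a := by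
    refine (lpNorm_nonneg hp a).lt_of_ne' fun h0 => ?_
    obtain ⟨t, ht⟩ := maxNodes_nonempty D ξ hn
    obtain ⟨f, -, hf⟩ := hlt' t ht
    rw [h0, (lpNorm_eq_zero hp).1 h0] at hf
    simp [branchVec] at hf
  set N := lpNorm p a
  -- `c i` is the argument of `a i`, and `σ` takes the value `c i` on the level with the index `i`
  have hc : ∀ i, ∃ c : 𝕜, ‖c‖ = 1 ∧ a i = ((‖a i‖ : ℝ) : 𝕜) * c := fun i => by
    obtain ⟨c, hc, h⟩ := RCLike.exists_norm_mul_eq_self (a i)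
    exact ⟨c, hc, by rw [mul_comm]; exact h.symm⟩
  choose c hc hac using hc
  have hσ : ∃ σ : List Ordinal.{v} → 𝕜, (∀ t, ‖σ t‖ ≤ 1) ∧
      ∀ i : Fin n, ∀ t ∈ level ξ n i, σ t = c i := by
    classical
    refine ⟨fun t => if h : ∃ i : Fin n, t ∈ level ξ n i then c h.choose else 0, fun t => ?_,
      fun i t ht => ?_⟩
    · dsimp only
      split_ifs with h
      · exact (hc _).le
      · simp
    · have h : ∃ i : Fin n, t ∈ level ξ n i := ⟨i, ht⟩
      have e : h.choose = i := Fin.ext (level_index_unique h.choose_spec ht)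
      simp only [dif_pos h, e]
  obtain ⟨σ, hσ1, hσ⟩ := hσ
  refine ⟨fun i => N⁻¹ * ‖a i‖, D, inferInstance, inferInstance, inferInstance,
    fun t => σ (t.map Prod.fst) • x t, β, fun i => by positivity, ?_, hx.smul hσ1, hαβ,
    fun t ht => ?_⟩
  · rw [lpNorm_smul_real hp, lpNorm_congr_norm (b := a) hp fun i => by simp, abs_of_pos (by positivity),
      inv_mul_cancel₀ hN.ne']
  · obtain ⟨f, hfK, hf⟩ := hlt' t ht
    refine lt_of_lt_of_le ?_ (le_supportFun hK hfK _)
    have e : branchVec ξ (fun i => ((N⁻¹ * ‖a i‖ : ℝ) : 𝕜)) (fun t => σ (t.map Prod.fst) • x t) t =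
        ((N⁻¹ : ℝ) : 𝕜) • branchVec ξ a x t := by
      rw [branchVec, branchVec, Finset.smul_sum]
      refine Finset.sum_congr rfl fun i _ => ?_
      rw [blockVec_smul (hσ i), smul_smul, smul_smul]
      congr 1
      conv_rhs => rw [hac i]
      push_cast
      ring
    rw [e, map_smul, _root_.smul_eq_mul, RCLike.re_ofReal_mul, lt_inv_mul_iff₀ hN, mul_comm]
    exact hf

/-- If the functionals of `K` are large on the combinations `∑ aᵢ z_i^t` for a cofinal set of
maximal members `t`, then their values on the blocks can be stabilized: along an ultrafilter, they
converge, and the limits provide the constants of a non-trivial derived filter. -/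
theorem exists_neBot_of_frequently (hK : ∀ f ∈ K, ‖WeakDual.toStrongDual f‖ ≤ R)
    {D : Type u} [Preorder D] {a : Fin n → ℝ} (ha : ∀ i, 0 ≤ a i)
    {x : List (Ordinal.{v} × D) → X} (hx : IsWeaklyNullInBall 𝕜 ξ n x) {α α' : ℝ} (hα : α < α')
    (h : ∃ᶠ t in cofinalFilter D ξ n,
      ∃ f ∈ K, α' < RCLike.re (f (branchVec ξ (fun i => ((a i : ℝ) : 𝕜)) x t))) :
    ∃ b : ℕ → ℝ, (∀ i, 0 ≤ b i) ∧ α < ∑ i : Fin n, a i * b i ∧ (blockFilter K ξ n b).NeBot := by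
  have hg : ∀ t, ∃ g : WeakDual 𝕜 X,
      (∃ f ∈ K, α' < RCLike.re (f (branchVec ξ (fun i => ((a i : ℝ) : 𝕜)) x t))) →
      g ∈ K ∧ α' < RCLike.re (g (branchVec ξ (fun i => ((a i : ℝ) : 𝕜)) x t)) := by
    intro t
    by_cases h : ∃ f ∈ K, α' < RCLike.re (f (branchVec ξ (fun i => ((a i : ℝ) : 𝕜)) x t))
    · exact ⟨h.choose, fun _ => h.choose_spec⟩
    · exact ⟨0, fun h' => absurd h' h⟩
  choose g hg using hg
  replace h := (h.mono fun t ht => hg t ht).and_eventually (eventually_cofinalFilter ξ n)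
  rw [frequently_iff_neBot] at h
  obtain ⟨𝒱, h𝒱⟩ := Ultrafilter.exists_le (cofinalFilter D ξ n ⊓ 𝓟 {t | (g t ∈ K ∧
    α' < RCLike.re (g t (branchVec ξ (fun i => ((a i : ℝ) : 𝕜)) x t))) ∧
    t.map Prod.fst ∈ maxNodes (gamma ξ n)})
  have hev : ∀ᶠ t in (𝒱 : Filter _), (g t ∈ K ∧
    α' < RCLike.re (g t (branchVec ξ (fun i => ((a i : ℝ) : 𝕜)) x t))) ∧
    t.map Prod.fst ∈ maxNodes (gamma ξ n) := h𝒱 (mem_inf_of_right (mem_principal_self _))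
  have hlim : ∀ i : ℕ, ∃ c : ℝ, i < n →
      Tendsto (fun t => RCLike.re (g t (blockVec 𝕜 ξ n i x t))) 𝒱 (𝓝 c) := by
    intro i
    by_cases hi : i < n
    · obtain ⟨c, -, hc⟩ := (isCompact_Icc (a := -R) (b := R)).ultrafilter_le_nhds
        (𝒱.map fun t => RCLike.re (g t (blockVec 𝕜 ξ n i x t))) (by
          rw [le_principal_iff, Ultrafilter.mem_coe, Ultrafilter.mem_map]
          filter_upwards [hev] with t ht
          have h1 := hx.norm_blockVec_le hi ht.2
          have h2 := re_apply_le (hK _ ht.1.1) ((norm_neg (blockVec 𝕜 ξ n i x t)).trans_le h1)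
          rw [map_neg, map_neg] at h2
          exact ⟨by linarith, re_apply_le (hK _ ht.1.1) h1⟩)
      exact ⟨c, fun _ => hc⟩
    · exact ⟨0, fun h => absurd h hi⟩
  choose c hc using hlim
  have hsum : α' ≤ ∑ i : Fin n, a i * c i := by
    refine ge_of_tendsto (tendsto_finsetSum _ fun i _ => (hc i i.2).const_mul (a i)) ?_
    filter_upwards [hev] with t ht
    rw [← re_branchVec]
    exact ht.1.2.le
  set S := ∑ i, a i with hS
  have hS0 : 0 ≤ S := Finset.sum_nonneg fun i _ => ha i
  obtain ⟨δ, hδ, hδS⟩ : ∃ δ > 0, 2 * δ * S < α' - α := by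
    refine ⟨(α' - α) / (2 * (S + 1)), div_pos (sub_pos.2 hα) (by positivity), ?_⟩
    have e : 2 * ((α' - α) / (2 * (S + 1))) * S = (α' - α) * (S / (S + 1)) := by
      field_simp
    rw [e]
    exact mul_lt_of_lt_one_right (sub_pos.2 hα) ((div_lt_one (by positivity)).2 (lt_add_one S))
  refine ⟨fun i => max (c i - 2 * δ) 0, fun i => le_max_right _ _, ?_, ?_⟩
  · calc α < ∑ i : Fin n, a i * c i - 2 * δ * S := by linarith
      _ = ∑ i : Fin n, a i * (c i - 2 * δ) := by
        rw [hS, Finset.mul_sum, ← Finset.sum_sub_distrib]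
        exact Finset.sum_congr rfl fun i _ => by ring
      _ ≤ _ := Finset.sum_le_sum fun i _ => mul_le_mul_of_nonneg_left (le_max_left _ _) (ha i)
  · have hbind := bind_blocks_le (D := D) (ξ := ξ) (R := R) (G := 𝓟 K)
      (T := fun j G => filterIter (fun _ : Ordinal.{v} => max (c (n - 1 - j) - 2 * δ) 0) G (ω ^ ξ))
      (P := fun j z => {f : WeakDual 𝕜 X | c (n - 1 - j) - δ ≤ RCLike.re (f z)})
      (fun j G => filterIter_le _)
      (fun j G hG x hx => by
        rcases le_total 0 (c (n - 1 - j) - 2 * δ) with h0 | h0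
        · rw [max_eq_left h0]
          exact bind_cofinalFilterOne_le ξ (by linarith) G hG x hx
        · rw [max_eq_right h0]
          exact (bind_le (Eventually.of_forall fun _ => inf_le_left)).trans
            (le_filterIter fun _ _ => le_rfl))
      (eventually_principal.2 hK) n x hx
    refine NeBot.mono ⟨fun hbot => ?_⟩ 
      (hbind.trans (iterateOps_le_blockFilter K ξ n fun i => max (c i - 2 * δ) 0))
    have hempty := mem_bind'.1 (empty_mem_iff_bot.2 hbot)
    have hclose : ∀ᶠ t in (𝒱 : Filter _), ∀ i ∈ Finset.range n,
        c i - δ ≤ RCLike.re (g t (blockVec 𝕜 ξ n i x t)) :=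
      (Finset.eventually_all _).2 fun i hi =>
        (hc i (Finset.mem_range.1 hi)).eventually_const_le (by linarith)
    obtain ⟨t, ht1, ht2, ht3⟩ := nonempty_of_mem
      (inter_mem (h𝒱.trans inf_le_left hempty) (inter_mem hclose hev))
    exact mem_inf_principal.1 ht1 ht3.1.1 fun j hj => ht2 _ (Finset.mem_range.2 (by omega))

theorem exists_neBot_of_lt_alpha (hp : 1 ≤ p) (hn : 1 ≤ n)
    (hK : ∀ f ∈ K, ‖WeakDual.toStrongDual f‖ ≤ R) {α : ℝ} (hα : 0 ≤ α)
    (h : (α : EReal) < alpha ξ p n K) :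
    ∃ (a : Fin n → ℝ) (b : ℕ → ℝ), (∀ i, 0 ≤ a i) ∧ lpNorm p a ≤ 1 ∧ (∀ i, 0 ≤ b i) ∧
      α < ∑ i : Fin n, a i * b i ∧ (blockFilter K ξ n b).NeBot := by
  obtain ⟨a, D, _, _, _, x, α', ha, hap, hx, hα', ht⟩ := exists_of_lt_alpha hp hn hK hα h
  have := neBot_cofinalFilter (D := D) ξ hn
  obtain ⟨b, hb, hlt, hne⟩ := exists_neBot_of_frequently hK ha hx hα'
    (((eventually_cofinalFilter ξ n).mono fun t h => exists_of_lt_supportFun (hα.trans hα'.le)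
      (ht t (mem_maxNodes_withDirs.2 h))).frequently)
  exact ⟨a, b, ha, hap, hb, hlt, hne⟩

/-- The right-hand side does not involve `n` and `p`: a non-trivial filter for `ω ^ ξ` derivations
is used with the coefficients concentrated in a single block. -/
theorem alpha_eq_zero_iff (hp : 1 ≤ p) (hn : 1 ≤ n)
    (hK : ∀ f ∈ K, ‖WeakDual.toStrongDual f‖ ≤ R) : alpha ξ p n K = 0 ↔
      ∀ b : ℝ, 0 < b → filterIter (fun _ : Ordinal.{v} => b) (𝓟 K) (ω ^ ξ) = ⊥ := by
  constructor
  · intro h b hb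
    by_contra hne
    have : (blockFilter K ξ n fun i => if i = n - 1 then b else 0).NeBot :=
      NeBot.mono ⟨hne⟩ (le_blockFilter hn b)
    have hle := le_alpha_of_neBot (a := Pi.single ⟨n - 1, by omega⟩ 1) hp hK
      (fun i => (Pi.single_nonneg.2 zero_le_one : (0 : Fin n → ℝ) ≤ _) i) (lpNorm_single hp _).le this
    rw [Finset.sum_eq_single (⟨n - 1, by omega⟩ : Fin n) (fun i _ hi => by simp [hi]) (by simp),
      h] at hle
    simp only [Pi.single_eq_same, if_true, one_mul] at hle
    exact hb.not_ge (by exact_mod_cast hle)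
  · intro h
    by_contra hne
    have hlt : ((0 : ℝ) : EReal) < alpha ξ p n K := alpha_nonneg.lt_of_ne' hne
    obtain ⟨a, b, ha, -, hb, hlt, hne⟩ := exists_neBot_of_lt_alpha hp hn hK le_rfl hlt
    obtain ⟨i, -, hi⟩ := Finset.exists_lt_of_sum_lt (s := Finset.univ) (f := fun _ : Fin n => (0 : ℝ))
      (g := fun i : Fin n => a i * b i) (by simpa using hlt)
    have hbi : 0 < b i := pos_of_mul_pos_right hi (ha i)
    exact (hne.mono (blockFilter_le i.2)).ne (h _ hbi)

theorem alpha_le (hp : 1 ≤ p) (hn : 1 ≤ n) (hR : 0 ≤ R)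
    (hK : ∀ f ∈ K, ‖WeakDual.toStrongDual f‖ ≤ R) :
    alpha ξ p n K ≤ (((n : ℝ) ^ (1 - (p⁻¹).toReal) * R : ℝ) : EReal) := by
  by_contra! hlt
  obtain ⟨γ, hγ, hγα⟩ := EReal.lt_iff_exists_real_btwn.1 hlt
  rw [EReal.coe_lt_coe_iff] at hγ
  have h0 : 0 ≤ (n : ℝ) ^ (1 - (p⁻¹).toReal) * R := by positivity
  refine hγα.not_ge (sInf_le ⟨γ, h0.trans_lt hγ, rfl, fun D _ _ _ a x hx => ?_⟩)
  obtain ⟨t, ht⟩ := maxNodes_nonempty D ξ hn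
  refine (iInf₂_le t ht).trans (EReal.coe_le_coe_iff.2 ?_)
  have hnorm : ‖branchVec ξ a x t‖ ≤ ∑ i, ‖a i‖ := by
    refine norm_sum_le_of_le _ fun i _ => ?_
    rw [norm_smul]
    exact mul_le_of_le_one_right (norm_nonneg _)
      (hx.norm_blockVec_le i.2 (mem_maxNodes_withDirs.1 ht))
  have hsum := sum_norm_le_lpNorm hp a
  refine Real.sSup_le ?_ (mul_nonneg (h0.trans hγ.le) (lpNorm_nonneg hp a))
  rintro _ ⟨f, hf, rfl⟩
  calc RCLike.re (f (branchVec ξ a x t)) ≤ R * ‖branchVec ξ a x t‖ :=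
        (RCLike.re_le_norm _).trans ((WeakDual.toStrongDual f).le_of_opNorm_le (hK f hf) _)
    _ ≤ R * ((n : ℝ) ^ (1 - (p⁻¹).toReal) * lpNorm p a) := by
        gcongr
        exact hnorm.trans hsum
    _ = (n : ℝ) ^ (1 - (p⁻¹).toReal) * R * lpNorm p a := by ring
    _ ≤ γ * lpNorm p a := mul_le_mul_of_nonneg_right hγ.le (lpNorm_nonneg hp a)

/-! ### The absolutely convex hull -/

theorem convex_norm_apply_le (x : X) (M : ℝ) : Convex ℝ {g : WeakDual 𝕜 X | ‖g x‖ ≤ M} := by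
  intro g hg h hh s t hs ht hst
  have e : (s • g + t • h) x = s • g x + t • h x := rfl
  have h1 : ‖s • g x‖ ≤ s * M := by
    rw [norm_smul, Real.norm_of_nonneg hs]
    exact mul_le_mul_of_nonneg_left hg hs
  have h2 : ‖t • h x‖ ≤ t * M := by
    rw [norm_smul, Real.norm_of_nonneg ht]
    exact mul_le_mul_of_nonneg_left hh ht
  have h3 : s * M + t * M = M := by rw [← add_mul, hst, one_mul]
  have h4 : ‖(s • g + t • h) x‖ ≤ M := by
    rw [e]
    exact (norm_add_le_of_le h1 h2).trans_eq h3
  exact h4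

theorem norm_apply_le_of_mem_hull {x : X} {M : ℝ} (hM : ∀ f ∈ K, ‖f x‖ ≤ M) {f : WeakDual 𝕜 X}
    (hf : f ∈ wkStarAbsConvexHull K) : ‖f x‖ ≤ M := by
  have hcl : IsClosed {g : WeakDual 𝕜 X | ‖g x‖ ≤ M} :=
    isClosed_le (WeakDual.eval_continuous x).norm continuous_const
  have hb : balancedHull 𝕜 K ⊆ {g : WeakDual 𝕜 X | ‖g x‖ ≤ M} := by
    intro g hg
    obtain ⟨r, hr, h, hh, rfl⟩ := mem_balancedHull_iff.1 hg
    have e : (r • h) x = r * h x := rfl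
    have h1 : ‖(r • h) x‖ ≤ M := by
      rw [e, norm_mul]
      exact (mul_le_of_le_one_left (norm_nonneg _) hr).trans (hM h hh)
    exact h1
  have h1 : convexHull ℝ (balancedHull 𝕜 K) ⊆ {g : WeakDual 𝕜 X | ‖g x‖ ≤ M} :=
    convexHull_min hb (convex_norm_apply_le x M)
  exact closure_minimal h1 hcl hf

theorem norm_le_of_mem_hull (hR : 0 ≤ R) (hK : ∀ f ∈ K, ‖WeakDual.toStrongDual f‖ ≤ R) :
    ∀ f ∈ wkStarAbsConvexHull K, ‖WeakDual.toStrongDual f‖ ≤ R := by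
  intro f hf
  refine ContinuousLinearMap.opNorm_le_bound _ hR fun x => ?_
  have h1 : ∀ g ∈ K, ‖g x‖ ≤ R * ‖x‖ := fun g hg =>
    (WeakDual.toStrongDual g).le_of_opNorm_le (hK g hg) x
  have h2 := norm_apply_le_of_mem_hull h1 hf
  exact h2

theorem subset_hull (K : Set (WeakDual 𝕜 X)) : K ⊆ wkStarAbsConvexHull K :=
  (subset_balancedHull 𝕜).trans ((subset_convexHull ℝ _).trans subset_closure)

theorem alpha_le_alpha_hull (hR : 0 ≤ R) (hK : ∀ f ∈ K, ‖WeakDual.toStrongDual f‖ ≤ R) :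
    alpha ξ p n K ≤ alpha ξ p n (wkStarAbsConvexHull K) := by
  have hsupp : ∀ x, supportFun K x ≤ supportFun (wkStarAbsConvexHull K) x := by
    intro x
    rcases K.eq_empty_or_nonempty with rfl | hne
    · simp [wkStarAbsConvexHull, supportFun, balancedHull]
    · refine csSup_le (hne.image _) ?_
      rintro _ ⟨f, hf, rfl⟩
      exact le_supportFun (norm_le_of_mem_hull hR hK) (subset_hull K hf) x
  refine sInf_le_sInf ?_
  rintro _ ⟨α, hα, rfl, h⟩
  refine ⟨α, hα, rfl, fun D _ _ _ a x hx => le_trans ?_ (h D a x hx)⟩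
  exact iInf₂_mono fun t _ => EReal.coe_le_coe_iff.2 (hsupp _)

/-- The value of the support function of the hull at `y` is at most `max_{f ∈ K} |f(y)|`. The
arguments of the numbers `f(y)` are stabilized along an ultrafilter and absorbed in the vectors. -/
theorem alpha_hull_le_alpha (hp : 1 ≤ p) (hn : 1 ≤ n) (hR : 0 ≤ R)
    (hK : ∀ f ∈ K, ‖WeakDual.toStrongDual f‖ ≤ R) :
    alpha ξ p n (wkStarAbsConvexHull K) ≤ alpha ξ p n K := by
  by_contra! hlt
  obtain ⟨γ, hγ, hγα⟩ := EReal.lt_iff_exists_real_btwn.1 hlt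
  have hγ0 : 0 ≤ γ := by exact_mod_cast alpha_nonneg.trans hγ.le
  obtain ⟨a, D, _, _, _, x, β, ha, hap, hx, hγβ, hβ⟩ :=
    exists_of_lt_alpha hp hn (norm_le_of_mem_hull hR hK) hγ0 hγα
  have hβ0 : 0 < β := hγ0.trans_lt hγβ
  set y := fun t => branchVec ξ (fun i => ((a i : ℝ) : 𝕜)) x t with hy
  have hex : ∀ t, ∃ c : 𝕜, ‖c‖ = 1 ∧ (t ∈ maxNodes (withDirs D (gamma ξ n)) →
      ∃ f ∈ K, β < ‖f (y t)‖ ∧ ((‖f (y t)‖ : ℝ) : 𝕜) = c * f (y t)) := by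
    intro t
    by_cases ht : t ∈ maxNodes (withDirs D (gamma ξ n))
    · obtain ⟨f, hf, hlt⟩ := exists_of_lt_supportFun hβ0.le (hβ t ht)
      obtain ⟨g, hg, hgt⟩ : ∃ g ∈ K, β < ‖g (y t)‖ := by
        by_contra! hcon
        exact (hlt.trans_le (RCLike.re_le_norm _)).not_ge (norm_apply_le_of_mem_hull hcon hf)
      obtain ⟨c, hc, hcg⟩ := RCLike.exists_norm_eq_mul_self (g (y t))
      exact ⟨c, hc, fun _ => ⟨g, hg, hgt, hcg⟩⟩
    · exact ⟨1, norm_one, fun h => absurd h ht⟩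
  choose c hc hcf using hex
  have := neBot_cofinalFilter (D := D) ξ hn
  obtain ⟨𝒱, h𝒱⟩ := Ultrafilter.exists_le (cofinalFilter D ξ n)
  obtain ⟨c₀, hc₀, hlim⟩ := (isCompact_sphere (0 : 𝕜) 1).ultrafilter_le_nhds (𝒱.map c) (by
    rw [le_principal_iff, Ultrafilter.mem_coe, Ultrafilter.mem_map]
    exact Eventually.of_forall fun t => by simpa using hc t)
  have hlim : Tendsto c 𝒱 (𝓝 c₀) := hlim
  have hclose : ∀ᶠ t in (𝒱 : Filter _), ‖c t - c₀‖ < (β - γ) / (2 * β) :=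
    (tendsto_iff_norm_sub_tendsto_zero.1 hlim).eventually_lt_const
      (div_pos (sub_pos.2 hγβ) (by positivity))
  have hx' := hx.smul (σ := fun _ => c₀) fun _ => by simpa using (mem_sphere_zero_iff_norm.1 hc₀).le
  obtain ⟨b, hb, hlt', hne⟩ := exists_neBot_of_frequently (α := γ) (α' := (β + γ) / 2) hK ha hx'
    (by linarith) (by
      refine Frequently.filter_mono (Eventually.frequently ?_) h𝒱
      filter_upwards [hclose, h𝒱 (eventually_cofinalFilter ξ n)] with t ht htmax
      obtain ⟨f, hf, hfβ, hfc⟩ := hcf t (mem_maxNodes_withDirs.2 htmax)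
      refine ⟨f, hf, ?_⟩
      have e : branchVec ξ (fun i => ((a i : ℝ) : 𝕜)) (fun t => c₀ • x t) t = c₀ • y t := by
        simp only [hy, branchVec, Finset.smul_sum]
        refine Finset.sum_congr rfl fun i _ => ?_
        rw [blockVec_smul (σ := fun _ => c₀) (c := c₀) fun _ _ => rfl, smul_comm]
      have e2 : f (c₀ • y t) = ((‖f (y t)‖ : ℝ) : 𝕜) - (c t - c₀) * f (y t) := by
        rw [hfc, map_smul, _root_.smul_eq_mul]
        ring
      rw [e, e2, map_sub, RCLike.ofReal_re]
      have h1 : RCLike.re ((c t - c₀) * f (y t)) ≤ (β - γ) / (2 * β) * ‖f (y t)‖ := by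
        refine (RCLike.re_le_norm _).trans ?_
        rw [norm_mul]
        gcongr
      have h2 : (β + γ) / 2 = β * (1 - (β - γ) / (2 * β)) := by
        field_simp
        ring
      have h3 : 0 < 1 - (β - γ) / (2 * β) := by
        rw [sub_pos, div_lt_one (by positivity)]
        linarith
      have h4 := mul_lt_mul_of_pos_right hfβ h3
      linarith)
  have := le_alpha_of_neBot hp hK ha hap hne
  exact (EReal.coe_lt_coe_iff.2 hlt').not_ge (this.trans hγ.le)

theorem alpha_hull (hp : 1 ≤ p) (hn : 1 ≤ n) (hR : 0 ≤ R)
    (hK : ∀ f ∈ K, ‖WeakDual.toStrongDual f‖ ≤ R) :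
    alpha ξ p n K = alpha ξ p n (wkStarAbsConvexHull K) :=
  le_antisymm (alpha_le_alpha_hull hR hK) (alpha_hull_le_alpha hp hn hR hK)

end Alpha

end WeakNullTrees

end

theorem theorem4p1 {𝕜 : Type*} [RCLike 𝕜] {X : Type u} [NormedAddCommGroup X]
    [NormedSpace 𝕜 X] [CompleteSpace X] (K : Set (WeakDual 𝕜 X)) (hK : IsCompact K)
    (ξ : Ordinal.{v}) (p : ENNReal) (hp : 1 ≤ p) :
    -- the stabilized description: cofinal sets of maximal members
    (∀ n : ℕ, 1 ≤ n → ∀ α : ℝ,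
      ((α : EReal) < alpha ξ p n K ↔
        ∃ (a : Fin n → ℝ) (D : Type u) (_ : Preorder D) (_ : IsDirectedOrder D) (_ : Nonempty D)
          (x : List (Ordinal.{v} × D) → X) (α' : ℝ),
          (∀ i, 0 ≤ a i) ∧ lpNorm p a ≤ 1 ∧
          IsWeaklyNullInBall 𝕜 ξ n x ∧ α < α' ∧
          IsCofinalIn ξ n
            {t | t ∈ maxNodes
                (withDirs D (gamma ξ n)) ∧
              α' < supportFun K
                (branchVec ξ (fun i => ((a i : ℝ) : 𝕜)) x t)})) ∧
    -- the stabilized description: trees and functionals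
    (∀ n : ℕ, 1 ≤ n → ∀ α : ℝ, (K.Nonempty ∨ 0 ≤ α) →
      ((α : EReal) < alpha ξ p n K ↔
        ∃ (a : Fin n → ℝ) (D : Type u) (_ : Preorder D) (_ : IsDirectedOrder D) (_ : Nonempty D)
          (x : List (Ordinal.{v} × D) → X) (f : List (Ordinal.{v} × D) → WeakDual 𝕜 X)
          (b : Fin n → ℝ),
          (∀ i, 0 ≤ a i) ∧ lpNorm p a ≤ 1 ∧
          IsWeaklyNullInBall 𝕜 ξ n x ∧
          (∀ t ∈ maxNodes
            (withDirs D (gamma ξ n)), f t ∈ K) ∧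
          (∀ i, 0 ≤ b i) ∧ α < ∑ i, a i * b i ∧
          ∀ i : Fin n, ∀ s ∈ withDirs D (level ξ n i),
            ∀ t ∈ maxNodes
              (withDirs D (gamma ξ n)),
            s <+: t → b i ≤ RCLike.re (f t (x s)))) ∧
    -- the case of value zero
    ((∃ n : ℕ, 1 ≤ n ∧ alpha ξ p n K = 0) ↔
      ∀ n : ℕ, 1 ≤ n → alpha ξ p n K = 0) ∧
    ((∀ n : ℕ, 1 ≤ n → alpha ξ p n K = 0) ↔
      szlenkIndex K ≤ ((Ordinal.omega0 ^ ξ : Ordinal.{v}) : WithTop Ordinal.{v})) ∧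
    -- the upper bound
    (∀ n : ℕ, 1 ≤ n → ∀ R : ℝ, 0 ≤ R → (∀ f ∈ K, ‖WeakDual.toStrongDual f‖ ≤ R) →
      alpha ξ p n K ≤ (((n : ℝ) ^ (1 - (p⁻¹).toReal) * R : ℝ) : EReal)) ∧
    -- passing to the weak*-closed absolutely convex hull
    (∀ n : ℕ, 1 ≤ n → alpha ξ p n K =
      alpha ξ p n (wkStarAbsConvexHull K)) ∧
    alphaSup ξ p K =
      alphaSup ξ p (wkStarAbsConvexHull K) := by
  obtain ⟨R₀, hR₀⟩ := exists_norm_le_of_isCompact hK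
  obtain ⟨R, hR, hKR⟩ : ∃ R : ℝ, 0 ≤ R ∧ ∀ f ∈ K, ‖WeakDual.toStrongDual f‖ ≤ R :=
    ⟨max R₀ 0, le_max_right _ _, fun f hf => (hR₀ f hf).trans (le_max_left _ _)⟩
  have hiff : ∀ n : ℕ, 1 ≤ n → (alpha ξ p n K = 0 ↔
      szlenkIndex K ≤ ((Ordinal.omega0 ^ ξ : Ordinal.{v}) : WithTop Ordinal.{v})) := fun n hn => by
    rw [alpha_eq_zero_iff hp hn hKR, szlenkIndex_le_iff, forall_szlenkIter_eq_empty_iff hK]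
  have hull : ∀ n : ℕ, 1 ≤ n → alpha ξ p n K = alpha ξ p n (wkStarAbsConvexHull K) := fun n hn =>
    alpha_hull hp hn hR hKR
  have hneg : ∀ n : ℕ, ∀ α : ℝ, α < 0 → (α : EReal) < alpha ξ p n K := fun n α hα =>
    lt_of_lt_of_le (by exact_mod_cast hα) alpha_nonneg
  refine ⟨fun n hn α => ⟨fun h => ?_, ?_⟩, fun n hn α hα => ⟨fun h => ?_, ?_⟩,
    ⟨fun ⟨m, hm, h⟩ n hn => (hiff n hn).2 ((hiff m hm).1 h), fun h => ⟨1, le_rfl, h 1 le_rfl⟩⟩,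
    ⟨fun h => (hiff 1 le_rfl).1 (h 1 le_rfl), fun h n hn => (hiff n hn).2 h⟩,
    fun n hn R hR hKR => alpha_le hp hn hR hKR, hull, ?_⟩
  · rcases lt_or_ge α 0 with hα | hα
    · -- all values of the support function at `0` vanish
      refine ⟨fun _ => 0, PUnit, inferInstance, inferInstance, inferInstance, fun _ => 0, α / 2,
        fun _ => le_rfl, ?_, ⟨fun _ _ => by simp, fun _ _ _ f => by simp⟩, by linarith, ?_⟩
      · rw [show (fun _ : Fin n => (0 : ℝ)) = 0 from rfl, (lpNorm_eq_zero hp).2 rfl]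
        exact zero_le_one
      · rw [isCofinalIn_iff fun _ h => h.1]
        have := neBot_cofinalFilter (D := PUnit.{u + 1}) ξ hn
        refine Eventually.frequently ?_
        filter_upwards [eventually_cofinalFilter ξ n] with t ht
        refine ⟨mem_maxNodes_withDirs.2 ht, ?_⟩
        have h0 : supportFun K (branchVec ξ (fun _ : Fin n => ((0 : ℝ) : 𝕜))
            (fun _ => (0 : X)) t) = 0 := by
          refine le_antisymm (Real.sSup_nonpos ?_) (Real.sSup_nonneg ?_) <;>
          · rintro _ ⟨f, -, rfl⟩
            simp [branchVec]
        rw [h0]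
        linarith
    · obtain ⟨a, D, i1, i2, i3, x, α', ha, hap, hx, hα', ht⟩ := exists_of_lt_alpha hp hn hKR hα h
      refine ⟨a, D, i1, i2, i3, x, α', ha, hap, hx, hα', ?_⟩
      rw [isCofinalIn_iff fun _ h => h.1]
      have := neBot_cofinalFilter (D := D) ξ hn
      refine Eventually.frequently ?_
      filter_upwards [eventually_cofinalFilter ξ n] with t htmax
      exact ⟨mem_maxNodes_withDirs.2 htmax, ht t (mem_maxNodes_withDirs.2 htmax)⟩
  · rintro ⟨a, D, _, _, _, x, α', ha, hap, hx, hα', hE⟩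
    rcases lt_or_ge α 0 with hα | hα
    · exact hneg n α hα
    · rw [isCofinalIn_iff fun _ h => h.1] at hE
      obtain ⟨b, -, hlt, hne⟩ := exists_neBot_of_frequently hKR ha hx hα'
        (hE.mono fun t ht => exists_of_lt_supportFun (hα.trans hα'.le) ht.2)
      exact (EReal.coe_lt_coe_iff.2 hlt).trans_le (le_alpha_of_neBot hp hKR ha hap hne)
  · rcases lt_or_ge α 0 with hα0 | hα0
    · obtain ⟨f, hf⟩ := hα.resolve_right hα0.not_ge
      refine ⟨fun _ => 0, PUnit, inferInstance, inferInstance, inferInstance, fun _ => 0,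
        fun _ => f, fun _ => 0, fun _ => le_rfl, ?_, ⟨fun _ _ => by simp, fun _ _ _ f => by simp⟩,
        fun _ _ => hf, fun _ => le_rfl, by simpa using hα0, fun _ _ _ _ _ _ => by simp⟩
      rw [show (fun _ : Fin n => (0 : ℝ)) = 0 from rfl, (lpNorm_eq_zero hp).2 rfl]
      exact zero_le_one
    · obtain ⟨a, b, ha, hap, hb, hlt, hne⟩ := exists_neBot_of_lt_alpha hp hn hKR hα0 h
      obtain ⟨x, f, hx, hf, hfb⟩ := exists_functionals_of_neBot hne
      exact ⟨a, WeakNhd 𝕜 X, inferInstance, inferInstance, inferInstance, x, f, fun i => b i, ha,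
        hap, hx, hf, fun i => hb i, hlt, fun i => hfb i⟩
  · rintro ⟨a, D, _, _, _, x, f, b, ha, hap, hx, hf, -, hlt, hfb⟩
    exact (EReal.coe_lt_coe_iff.2 hlt).trans_le
      (le_alpha_of_functionals hp hKR ha hap hx hf hfb)
  · exact iSup_congr fun n => iSup_congr (hull n)
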